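/- Let $u\colon\mathbb R^3\to\mathbb R^3$ be a smooth involution whose fixed point set is non-empty and whose differential at every fixed point is diagonalizable with eigenvalues $1,-1,-1$. For $i=0,1$ let $S_i\subset\mathbb R^3$ be a compact connected smoothly embedded surface (possibly with boundary) with $u(S_i)=S_i$, equipped with an area form $\Omega_i$ such that $u^*\Omega_i=\Omega_i$. Let $U_i\supseteq S_i$ be a $u$-invariant open set (for instance $U_i=\mathbb R^3$) and let $\xi_i=\ker\alpha_i$ be an invariant contact structure on $U_i$, that is, $\alpha_i$ is a smooth $1$-form on $U_i$ with $\alpha_i\wedge d\alpha_i>0$ and $u^*\alpha_i=-\alpha_i$. Let $X_i$ be the vector field on $S_i$ determined by $\Omega_i(X_i,\cdot)=\alpha_i|_{TS_i}$, which represents the characteristic foliation of $\xi_i$ on $S_i$. Let $\phi\colon S_0\to S_1$ be a diffeomorphism with $\phi\circ u=u\circ\phi$ on $S_0$ that matches the characteristic foliations, that is, $X_1=f\,\phi_*X_0$ for some smooth function $f\colon S_1\to(0,\infty)$ with $f\circ u=f$. Then there exist $u$-invariant open neighborhoods $\mathcal N(S_0)\subseteq U_0$ of $S_0$ and $\mathcal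 N(S_1)\subseteq U_1$ of $S_1$ and a diffeomorphism $\psi\colon\mathcal N(S_0)\to\mathcal N(S_1)$ such that $\psi\circ u=u\circ\psi$, $T\psi(\xi_0)=\xi_1$, and $\psi|_{S_0}=\phi$. -/

import Mathlib

open Set
open scoped ContDiff

noncomputable section

namespace EquivContact

/-- Euclidean three-space, with the orientation given by its standard basis. -/
abbrev R3 : Type := EuclideanSpace ℝ (Fin 3)

/-- The standard basis vectors of `R3`. -/
def stdVec (i : Fin 3) : R3 := EuclideanSpace.single i (1 : ℝ)

/-- Smooth involutions of `R3` with non-empty fixed point set, whose differential at every fixed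
point is diagonalizable as `[1] ⊕ [-1] ⊕ [-1]`. -/
structure IsAxialInvolution (u : R3 → R3) : Prop where
  smooth : ContDiff ℝ ∞ u
  involutive : Function.Involutive u
  exists_fixed : ∃ p, u p = p
  diagonal : ∀ p, u p = p → ∃ b : Module.Basis (Fin 3) ℝ R3,
    fderiv ℝ u p (b 0) = b 0 ∧ fderiv ℝ u p (b 1) = -b 1 ∧ fderiv ℝ u p (b 2) = -b 2

/-- Smoothness of a map on an arbitrary subset of `R3`: locally, the map is the restriction of a
smooth map defined on an open subset of `R3`. -/
def SmoothOnSet {F : Type*} [NormedAddCommGroup F] [NormedSpace ℝ F] (f : R3 → F) (S : Set R3) :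
    Prop :=
  ∀ p ∈ S, ∃ (V : Set R3) (g : R3 → F), IsOpen V ∧ p ∈ V ∧ ContDiffOn ℝ ∞ g V ∧ EqOn f g (S ∩ V)

/-- Compact connected smooth surfaces embedded in `R3`, possibly with boundary. Around each of its
points there are smooth coordinates of `R3` in which the surface is a piece of a plane (around
interior points) or of a closed half-plane (around boundary points). -/
structure IsCompactSurface (S : Set R3) : Prop where
  compact : IsCompact S
  connected : IsConnected S
  chart : ∀ p ∈ S, ∃ e : OpenPartialHomeomorph R3 R3, p ∈ e.source ∧
    ContDiffOn ℝ ∞ e e.source ∧ ContDiffOn ℝ ∞ e.symm e.target ∧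
    ((∀ x ∈ e.source, x ∈ S ↔ e x 2 = 0) ∨ (∀ x ∈ e.source, x ∈ S ↔ e x 2 = 0 ∧ 0 ≤ e x 1))

/-- The tangent plane `T_p S` of an embedded surface (possibly with boundary), as a subspace of
`R3`: the linear span of all limits of rescaled secant vectors of `S` at `p`. -/
def tangentPlane (S : Set R3) (p : R3) : Submodule ℝ R3 :=
  Submodule.span ℝ (tangentConeAt ℝ S p)

/-- `S` is preserved by `u`, and the 2-form `Ω` (of which only the restriction to the tangent planes
of `S` matters) is a `u`-invariant area form on `S`. -/
structure IsInvariantAreaForm (u : R3 → R3) (S : Set R3) (Ω : R3 → R3 [⋀^Fin 2]→L[ℝ] ℝ) :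
    Prop where
  mapsTo : MapsTo u S S
  smooth : SmoothOnSet Ω S
  nonvanishing : ∀ p ∈ S, ∃ v ∈ tangentPlane S p, ∃ w ∈ tangentPlane S p, Ω p ![v, w] ≠ 0
  invariant : ∀ p ∈ S, ∀ v ∈ tangentPlane S p, ∀ w ∈ tangentPlane S p,
    Ω (u p) ![fderiv ℝ u p v, fderiv ℝ u p w] = Ω p ![v, w]

/-- A `u`-oriented compact surface `(S, Ω)`. -/
structure IsUOrientedCompactSurface (u : R3 → R3) (S : Set R3) (Ω : R3 → R3 [⋀^Fin 2]→L[ℝ] ℝ) :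
    Prop where
  surface : IsCompactSurface S
  area : IsInvariantAreaForm u S Ω

/-- The exterior derivative `dα` of a 1-form. -/
def dForm (α : R3 → R3 →L[ℝ] ℝ) (p : R3) : R3 [⋀^Fin 2]→L[ℝ] ℝ :=
  extDeriv (fun x => ContinuousAlternatingMap.ofSubsingleton ℝ R3 ℝ (0 : Fin 1) (α x)) p

/-- The value of `α ∧ dα` at `p` on the standard basis of `R3`. -/
def contactVolume (α : R3 → R3 →L[ℝ] ℝ) (p : R3) : ℝ :=
  α p (stdVec 0) * dForm α p ![stdVec 1, stdVec 2] +
    α p (stdVec 1) * dForm α p ![stdVec 2, stdVec 0] +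
    α p (stdVec 2) * dForm α p ![stdVec 0, stdVec 1]

/-- `α` is a positive contact form on the `u`-invariant open set `U`, with `u^* α = -α`; that is,
`ker α` is an invariant positively cooriented contact structure on `U`. -/
structure IsInvariantContactForm (u : R3 → R3) (U : Set R3) (α : R3 → R3 →L[ℝ] ℝ) : Prop where
  isOpen : IsOpen U
  mapsTo : MapsTo u U U
  smooth : ContDiffOn ℝ ∞ α U
  positive : ∀ p ∈ U, 0 < contactVolume α p
  antiInvariant : ∀ p ∈ U, ∀ v : R3, α (u p) (fderiv ℝ u p v) = -α p v

/-- The contact plane at `p` of the contact structure `ξ = ker α`. -/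
def contactPlane (α : R3 → R3 →L[ℝ] ℝ) (p : R3) : Submodule ℝ R3 :=
  LinearMap.ker (α p : R3 →ₗ[ℝ] ℝ)

/-- `X` is the vector field on `S` with `i_X Ω = α|_{TS}` (contraction in the first entry). It
represents the characteristic foliation of `ker α` on `(S, Ω)`. On the points of `S` it is uniquely
determined, and it is smooth because `Ω` and `α` are. -/
def IsCharacteristicField (S : Set R3) (Ω : R3 → R3 [⋀^Fin 2]→L[ℝ] ℝ) (α : R3 → R3 →L[ℝ] ℝ)
    (X : R3 → R3) : Prop :=
  ∀ p ∈ S, X p ∈ tangentPlane S p ∧ ∀ v ∈ tangentPlane S p, Ω p ![X p, v] = α p v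

/-- Two vector fields on `S` represent the same singular foliation: they differ by a positive
smooth `u`-invariant factor. -/
def SameFoliation (u : R3 → R3) (S : Set R3) (X X' : R3 → R3) : Prop :=
  ∃ f : R3 → ℝ, SmoothOnSet f S ∧ (∀ p ∈ S, 0 < f p) ∧ (∀ p ∈ S, f (u p) = f p) ∧
    ∀ p ∈ S, X' p = f p • X p

/-- `φ` is a `u`-equivariant diffeomorphism from `S₀` onto `S₁`. -/
structure IsEquivariantDiffeo (u : R3 → R3) (S₀ S₁ : Set R3) (φ : PartialEquiv R3 R3) : Prop where
  source_eq : φ.source = S₀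
  target_eq : φ.target = S₁
  smooth : SmoothOnSet φ S₀
  smooth_symm : SmoothOnSet φ.symm S₁
  equivariant : ∀ p ∈ S₀, φ (u p) = u (φ p)

/-- The push-forward `φ_* X` of a vector field on `S₀ = φ.source`. On `T_p S₀` the derivative of
`φ` within `S₀` is the differential of `φ`. -/
def pushforward (φ : PartialEquiv R3 R3) (X : R3 → R3) (q : R3) : R3 :=
  fderivWithin ℝ φ φ.source (φ.symm q) (X (φ.symm q))

/-- `ψ` is a `u`-equivariant contactomorphism from the open `u`-invariant set `ψ.source` onto the
open `u`-invariant set `ψ.target`, for the contact structures `ker α₀` and `ker α₁`. -/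
structure IsEquivariantContacto (u : R3 → R3) (α₀ α₁ : R3 → R3 →L[ℝ] ℝ)
    (ψ : OpenPartialHomeomorph R3 R3) : Prop where
  source_invariant : MapsTo u ψ.source ψ.source
  target_invariant : MapsTo u ψ.target ψ.target
  smooth : ContDiffOn ℝ ∞ ψ ψ.source
  smooth_symm : ContDiffOn ℝ ∞ ψ.symm ψ.target
  equivariant : ∀ p ∈ ψ.source, ψ (u p) = u (ψ p)
  map_contactPlane : ∀ p ∈ ψ.source,
    (contactPlane α₀ p).map (fderiv ℝ ψ p : R3 →ₗ[ℝ] R3) = contactPlane α₁ (ψ p)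

end EquivContact

end

/-!
Extend `φ` to a smooth map `f` near `S₀`. Since `φ` matches the characteristic foliations, `f^* α₁`
and `h α₀` agree on `T S₀` for a nowhere vanishing function `h`, the product of the foliation factor
and the ratio of the area forms. By connectedness `h` has constant sign; changing the sign of `α₁`
and averaging over `u`, we may take `h` positive and invariant and replace `α₀` by `h α₀`. The
derivative of `f` transverse to `S₀` can then be chosen so that `f^* α₁ = α₀` on all of `T ℝ³` along
`S₀` and `f` preserves orientation: locally this is linear algebra, and the choices form a convex
set, so a partition of unity and an average over `u` give one global equivariant choice. The linear
interpolation between `α₀` and `f^* α₁` is now a path of contact forms near `S₀`, constant along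
`S₀`, and the equivariant Moser–Gray isotopy of this path fixes `S₀` pointwise.
-/

noncomputable section

open Set Filter Topology
open scoped ContDiff unitInterval Manifold

namespace EquivContact

section InverseFunction

variable {E F : Type*} [NormedAddCommGroup E] [NormedSpace ℝ E] [NormedAddCommGroup F]
  [NormedSpace ℝ F]

theorem comp_fderiv_symm {e : OpenPartialHomeomorph E F} {y : F} (hy : y ∈ e.target)
    (h : DifferentiableAt ℝ e (e.symm y)) (h' : DifferentiableAt ℝ e.symm y) :
    (fderiv ℝ e (e.symm y)).comp (fderiv ℝ e.symm y) = ContinuousLinearMap.id ℝ F :=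
  (h.hasFDerivAt.comp y h'.hasFDerivAt).unique <|
    (hasFDerivAt_id y).congr_of_eventuallyEq (e.eventually_right_inverse hy)

theorem fderiv_symm_comp {e : OpenPartialHomeomorph E F} {x : E} (hx : x ∈ e.source)
    (h : DifferentiableAt ℝ e x) (h' : DifferentiableAt ℝ e.symm (e x)) :
    (fderiv ℝ e.symm (e x)).comp (fderiv ℝ e x) = ContinuousLinearMap.id ℝ E :=
  (h'.hasFDerivAt.comp x h.hasFDerivAt).unique <|
    (hasFDerivAt_id x).congr_of_eventuallyEq (e.eventually_left_inverse hx)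

variable [CompleteSpace E]

theorem isOpen_image_of_hasStrictFDerivAt_equiv {f : E → F} {s : Set E} (hs : IsOpen s)
    (hf : ∀ x ∈ s, ∃ L : E ≃L[ℝ] F, HasStrictFDerivAt f (L : E →L[ℝ] F) x) : IsOpen (f '' s) := by
  rw [isOpen_iff_mem_nhds]
  rintro _ ⟨x, hx, rfl⟩
  obtain ⟨L, hL⟩ := hf x hx
  rw [← hL.map_nhds_eq_of_equiv]
  exact image_mem_map (hs.mem_nhds hx)

theorem exists_openPartialHomeomorph_of_isInvertible_fderiv {f : E → F} {W : Set E} (hW : IsOpen W)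
    (hf : ContDiffOn ℝ ∞ f W) (hinj : InjOn f W)
    (hf' : ∀ x ∈ W, (fderiv ℝ f x).IsInvertible) :
    ∃ e : OpenPartialHomeomorph E F, e.source = W ∧ (∀ x, e x = f x) ∧
      ContDiffOn ℝ ∞ e.symm e.target := by
  have hcd (x) (hx : x ∈ W) : ContDiffAt ℝ ∞ f x := hf.contDiffAt (hW.mem_nhds hx)
  have hstrict (x) (hx : x ∈ W) : ∃ L : E ≃L[ℝ] F, HasStrictFDerivAt f (L : E →L[ℝ] F) x := by
    obtain ⟨L, hL⟩ := hf' x hx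
    exact ⟨L, hL ▸ (hcd x hx).hasStrictFDerivAt (by simp)⟩
  have hopen : IsOpenMap (W.domRestrict f) := fun s hs => by
    have := isOpen_image_of_hasStrictFDerivAt_equiv (f := f) (hW.isOpenMap_subtype_val s hs)
      (by rintro _ ⟨y, -, rfl⟩; exact hstrict y y.2)
    rwa [image_image] at this
  let e : OpenPartialHomeomorph E F := OpenPartialHomeomorph.ofContinuousOpenRestrict
    (hinj.toPartialEquiv f W) hf.continuousOn hopen hW
  refine ⟨e, rfl, fun _ => rfl, fun y hy => ?_⟩
  have hx := e.map_target hy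
  obtain ⟨L, hL⟩ := hstrict _ hx
  exact (e.contDiffAt_symm hy (f₀' := L) hL.hasFDerivAt (hcd _ hx)).contDiffWithinAt

theorem exists_isOpen_injOn_of_isInvertible_fderiv {f : E → F} {K V : Set E} (hK : IsCompact K)
    (hV : IsOpen V) (hKV : K ⊆ V) (hf : ContDiffOn ℝ ∞ f V) (hinj : InjOn f K)
    (hf' : ∀ x ∈ K, (fderiv ℝ f x).IsInvertible) :
    ∃ W, IsOpen W ∧ K ⊆ W ∧ W ⊆ V ∧ InjOn f W ∧ ∀ x ∈ W, (fderiv ℝ f x).IsInvertible := by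
  have hcd (x) (hx : x ∈ V) : ContDiffAt ℝ ∞ f x := hf.contDiffAt (hV.mem_nhds hx)
  have hinv : IsOpen (V ∩ fderiv ℝ f ⁻¹' range ((↑) : (E ≃L[ℝ] F) → E →L[ℝ] F)) :=
    (hf.continuousOn_fderiv_of_isOpen hV (by simp)).isOpen_inter_preimage hV
      ContinuousLinearEquiv.isOpen
  have hlocal (x) (hx : x ∈ K) : ∃ t ∈ 𝓝 x, InjOn f t := by
    obtain ⟨L, hL⟩ := hf' x hx
    have hL' : HasStrictFDerivAt f (L : E →L[ℝ] F) x :=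
      hL ▸ (hcd x (hKV hx)).hasStrictFDerivAt (by simp)
    exact ⟨_, (hL'.toOpenPartialHomeomorph f).open_source.mem_nhds
      hL'.mem_toOpenPartialHomeomorph_source, (hL'.toOpenPartialHomeomorph f).injOn⟩
  obtain ⟨T, hTo, hKT, hT⟩ := hinj.exists_isOpen_superset hK
    (fun x hx => (hcd x (hKV hx)).continuousAt) hlocal
  exact ⟨T ∩ _, hTo.inter hinv, fun x hx => ⟨hKT hx, hKV hx, hf' x hx⟩, fun x hx => hx.2.1,
    hT.mono inter_subset_left, fun x hx => hx.2.2⟩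

end InverseFunction

section Postcomposition

universe v

variable {X : Type*} [TopologicalSpace X] [CompactSpace X]

/-- Pointwise application of a continuous family of operators to a continuous function. -/
def pointwiseApply (X : Type*) [TopologicalSpace X] [CompactSpace X] (E F : Type*)
    [NormedAddCommGroup E] [NormedSpace ℝ E] [NormedAddCommGroup F] [NormedSpace ℝ F] :
    C(X, E →L[ℝ] F) →L[ℝ] C(X, E) →L[ℝ] C(X, F) :=
  LinearMap.mkContinuous₂
    (LinearMap.mk₂ ℝ (fun (A : C(X, E →L[ℝ] F)) (h : C(X, E)) =>
      (⟨fun t => A t (h t), by fun_prop⟩ : C(X, F)))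
      (by intros; ext; simp) (by intros; ext; simp) (by intros; ext; simp) (by intros; ext; simp))
    1 (by
      intro A h
      rw [one_mul, ContinuousMap.norm_le _ (by positivity)]
      intro t
      exact (ContinuousLinearMap.le_opNorm _ _).trans
        (mul_le_mul (A.norm_coe_le_norm t) (h.norm_coe_le_norm t) (norm_nonneg _) (by positivity)))

@[simp] theorem pointwiseApply_apply {E F : Type*} [NormedAddCommGroup E] [NormedSpace ℝ E]
    [NormedAddCommGroup F] [NormedSpace ℝ F] (A : C(X, E →L[ℝ] F)) (h : C(X, E)) (t : X) :
    pointwiseApply X E F A h t = A t (h t) := rfl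

theorem hasFDerivAt_postcomp {E F : Type*} [NormedAddCommGroup E] [NormedSpace ℝ E]
    [NormedAddCommGroup F] [NormedSpace ℝ F] {f : C(E, F)} {f' : C(E, E →L[ℝ] F)}
    (hf : ∀ x, HasFDerivAt f (f' x) x) (γ : C(X, E)) :
    HasFDerivAt (fun γ : C(X, E) => f.comp γ) (pointwiseApply X E F (f'.comp γ)) γ := by
  rw [hasFDerivAt_iff_isLittleO_nhds_zero, Asymptotics.isLittleO_iff]
  intro ε hε
  -- `f'` is uniformly continuous at the points of the compact image of `γ`.
  obtain ⟨δ, hδ, hf'δ⟩ := Metric.mem_uniformity_dist.1 <|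
    (isCompact_range γ.continuous).uniformContinuousAt_of_continuousAt f'
      (fun x _ => f'.continuous.continuousAt) (Metric.dist_mem_uniformity hε)
  filter_upwards [Metric.ball_mem_nhds (0 : C(X, E)) hδ] with h hh
  rw [ContinuousMap.norm_le _ (by positivity)]
  intro t
  have hht : ‖h t‖ ≤ ‖h‖ := h.norm_coe_le_norm t
  have hmem : γ t + h t ∈ Metric.ball (γ t) δ := by
    simpa using hht.trans_lt (mem_ball_zero_iff.1 hh)
  have hf'γ : ∀ y ∈ Metric.ball (γ t) δ, ‖f' y - f' (γ t)‖ ≤ ε := fun y hy => by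
    rw [← dist_eq_norm, dist_comm]
    exact (hf'δ (by rwa [dist_comm]) (mem_range_self t)).le
  calc ‖f (γ t + h t) - f (γ t) - f' (γ t) (h t)‖
      ≤ ε * ‖γ t + h t - γ t‖ := by
        simpa using (convex_ball (γ t) δ).norm_image_sub_le_of_norm_hasFDerivWithin_le'
          (fun x _ => (hf x).hasFDerivWithinAt) hf'γ (Metric.mem_ball_self hδ) hmem
    _ ≤ ε * ‖h‖ := by rw [add_sub_cancel_left]; gcongr

theorem contDiff_nat_postcomp {E : Type v} [NormedAddCommGroup E] [NormedSpace ℝ E] (n : ℕ) :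
    ∀ {F : Type v} [NormedAddCommGroup F] [NormedSpace ℝ F] {f : C(E, F)} (_ : ContDiff ℝ ∞ f),
      ContDiff ℝ n (fun γ : C(X, E) => f.comp γ) := by
  induction n with
  | zero => exact fun {_ _ _ f} _ => contDiff_zero.2 (ContinuousMap.continuous_postcomp f)
  | succ n ih =>
    intro F _ _ f hf
    have hf' : ContDiff ℝ ∞ (fderiv ℝ f) := hf.fderiv_right (by simp)
    let f' : C(E, E →L[ℝ] F) := ⟨fderiv ℝ f, hf'.continuous⟩
    rw [Nat.cast_add, Nat.cast_one, contDiff_succ_iff_hasFDerivAt]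
    exact ⟨fun γ => pointwiseApply X E F (f'.comp γ),
      (ContinuousLinearMap.contDiff _).comp (ih (f := f') hf'),
      hasFDerivAt_postcomp fun x => (hf.differentiable (by simp) x).hasFDerivAt⟩

theorem contDiff_postcomp {E F : Type v} [NormedAddCommGroup E] [NormedSpace ℝ E]
    [NormedAddCommGroup F] [NormedSpace ℝ F] {f : C(E, F)} (hf : ContDiff ℝ ∞ f) :
    ContDiff ℝ ∞ (fun γ : C(X, E) => f.comp γ) :=
  contDiff_infty.2 fun n => contDiff_nat_postcomp n hf

end Postcomposition

section Volterra

variable {E : Type*} [NormedAddCommGroup E]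

/-- The extension of a path `I → E` to a curve on the whole real line, constant outside of the
unit interval. -/
abbrev pathExtend (γ : C(I, E)) : ℝ → E := IccExtend zero_le_one γ

theorem continuous_pathExtend (γ : C(I, E)) : Continuous (pathExtend γ) :=
  γ.continuous.Icc_extend'

variable [NormedSpace ℝ E]

/-- The primitive vanishing at `0` of a continuous function on the unit interval. -/
def primitive (E : Type*) [NormedAddCommGroup E] [NormedSpace ℝ E] : C(I, E) →L[ℝ] C(I, E) :=
  LinearMap.mkContinuous
    { toFun := fun g => ⟨fun t => ∫ s in (0 : ℝ)..t, pathExtend g s,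
        (intervalIntegral.continuous_primitive
          (fun _ _ => (continuous_pathExtend g).intervalIntegrable _ _) 0).comp
            continuous_subtype_val⟩
      map_add' := fun f g => by
        ext t
        exact intervalIntegral.integral_add ((continuous_pathExtend f).intervalIntegrable _ _)
          ((continuous_pathExtend g).intervalIntegrable _ _)
      map_smul' := fun c f => by
        ext t
        exact intervalIntegral.integral_smul c _ } 1 (by
    intro g
    rw [one_mul, ContinuousMap.norm_le _ (norm_nonneg g)]
    intro t
    refine (intervalIntegral.norm_integral_le_of_norm_le_const (C := ‖g‖)
      fun s _ => g.norm_coe_le_norm _).trans ?_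
    rw [sub_zero, abs_of_nonneg t.2.1]
    exact mul_le_of_le_one_right (norm_nonneg _) t.2.2)

theorem primitive_apply (g : C(I, E)) (t : I) :
    primitive E g t = ∫ s in (0 : ℝ)..t, pathExtend g s := rfl

@[simp] theorem primitive_zero (g : C(I, E)) : primitive E g 0 = 0 := by
  simp [primitive_apply]

theorem hasDerivWithinAt_primitive [CompleteSpace E] (g : C(I, E)) {t : ℝ} (ht : t ∈ I) :
    HasDerivWithinAt (pathExtend (primitive E g)) (pathExtend g t) I t := by
  have hderiv : HasDerivAt (fun t : ℝ => ∫ s in (0 : ℝ)..t, pathExtend g s) (pathExtend g t) t :=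
    ((continuous_pathExtend g).integral_hasStrictDerivAt 0 t).hasDerivAt
  refine hderiv.hasDerivWithinAt.congr_of_mem (fun s hs => ?_) ht
  rw [pathExtend, IccExtend_of_mem _ _ hs, primitive_apply]

/-- The Volterra operator `h ↦ ∫ A h`. -/
def volterra (A : C(I, E →L[ℝ] E)) : C(I, E) →L[ℝ] C(I, E) :=
  (primitive E).comp (pointwiseApply I E E A)

theorem volterra_apply (A : C(I, E →L[ℝ] E)) (h : C(I, E)) :
    volterra A h = primitive E (pointwiseApply I E E A h) := rfl

theorem norm_volterra_pow_apply_le (A : C(I, E →L[ℝ] E)) (h : C(I, E)) (n : ℕ) (t : I) :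
    ‖(volterra A ^ n) h t‖ ≤ ‖A‖ ^ n * ((t : ℝ) ^ n / n.factorial) * ‖h‖ := by
  induction n generalizing t with
  | zero => simpa using h.norm_coe_le_norm t
  | succ n ih =>
    have hint : ∫ s in (0 : ℝ)..t, ‖A‖ ^ (n + 1) * (s ^ n / n.factorial) * ‖h‖ =
        ‖A‖ ^ (n + 1) * ((t : ℝ) ^ (n + 1) / (n + 1).factorial) * ‖h‖ := by
      rw [intervalIntegral.integral_mul_const, intervalIntegral.integral_const_mul,
        intervalIntegral.integral_div, integral_pow, Nat.factorial_succ]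
      have : (n.factorial : ℝ) ≠ 0 := by positivity
      push_cast
      field_simp
      simp
    rw [pow_succ', mul_apply_eq_comp, volterra_apply, primitive_apply, ← hint]
    refine intervalIntegral.norm_integral_le_of_norm_le t.2.1 (Eventually.of_forall fun s hs => ?_)
      (Continuous.intervalIntegrable (by fun_prop) _ _)
    have hsI : s ∈ I := ⟨hs.1.le, hs.2.trans t.2.2⟩
    rw [pathExtend, IccExtend_of_mem _ _ hsI, pointwiseApply_apply]
    calc ‖A ⟨s, hsI⟩ ((volterra A ^ n) h ⟨s, hsI⟩)‖
        ≤ ‖A ⟨s, hsI⟩‖ * ‖(volterra A ^ n) h ⟨s, hsI⟩‖ := (A ⟨s, hsI⟩).le_opNorm _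
      _ ≤ ‖A‖ * (‖A‖ ^ n * (s ^ n / n.factorial) * ‖h‖) := by
        gcongr
        exacts [A.norm_coe_le_norm _, ih ⟨s, hsI⟩]
      _ = ‖A‖ ^ (n + 1) * (s ^ n / n.factorial) * ‖h‖ := by ring

theorem norm_volterra_pow_le (A : C(I, E →L[ℝ] E)) (n : ℕ) :
    ‖volterra A ^ n‖ ≤ ‖A‖ ^ n / n.factorial := by
  refine ContinuousLinearMap.opNorm_le_bound _ (by positivity) fun h => ?_
  rw [ContinuousMap.norm_le _ (by positivity)]
  intro t
  refine (norm_volterra_pow_apply_le A h n t).trans ?_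
  rw [← mul_div_assoc]
  gcongr
  exact mul_le_of_le_one_right (by positivity) (pow_le_one₀ t.2.1 t.2.2)

theorem isUnit_one_sub_volterra [CompleteSpace E] (A : C(I, E →L[ℝ] E)) :
    IsUnit (1 - volterra A) := by
  obtain ⟨n, hn⟩ : ∃ n : ℕ, ‖A‖ ^ n / n.factorial < 1 :=
    ((FloorSemiring.tendsto_pow_div_factorial_atTop ‖A‖).eventually_lt_const one_pos).exists
  have hpow : IsUnit (1 - volterra A ^ n) :=
    isUnit_one_sub_of_norm_lt_one (R := C(I, E) →L[ℝ] C(I, E))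
      ((norm_volterra_pow_le A n).trans_lt hn)
  have hcomm : Commute (1 - volterra A) (∑ i ∈ Finset.range n, volterra A ^ i) :=
    Commute.sum_right _ _ _ fun i _ =>
      ((Commute.one_left _).sub_left ((Commute.refl _).pow_right i))
  rw [← mul_neg_geom_sum, hcomm.isUnit_mul_iff] at hpow
  exact hpow.1

end Volterra

section IntegralCurves

variable {E : Type*} [NormedAddCommGroup E] [NormedSpace ℝ E]

theorem isIntegralCurveOn_Icc_unique {v : ℝ → E → E} {K : NNReal} {a b t₀ : ℝ}
    (hv : ∀ t ∈ Icc a b, LipschitzWith K (v t)) {γ γ' : ℝ → E}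
    (hγ : IsIntegralCurveOn γ v (Icc a b)) (hγ' : IsIntegralCurveOn γ' v (Icc a b))
    (ht₀ : t₀ ∈ Icc a b) (h : γ t₀ = γ' t₀) : EqOn γ γ' (Icc a b) := by
  have hleft : Icc a t₀ ⊆ Icc a b := Icc_subset_Icc_right ht₀.2
  have hright : Icc t₀ b ⊆ Icc a b := Icc_subset_Icc_left ht₀.1
  have hIic {c : ℝ → E} (hc : IsIntegralCurveOn c v (Icc a b)) (t) (ht : t ∈ Ioc a t₀) :
      HasDerivWithinAt c (v t (c t)) (Iic t) t :=
    (hc t ⟨ht.1.le, ht.2.trans ht₀.2⟩).mono_of_mem_nhdsWithin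
      (Icc_mem_nhdsLE_of_mem ⟨ht.1, ht.2.trans ht₀.2⟩)
  have hIci {c : ℝ → E} (hc : IsIntegralCurveOn c v (Icc a b)) (t) (ht : t ∈ Ico t₀ b) :
      HasDerivWithinAt c (v t (c t)) (Ici t) t :=
    (hc t ⟨ht₀.1.trans ht.1, ht.2.le⟩).mono_of_mem_nhdsWithin
      (Icc_mem_nhdsGE_of_mem ⟨ht₀.1.trans ht.1, ht.2⟩)
  rw [← Icc_union_Icc_eq_Icc ht₀.1 ht₀.2]
  refine EqOn.union ?_ ?_
  · exact ODE_solution_unique_of_mem_Icc_left (s := fun _ => univ)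
      (fun t ht => (hv t (hleft (Ioc_subset_Icc_self ht))).lipschitzOnWith)
      (hγ.continuousOn.mono hleft) (hIic hγ) (fun _ _ => trivial)
      (hγ'.continuousOn.mono hleft) (hIic hγ') (fun _ _ => trivial) h
  · exact ODE_solution_unique_of_mem_Icc_right (s := fun _ => univ)
      (fun t ht => (hv t (hright (Ico_subset_Icc_self ht))).lipschitzOnWith)
      (hγ.continuousOn.mono hright) (hIci hγ) (fun _ _ => trivial)
      (hγ'.continuousOn.mono hright) (hIci hγ') (fun _ _ => trivial) h

theorem eq_zero_of_isIntegralCurveOn_linear {A : ℝ → E →L[ℝ] E} {a b t₀ : ℝ}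
    (hA : ContinuousOn A (Icc a b)) {w : ℝ → E}
    (hw : IsIntegralCurveOn w (fun t => A t) (Icc a b)) (ht₀ : t₀ ∈ Icc a b) (h₀ : w t₀ = 0) :
    ∀ t ∈ Icc a b, w t = 0 := by
  obtain ⟨C, hC⟩ := isCompact_Icc.exists_bound_of_continuousOn hA
  have hlip : ∀ t ∈ Icc a b, LipschitzWith C.toNNReal (A t) := fun t ht =>
    (A t).lipschitz.weaken (NNReal.coe_le_coe.1 ((hC t ht).trans (Real.le_coe_toNNReal C)))
  exact isIntegralCurveOn_Icc_unique hlip hw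
    (fun t _ => by simpa using (hasDerivWithinAt_const t (Icc a b) (0 : E))) ht₀ h₀

theorem exists_isIntegralCurveOn_unitInterval [CompleteSpace E] {v : ℝ → E → E}
    {K L : NNReal} (hK : ∀ t ∈ I, LipschitzWith K (v t)) (hv : ∀ x, ContinuousOn (v · x) I)
    (hL : ∀ t ∈ I, ∀ x, ‖v t x‖ ≤ L) (x : E) :
    ∃ γ : C(I, E), γ 0 = x ∧ IsIntegralCurveOn (pathExtend γ) v I := by
  have hPL : IsPicardLindelof v (0 : I) x L 0 L K :=
    { lipschitzOnWith := fun t ht => (hK t ht).lipschitzOnWith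
      continuousOn := fun y _ => hv y
      norm_le := fun t ht y _ => hL t ht y
      mul_max_le := by simp }
  obtain ⟨c, hc0, hc⟩ := hPL.exists_eq_forall_mem_Icc_hasDerivWithinAt₀
  have hcc : IsIntegralCurveOn c v I := hc
  let γ : C(I, E) := ⟨fun t => c t, hcc.continuousOn.domRestrict⟩
  have hγ : EqOn (pathExtend γ) c I := fun t ht => IccExtend_of_mem _ _ ht
  refine ⟨γ, hc0, fun t ht => ?_⟩
  rw [hγ ht]
  exact (hcc t ht).congr_of_mem hγ ht

end IntegralCurves

section Flow

variable {E : Type*} [NormedAddCommGroup E]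

/-- The graph of a path. -/
def pathGraph (γ : C(I, E)) : C(I, ℝ × E) := ⟨fun t => (t, γ t), by fun_prop⟩

@[simp] theorem pathGraph_apply (γ : C(I, E)) (t : I) : pathGraph γ t = ((t : ℝ), γ t) := rfl

variable [NormedSpace ℝ E]

theorem pathGraph_eq_add : (pathGraph : C(I, E) → C(I, ℝ × E)) = fun γ =>
    pathGraph 0 + (ContinuousLinearMap.inr ℝ ℝ E).compLeftContinuous ℝ I γ := by
  ext γ t <;> simp

theorem hasFDerivAt_pathGraph (γ : C(I, E)) :
    HasFDerivAt pathGraph ((ContinuousLinearMap.inr ℝ ℝ E).compLeftContinuous ℝ I) γ := by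
  rw [pathGraph_eq_add]
  exact (ContinuousLinearMap.hasFDerivAt _).const_add _

theorem contDiff_pathGraph : ContDiff ℝ ∞ (pathGraph : C(I, E) → C(I, ℝ × E)) := by
  rw [pathGraph_eq_add]
  exact contDiff_const.add (ContinuousLinearMap.contDiff _)

/-- The linearization along a path of a time-dependent vector field. -/
def linearizationAlong {Y : C(ℝ × E, E)} (hY : ContDiff ℝ ∞ Y) (γ : C(I, E)) :
    C(I, E →L[ℝ] E) :=
  ⟨fun t => (fderiv ℝ Y (t, γ t)).comp (ContinuousLinearMap.inr ℝ ℝ E), by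
    have := hY.continuous_fderiv (by simp)
    fun_prop⟩

/-- The failure of a path `γ` to satisfy the integral equation `γ t = ∫₀ᵗ Y (s, γ s) ds`. It is
constant exactly for the integral curves of `Y`. -/
def integralDefect (Y : C(ℝ × E, E)) (γ : C(I, E)) : C(I, E) :=
  γ - primitive E (Y.comp (pathGraph γ))

theorem contDiff_integralDefect {Y : C(ℝ × E, E)} (hY : ContDiff ℝ ∞ Y) :
    ContDiff ℝ ∞ (integralDefect Y) :=
  contDiff_id.sub ((primitive E).contDiff.comp ((contDiff_postcomp hY).comp contDiff_pathGraph))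

theorem hasFDerivAt_integralDefect {Y : C(ℝ × E, E)} (hY : ContDiff ℝ ∞ Y) (γ : C(I, E)) :
    HasFDerivAt (integralDefect Y) (1 - volterra (linearizationAlong hY γ)) γ := by
  have hcomp := hasFDerivAt_postcomp (f' := ⟨fderiv ℝ Y, hY.continuous_fderiv (by simp)⟩)
    (fun x => (hY.differentiable (by simp) x).hasFDerivAt) (pathGraph γ)
  exact (hasFDerivAt_id γ).sub
    ((primitive E).hasFDerivAt.comp γ (hcomp.comp γ (hasFDerivAt_pathGraph γ)))

variable [CompleteSpace E]

theorem isInvertible_fderiv_integralDefect {Y : C(ℝ × E, E)} (hY : ContDiff ℝ ∞ Y) (γ : C(I, E)) :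
    (fderiv ℝ (integralDefect Y) γ).IsInvertible := by
  obtain ⟨U, hU⟩ := isUnit_one_sub_volterra (linearizationAlong hY γ)
  refine ⟨ContinuousLinearEquiv.unitsEquiv ℝ _ U, ?_⟩
  rw [(hasFDerivAt_integralDefect hY γ).fderiv, ← hU]
  rfl

theorem integralDefect_eq_const_iff (Y : C(ℝ × E, E)) (γ : C(I, E)) (x : E) :
    integralDefect Y γ = ContinuousMap.const I x ↔
      γ 0 = x ∧ IsIntegralCurveOn (pathExtend γ) (fun t y => Y (t, y)) I := by
  have hcurve (t) (ht : t ∈ I) :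
      Y (t, pathExtend γ t) = pathExtend (Y.comp (pathGraph γ)) t := by
    simp [pathExtend, IccExtend_of_mem _ _ ht]
  constructor
  · intro h
    have hγ : γ = ContinuousMap.const I x + primitive E (Y.comp (pathGraph γ)) :=
      sub_eq_iff_eq_add.1 h
    refine ⟨by simpa using congr($hγ 0), fun t ht => ?_⟩
    simp only [hcurve t ht]
    refine ((hasDerivWithinAt_primitive (Y.comp (pathGraph γ)) ht).const_add x).congr_of_mem
      (fun s _ => ?_) ht
    exact congr($hγ (projIcc 0 1 zero_le_one s))
  · rintro ⟨rfl, hγ⟩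
    ext t
    change γ t - primitive E (Y.comp (pathGraph γ)) t = γ 0
    have hint : ∫ s in (0 : ℝ)..t, pathExtend (Y.comp (pathGraph γ)) s =
        pathExtend γ t - pathExtend γ 0 := by
      refine intervalIntegral.integral_eq_sub_of_hasDerivAt_of_le t.2.1
        (continuous_pathExtend γ).continuousOn (fun s hs => ?_)
        ((continuous_pathExtend _).intervalIntegrable _ _)
      have hs1 : s < 1 := hs.2.trans_le t.2.2
      rw [← hcurve s ⟨hs.1.le, hs1.le⟩]
      exact (hγ s ⟨hs.1.le, hs1.le⟩).hasDerivAt (Icc_mem_nhds hs.1 hs1)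
    rw [primitive_apply, hint, pathExtend, IccExtend_val, IccExtend_left]
    exact sub_sub_cancel _ _

/-- `Γ` is the flow over the unit time interval of the time-dependent vector field `Y`: it sends a
point to the integral curve starting there, and it is smooth as a map into the Banach space of
continuous paths. -/
structure IsFlow (Y : ℝ × E → E) (Γ : E → C(I, E)) : Prop where
  contDiff : ContDiff ℝ ∞ Γ
  apply_zero : ∀ x, Γ x 0 = x
  isIntegralCurveOn : ∀ x, IsIntegralCurveOn (pathExtend (Γ x)) (fun t y => Y (t, y)) I

theorem exists_isFlow {Y : ℝ × E → E} (hY : ContDiff ℝ ∞ Y) {K L : NNReal}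
    (hK : LipschitzWith K Y) (hL : ∀ q, ‖Y q‖ ≤ L) : ∃ Γ, IsFlow Y Γ := by
  let Yc : C(ℝ × E, E) := ⟨Y, hY.continuous⟩
  have hlip (t) (_ : t ∈ I) : LipschitzWith K fun y => Y (t, y) := by
    simpa [Function.comp_def] using hK.comp (LipschitzWith.prodMk_left t)
  choose Γ hΓ0 hΓ using exists_isIntegralCurveOn_unitInterval hlip
    (fun x => (hY.continuous.comp (by fun_prop : Continuous fun t : ℝ => (t, x))).continuousOn)
    fun t _ x => hL (t, x)
  refine ⟨Γ, contDiff_iff_contDiffAt.2 fun x => ?_, hΓ0, hΓ⟩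
  have hsmooth := (contDiff_integralDefect (Y := Yc) hY).contDiffAt (x := Γ x)
  have hdefect (y) : integralDefect Yc (Γ y) = ContinuousMap.const I y :=
    (integralDefect_eq_const_iff Yc (Γ y) y).2 ⟨hΓ0 y, hΓ y⟩
  obtain ⟨L, hL⟩ := isInvertible_fderiv_integralDefect (Y := Yc) hY (Γ x)
  have hderiv : HasStrictFDerivAt (integralDefect Yc) (L : C(I, E) →L[ℝ] C(I, E)) (Γ x) :=
    hL ▸ hsmooth.hasStrictFDerivAt (by simp)
  -- Near the constant path `x`, the local inverse of `integralDefect` computes integral curves.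
  have hlocal : Γ =ᶠ[𝓝 x] fun y => hderiv.localInverse _ _ _ (ContinuousLinearMap.const ℝ I y) := by
    have hright := hderiv.eventually_right_inverse
    rw [hdefect x] at hright
    filter_upwards [(ContinuousLinearMap.const ℝ I (M := E)).continuous.continuousAt.eventually
      hright] with y hy
    obtain ⟨h0, hcurve⟩ := (integralDefect_eq_const_iff Yc _ y).1 hy
    ext t
    have h := isIntegralCurveOn_Icc_unique hlip (hΓ y) hcurve (left_mem_Icc.2 zero_le_one)
      (by simpa [pathExtend, IccExtend_left] using (hΓ0 y).trans h0.symm) t.2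
    simpa [pathExtend, IccExtend_val] using h
  refine ContDiffAt.congr_of_eventuallyEq ?_ hlocal
  refine ContDiffAt.comp x ?_ (ContinuousLinearMap.const ℝ I (M := E)).contDiff.contDiffAt
  have := hsmooth.to_localInverse (f' := L) hderiv.hasFDerivAt (by simp)
  rwa [hdefect x] at this

end Flow

namespace IsFlow

variable {E : Type*} [NormedAddCommGroup E] [NormedSpace ℝ E]
variable {Y : ℝ × E → E} {Γ : E → C(I, E)} {K : NNReal}

theorem apply_eq_of_isIntegralCurveOn (hΓ : IsFlow Y Γ) (hK : LipschitzWith K Y) {γ : C(I, E)}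
    (hγ : IsIntegralCurveOn (pathExtend γ) (fun t y => Y (t, y)) I) : Γ (γ 0) = γ := by
  ext t
  have hlip (t) (_ : t ∈ I) : LipschitzWith K fun y => Y (t, y) := by
    simpa [Function.comp_def] using hK.comp (LipschitzWith.prodMk_left t)
  have h := isIntegralCurveOn_Icc_unique hlip (hΓ.isIntegralCurveOn (γ 0)) hγ
    (left_mem_Icc.2 zero_le_one)
    (by simpa [pathExtend, IccExtend_left] using hΓ.apply_zero (γ 0)) t.2
  simpa [pathExtend, IccExtend_val] using h

theorem apply_eq_const (hΓ : IsFlow Y Γ) (hK : LipschitzWith K Y) {p : E}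
    (hp : ∀ t ∈ I, Y (t, p) = 0) : Γ p = ContinuousMap.const I p :=
  hΓ.apply_eq_of_isIntegralCurveOn hK (γ := ContinuousMap.const I p) fun t ht => by
    simpa [pathExtend, IccExtend, Function.comp_def, hp t ht] using
      hasDerivWithinAt_const t I p

theorem apply_comp (hΓ : IsFlow Y Γ) (hK : LipschitzWith K Y) {u : E → E} (hu : ContDiff ℝ ∞ u)
    {x : E} (hY : ∀ t : I, Y (t, u (Γ x t)) = fderiv ℝ u (Γ x t) (Y (t, Γ x t))) (t : I) :
    Γ (u x) t = u (Γ x t) := by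
  let γ : C(I, E) := ⟨fun t => u (Γ x t), hu.continuous.comp (Γ x).continuous⟩
  have hγ : IsIntegralCurveOn (pathExtend γ) (fun t y => Y (t, y)) I := fun t ht => by
    have h := (hu.differentiable (by simp) (pathExtend (Γ x) t)).hasFDerivAt.comp_hasDerivWithinAt t
      (hΓ.isIntegralCurveOn x t ht)
    simp only [pathExtend, IccExtend_of_mem _ _ ht] at h ⊢
    rwa [← hY ⟨t, ht⟩] at h
  have h := hΓ.apply_eq_of_isIntegralCurveOn hK hγ
  have h0 : γ 0 = u x := congrArg u (hΓ.apply_zero x)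
  rw [h0] at h
  exact congr($h t)

variable [CompleteSpace E]

theorem fderiv_eq (hΓ : IsFlow Y Γ) (hY : ContDiff ℝ ∞ Y) (x v : E) :
    fderiv ℝ Γ x v = ContinuousMap.const I v + volterra
      (linearizationAlong (Y := ⟨Y, hY.continuous⟩) hY (Γ x)) (fderiv ℝ Γ x v) := by
  let Yc : C(ℝ × E, E) := ⟨Y, hY.continuous⟩
  have hdefect : (fun y => integralDefect Yc (Γ y)) = ContinuousLinearMap.const ℝ I := by
    funext y
    exact (integralDefect_eq_const_iff Yc (Γ y) y).2 ⟨hΓ.apply_zero y, hΓ.isIntegralCurveOn y⟩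
  have hd : HasFDerivAt Γ (fderiv ℝ Γ x) x := (hΓ.contDiff.differentiable (by simp) x).hasFDerivAt
  have h := (hasFDerivAt_integralDefect (Y := Yc) hY (Γ x)).comp x hd
  rw [Function.comp_def, hdefect] at h
  have := congr($(h.unique (ContinuousLinearMap.hasFDerivAt _)) v)
  exact sub_eq_iff_eq_add.1 this

theorem fderiv_apply_zero (hΓ : IsFlow Y Γ) (hY : ContDiff ℝ ∞ Y) (x v : E) :
    fderiv ℝ Γ x v 0 = v := by
  rw [hΓ.fderiv_eq hY, ContinuousMap.add_apply, volterra_apply, primitive_zero, add_zero,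
    ContinuousMap.const_apply]

theorem isIntegralCurveOn_fderiv (hΓ : IsFlow Y Γ) (hY : ContDiff ℝ ∞ Y) (x v : E) :
    IsIntegralCurveOn (pathExtend (fderiv ℝ Γ x v))
      (fun t w => fderiv ℝ Y (t, pathExtend (Γ x) t) (0, w)) I := fun t ht => by
  have h := (hasDerivWithinAt_primitive (pointwiseApply I E E
    (linearizationAlong (Y := ⟨Y, hY.continuous⟩) hY (Γ x)) (fderiv ℝ Γ x v)) ht).const_add v
  have hval : pathExtend (pointwiseApply I E E
      (linearizationAlong (Y := ⟨Y, hY.continuous⟩) hY (Γ x)) (fderiv ℝ Γ x v)) t =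
      fderiv ℝ Y (t, pathExtend (Γ x) t) (0, pathExtend (fderiv ℝ Γ x v) t) := by
    simp only [pathExtend, IccExtend_of_mem _ _ ht]
    rfl
  rw [hval] at h
  exact h.congr_of_mem (fun s _ => congr($(hΓ.fderiv_eq hY x v) (projIcc 0 1 zero_le_one s))) ht

theorem fderiv_apply_injective (hΓ : IsFlow Y Γ) (hY : ContDiff ℝ ∞ Y) (x : E) (t : I) :
    Function.Injective fun v => fderiv ℝ Γ x v t := by
  refine (injective_iff_map_eq_zero ((ContinuousMap.evalCLM ℝ t).comp (fderiv ℝ Γ x))).2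
    fun v hv => ?_
  let A : ℝ → E →L[ℝ] E := fun t =>
    (fderiv ℝ Y (t, pathExtend (Γ x) t)).comp (ContinuousLinearMap.inr ℝ ℝ E)
  have hA : Continuous A := ((hY.continuous_fderiv (by simp)).comp
    (continuous_id.prodMk (continuous_pathExtend (Γ x)))).clm_comp continuous_const
  have h := eq_zero_of_isIntegralCurveOn_linear hA.continuousOn
    (hΓ.isIntegralCurveOn_fderiv hY x v) t.2 (by simpa [pathExtend, IccExtend_val] using hv) 0
    (left_mem_Icc.2 zero_le_one)
  rw [pathExtend, IccExtend_left] at h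
  exact (hΓ.fderiv_apply_zero hY x v).symm.trans h

end IsFlow

theorem exists_contDiff_hasCompactSupport_eqOn {E F : Type*} [NormedAddCommGroup E]
    [NormedSpace ℝ E] [FiniteDimensional ℝ E] [NormedAddCommGroup F] [NormedSpace ℝ F]
    {C R : Set E} {f : E → F} (hC : IsCompact C) (hR : IsOpen R) (hCR : C ⊆ R)
    (hf : ContDiffOn ℝ ∞ f R) :
    ∃ (g : E → F) (R' : Set E), ContDiff ℝ ∞ g ∧ HasCompactSupport g ∧
      IsOpen R' ∧ C ⊆ R' ∧ R' ⊆ R ∧ EqOn g f R' := by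
  obtain ⟨D, hD, hCD, hDR⟩ := exists_compact_between hC hR hCR
  obtain ⟨D', hD', hDD', hDR'⟩ := exists_compact_between hD hR hDR
  obtain ⟨χ, hχ, -, hsupp, hone⟩ := exists_contMDiff_support_eq_eq_one_iff (n := (⊤ : ℕ∞)) 𝓘(ℝ, E)
    (isOpen_interior (s := D')) hD.isClosed hDD'
  have hzero (x) (hx : x ∉ D') : χ x = 0 := by
    rw [← Function.notMem_support, hsupp]
    exact fun h => hx (interior_subset h)
  refine ⟨fun x => χ x • f x, interior D, contDiff_iff_contDiffAt.2 fun x => ?_,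
    HasCompactSupport.intro hD' fun x hx => by rw [hzero x hx, zero_smul],
    isOpen_interior, hCD, interior_subset.trans hDR,
    fun x hx => by simp only [(hone x).1 (interior_subset hx), one_smul]⟩
  by_cases hx : x ∈ R
  · exact hχ.contDiff.contDiffAt.smul (hf.contDiffAt (hR.mem_nhds hx))
  · refine (contDiffAt_const (c := (0 : F))).congr_of_eventuallyEq ?_
    filter_upwards [hD'.isClosed.isOpen_compl.mem_nhds fun h => hx (hDR' h)] with y hy
    rw [hzero y hy, zero_smul]

section LinearAlgebra

theorem isInvertible_of_det_ne_zero {E : Type*} [NormedAddCommGroup E] [NormedSpace ℝ E]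
    [FiniteDimensional ℝ E] {L : E →L[ℝ] E} (hL : L.det ≠ 0) : L.IsInvertible :=
  ⟨L.toContinuousLinearEquivOfDetNeZero hL, L.coe_toContinuousLinearEquivOfDetNeZero hL⟩

theorem det_comp {E : Type*} [NormedAddCommGroup E] [NormedSpace ℝ E] (L M : E →L[ℝ] E) :
    (L.comp M).det = L.det * M.det :=
  LinearMap.det_comp (L : E →ₗ[ℝ] E) (M : E →ₗ[ℝ] E)

theorem twoForm_self {E : Type*} [NormedAddCommGroup E] [NormedSpace ℝ E]
    (θ : E [⋀^Fin 2]→L[ℝ] ℝ) (v : E) : θ ![v, v] = 0 :=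
  θ.map_eq_zero_of_eq ![v, v] (i := 0) (j := 1) rfl (by simp)

/-- The bilinear map underlying a 2-form. -/
def toBilin {E : Type*} [NormedAddCommGroup E] [NormedSpace ℝ E] (θ : E [⋀^Fin 2]→L[ℝ] ℝ) :
    E →ₗ[ℝ] E →ₗ[ℝ] ℝ :=
  have update_zero (v w x : E) : Function.update ![v, w] 0 x = ![x, w] := by
    ext i : 1; fin_cases i <;> rfl
  have update_one (v w x : E) : Function.update ![v, w] 1 x = ![v, x] := by
    ext i : 1; fin_cases i <;> rfl
  LinearMap.mk₂ ℝ (fun v w => θ ![v, w])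
    (fun v v' w => by simpa only [update_zero] using θ.map_update_add ![v, w] 0 v v')
    (fun c v w => by simpa only [update_zero] using θ.map_update_smul ![v, w] 0 c v)
    (fun v w w' => by simpa only [update_one] using θ.map_update_add ![v, w] 1 w w')
    (fun c v w => by simpa only [update_one] using θ.map_update_smul ![v, w] 1 c w)

theorem toBilin_apply {E : Type*} [NormedAddCommGroup E] [NormedSpace ℝ E]
    (θ : E [⋀^Fin 2]→L[ℝ] ℝ) (v w : E) : toBilin θ v w = θ ![v, w] := rfl

theorem twoForm_swap {E : Type*} [NormedAddCommGroup E] [NormedSpace ℝ E]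
    (θ : E [⋀^Fin 2]→L[ℝ] ℝ) (v w : E) : θ ![v, w] = -θ ![w, v] := by
  have h := twoForm_self θ (v + w)
  rw [← toBilin_apply] at h
  simp only [map_add, LinearMap.add_apply, toBilin_apply, twoForm_self] at h
  linarith

theorem comp_vec_two {E F : Type*} (f : E → F) (v w : E) : f ∘ ![v, w] = ![f v, f w] := by
  ext i : 1; fin_cases i <;> rfl

theorem stdVec_apply (i j : Fin 3) : stdVec i j = if j = i then 1 else 0 := by
  simp [stdVec]

theorem eq_sum_stdVec (v : R3) : v = v 0 • stdVec 0 + v 1 • stdVec 1 + v 2 • stdVec 2 := by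
  ext i; fin_cases i <;> simp [stdVec_apply]

theorem covector_expand (A : R3 →L[ℝ] ℝ) (v : R3) :
    A v = v 0 * A (stdVec 0) + v 1 * A (stdVec 1) + v 2 * A (stdVec 2) := by
  conv_lhs => rw [eq_sum_stdVec v]
  simp only [map_add, map_smul, smul_eq_mul]

theorem twoForm_expand (θ : R3 [⋀^Fin 2]→L[ℝ] ℝ) (v w : R3) :
    θ ![v, w] = (v 1 * w 2 - v 2 * w 1) * θ ![stdVec 1, stdVec 2] +
      (v 2 * w 0 - v 0 * w 2) * θ ![stdVec 2, stdVec 0] +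
      (v 0 * w 1 - v 1 * w 0) * θ ![stdVec 0, stdVec 1] := by
  conv_lhs => rw [← toBilin_apply, eq_sum_stdVec v, eq_sum_stdVec w]
  simp only [map_add, map_smul, LinearMap.add_apply, LinearMap.smul_apply, toBilin_apply,
    twoForm_self, smul_eq_mul]
  rw [twoForm_swap θ (stdVec 1) (stdVec 0), twoForm_swap θ (stdVec 2) (stdVec 1),
    twoForm_swap θ (stdVec 0) (stdVec 2)]
  ring

/-- The standard volume form of `R3`. -/
def vol (v w n : R3) : ℝ := (EuclideanSpace.basisFun (Fin 3) ℝ).toBasis.det ![v, w, n]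

theorem vol_apply (v w n : R3) : vol v w n =
    (v 1 * w 2 - v 2 * w 1) * n 0 + (v 2 * w 0 - v 0 * w 2) * n 1 +
      (v 0 * w 1 - v 1 * w 0) * n 2 := by
  simp only [vol, Module.Basis.det_apply, Matrix.det_fin_three, Module.Basis.toMatrix_apply,
    EuclideanSpace.basisFun_toBasis, PiLp.basisFun_repr, Matrix.cons_val]
  ring

theorem vol_map (L : R3 →L[ℝ] R3) (v w n : R3) : vol (L v) (L w) (L n) = L.det * vol v w n := by
  rw [vol, vol, ContinuousLinearMap.det, ← Module.Basis.det_comp]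
  congr 1
  ext i : 1; fin_cases i <;> rfl

theorem vol_ne_zero_iff_linearIndependent (v w n : R3) :
    vol v w n ≠ 0 ↔ LinearIndependent ℝ ![v, w, n] := by
  rw [vol, ← isUnit_iff_ne_zero, ← Module.Basis.is_basis_iff_det]
  exact ⟨fun h => h.1, fun h => ⟨h, h.span_eq_top_of_card_eq_finrank (by simp)⟩⟩

theorem eq_zero_of_vol_eq_zero {v : R3} (hv : ∀ w n, vol v w n = 0) : v = 0 := by
  have h (i) : v i = vol v (stdVec (i + 1)) (stdVec (i + 2)) := by
    fin_cases i <;> simp [vol_apply, stdVec_apply]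
  ext i
  rw [h, hv]; rfl

/-- The coefficient of `A ∧ θ` with respect to the standard volume form of `R3`. -/
def wedge (A : R3 →L[ℝ] ℝ) (θ : R3 [⋀^Fin 2]→L[ℝ] ℝ) : ℝ :=
  A (stdVec 0) * θ ![stdVec 1, stdVec 2] + A (stdVec 1) * θ ![stdVec 2, stdVec 0] +
    A (stdVec 2) * θ ![stdVec 0, stdVec 1]

theorem wedge_mul_vol (A : R3 →L[ℝ] ℝ) (θ : R3 [⋀^Fin 2]→L[ℝ] ℝ) (v w n : R3) :
    wedge A θ * vol v w n = A v * θ ![w, n] + A w * θ ![n, v] + A n * θ ![v, w] := by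
  rw [covector_expand A v, covector_expand A w, covector_expand A n, twoForm_expand θ w n,
    twoForm_expand θ n v, twoForm_expand θ v w, wedge, vol_apply]
  ring

theorem wedge_comp (A : R3 →L[ℝ] ℝ) (θ : R3 [⋀^Fin 2]→L[ℝ] ℝ) (L : R3 →L[ℝ] R3) :
    wedge (A.comp L) (θ.compContinuousLinearMap L) = wedge A θ * L.det := by
  have hvol : vol (stdVec 0) (stdVec 1) (stdVec 2) = 1 := by simp [vol_apply, stdVec_apply]
  rw [← mul_one L.det, ← hvol, ← vol_map, wedge_mul_vol]
  simp only [wedge, ContinuousLinearMap.comp_apply,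
    ContinuousAlternatingMap.compContinuousLinearMap_apply, comp_vec_two]

theorem wedge_neg_neg (A : R3 →L[ℝ] ℝ) (θ : R3 [⋀^Fin 2]→L[ℝ] ℝ) :
    wedge (-A) (-θ) = wedge A θ := by
  simp [wedge]

end LinearAlgebra

section ExteriorDerivative

/-- The pull-back of a 1-form. -/
def pullbackForm (f : R3 → R3) (α : R3 → R3 →L[ℝ] ℝ) (x : R3) : R3 →L[ℝ] ℝ :=
  (α (f x)).comp (fderiv ℝ f x)

theorem contDiffOn_pullbackForm {f : R3 → R3} {α : R3 → R3 →L[ℝ] ℝ} {N O : Set R3}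
    (hN : IsOpen N) (hf : ContDiffOn ℝ ∞ f N) (hα : ContDiffOn ℝ ∞ α O) (hm : MapsTo f N O) :
    ContDiffOn ℝ ∞ (pullbackForm f α) N :=
  (hα.comp hf hm).clm_comp (hf.fderiv_of_isOpen hN (by simp))

theorem differentiableAt_ofSubsingleton {α : R3 → R3 →L[ℝ] ℝ} {p : R3}
    (h : DifferentiableAt ℝ α p) : DifferentiableAt ℝ
      (fun x => ContinuousAlternatingMap.ofSubsingleton ℝ R3 ℝ (0 : Fin 1) (α x)) p :=
  (ContinuousAlternatingMap.ofSubsingletonLIE (𝕜 := ℝ) (E := R3) (F := ℝ)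
    (0 : Fin 1)).differentiable.differentiableAt.comp p h

theorem dForm_apply {α : R3 → R3 →L[ℝ] ℝ} {p : R3} (h : DifferentiableAt ℝ α p) (v w : R3) :
    dForm α p ![v, w] = fderiv ℝ α p v w - fderiv ℝ α p w v := by
  have hconst (v) : fderiv ℝ (fun x => α x v) p = (fderiv ℝ α p).flip v := by
    ext w
    simp [fderiv_clm_apply h (differentiableAt_const v)]
  rw [dForm, extDeriv_apply (differentiableAt_ofSubsingleton h), Fin.sum_univ_two]
  simp [Fin.removeNth, Fin.succAbove, hconst, sub_eq_add_neg]

theorem dForm_neg (α : R3 → R3 →L[ℝ] ℝ) (p : R3) : dForm (fun x => -α x) p = -dForm α p := by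
  rw [← neg_one_smul ℝ (dForm α p), dForm, dForm, ← extDeriv_fun_smul]
  congr 1
  ext x v
  simp

theorem dForm_congr {α β : R3 → R3 →L[ℝ] ℝ} {p : R3} (h : α =ᶠ[𝓝 p] β) :
    dForm α p = dForm β p :=
  (h.fun_comp _).extDeriv_eq

theorem dForm_pullbackForm {f : R3 → R3} {α : R3 → R3 →L[ℝ] ℝ} {x : R3}
    (hf : ContDiffAt ℝ ∞ f x) (hα : DifferentiableAt ℝ α (f x)) :
    dForm (pullbackForm f α) x =
      (dForm α (f x)).compContinuousLinearMap (fderiv ℝ f x) :=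
  extDeriv_pullback (differentiableAt_ofSubsingleton hα) hf
    (by simp only [minSmoothness_of_isRCLikeNormedField]; exact WithTop.coe_le_coe.2 le_top)

theorem contDiffOn_dForm {α : R3 → R3 →L[ℝ] ℝ} {O : Set R3} (hO : IsOpen O)
    (hα : ContDiffOn ℝ ∞ α O) : ContDiffOn ℝ ∞ (dForm α) O :=
  (ContinuousAlternatingMap.alternatizeUncurryFinCLM ℝ R3 ℝ).contDiff.comp_contDiffOn
    (((ContinuousAlternatingMap.ofSubsingletonLIE (𝕜 := ℝ) (E := R3) (F := ℝ)
      (0 : Fin 1)).contDiff.comp_contDiffOn hα).fderiv_of_isOpen hO (by simp))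

theorem continuousOn_wedge {X : Type*} [TopologicalSpace X] {s : Set X} {A : X → R3 →L[ℝ] ℝ}
    {θ : X → R3 [⋀^Fin 2]→L[ℝ] ℝ} (hA : ContinuousOn A s) (hθ : ContinuousOn θ s) :
    ContinuousOn (fun x => wedge (A x) (θ x)) s := by
  have hA' (v) : ContinuousOn (fun x => A x v) s := hA.clm_apply continuousOn_const
  have hθ' (v) : ContinuousOn (fun x => θ x v) s :=
    (ContinuousAlternatingMap.apply ℝ R3 ℝ v).continuous.comp_continuousOn hθ
  exact (((hA' _).mul (hθ' _)).add ((hA' _).mul (hθ' _))).add ((hA' _).mul (hθ' _))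

theorem contDiffOn_wedge {X : Type*} [NormedAddCommGroup X] [NormedSpace ℝ X] {s : Set X}
    {A : X → R3 →L[ℝ] ℝ} {θ : X → R3 [⋀^Fin 2]→L[ℝ] ℝ} (hA : ContDiffOn ℝ ∞ A s)
    (hθ : ContDiffOn ℝ ∞ θ s) : ContDiffOn ℝ ∞ (fun x => wedge (A x) (θ x)) s := by
  have hA' (v) : ContDiffOn ℝ ∞ (fun x => A x v) s := hA.clm_apply contDiffOn_const
  have hθ' (v) : ContDiffOn ℝ ∞ (fun x => θ x v) s :=
    (ContinuousAlternatingMap.apply ℝ R3 ℝ v).contDiff.comp_contDiffOn hθ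
  exact (((hA' _).mul (hθ' _)).add ((hA' _).mul (hθ' _))).add ((hA' _).mul (hθ' _))

theorem contactVolume_eq_wedge (α : R3 → R3 →L[ℝ] ℝ) (p : R3) :
    contactVolume α p = wedge (α p) (dForm α p) := rfl

theorem contactVolume_pullbackForm {f : R3 → R3} {α : R3 → R3 →L[ℝ] ℝ} {x : R3}
    (hf : ContDiffAt ℝ ∞ f x) (hα : DifferentiableAt ℝ α (f x)) :
    contactVolume (pullbackForm f α) x = contactVolume α (f x) * (fderiv ℝ f x).det := by
  rw [contactVolume_eq_wedge, dForm_pullbackForm hf hα, pullbackForm, wedge_comp,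
    contactVolume_eq_wedge]

theorem fderiv_comp_fderiv_of_involutive {E : Type*} [NormedAddCommGroup E] [NormedSpace ℝ E]
    {u : E → E} (hu : Differentiable ℝ u) (hui : Function.Involutive u) (x : E) :
    (fderiv ℝ u (u x)).comp (fderiv ℝ u x) = ContinuousLinearMap.id ℝ E := by
  have h := (hu (u x)).hasFDerivAt.comp x (hu x).hasFDerivAt
  rw [hui.comp_self] at h
  exact h.unique (hasFDerivAt_id x)

theorem fderiv_apply_fderiv_of_involutive {E : Type*} [NormedAddCommGroup E] [NormedSpace ℝ E]
    {u : E → E} (hu : Differentiable ℝ u) (hui : Function.Involutive u) (x v : E) :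
    fderiv ℝ u (u x) (fderiv ℝ u x v) = v :=
  congr($(fderiv_comp_fderiv_of_involutive hu hui x) v)

end ExteriorDerivative

namespace IsInvariantContactForm

variable {u : R3 → R3} {U : Set R3} {α : R3 → R3 →L[ℝ] ℝ}

theorem differentiableAt (hα : IsInvariantContactForm u U α) {p : R3} (hp : p ∈ U) :
    DifferentiableAt ℝ α p :=
  (hα.smooth.contDiffAt (hα.isOpen.mem_nhds hp)).differentiableAt (by simp)

theorem comp_fderiv (hα : IsInvariantContactForm u U α) {p : R3} (hp : p ∈ U) :
    (α (u p)).comp (fderiv ℝ u p) = -α p :=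
  ContinuousLinearMap.ext (hα.antiInvariant p hp)

theorem dForm_comp_fderiv (hα : IsInvariantContactForm u U α) (hu : ContDiff ℝ ∞ u) {p : R3}
    (hp : p ∈ U) : (dForm α (u p)).compContinuousLinearMap (fderiv ℝ u p) = -dForm α p := by
  have h : pullbackForm u α =ᶠ[𝓝 p] fun x => -α x := by
    filter_upwards [hα.isOpen.mem_nhds hp] with x hx using hα.comp_fderiv hx
  rw [← dForm_pullbackForm hu.contDiffAt (hα.differentiableAt (hα.mapsTo hp)), dForm_congr h,
    dForm_neg]

theorem ne_zero (hα : IsInvariantContactForm u U α) {p : R3} (hp : p ∈ U) : α p ≠ 0 := by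
  intro h
  have := hα.positive p hp
  simp [contactVolume, h] at this

theorem neg (hα : IsInvariantContactForm u U α) :
    IsInvariantContactForm u U fun x => -α x where
  isOpen := hα.isOpen
  mapsTo := hα.mapsTo
  smooth := hα.smooth.neg
  positive p hp := by
    rw [contactVolume_eq_wedge, dForm_neg, wedge_neg_neg]
    exact hα.positive p hp
  antiInvariant p hp v := congrArg Neg.neg (hα.antiInvariant p hp v)

end IsInvariantContactForm

section MoserVector

/-- The solution `Y` of `A Y = 0`, `ι_Y θ + B ∈ ℝ A`, where `A ∧ θ ≠ 0`. -/
def moserVector (A B : R3 →L[ℝ] ℝ) (θ : R3 [⋀^Fin 2]→L[ℝ] ℝ) : R3 :=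
  (wedge A θ)⁻¹ • ((A (stdVec 1) * B (stdVec 2) - A (stdVec 2) * B (stdVec 1)) • stdVec 0 +
    (A (stdVec 2) * B (stdVec 0) - A (stdVec 0) * B (stdVec 2)) • stdVec 1 +
    (A (stdVec 0) * B (stdVec 1) - A (stdVec 1) * B (stdVec 0)) • stdVec 2)

theorem apply_moserVector (A B : R3 →L[ℝ] ℝ) (θ : R3 [⋀^Fin 2]→L[ℝ] ℝ) :
    A (moserVector A B θ) = 0 := by
  simp only [moserVector, map_smul, map_add, smul_eq_mul]
  ring

theorem contract_moserVector {A : R3 →L[ℝ] ℝ} (B : R3 →L[ℝ] ℝ) {θ : R3 [⋀^Fin 2]→L[ℝ] ℝ}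
    (h : wedge A θ ≠ 0) (v : R3) :
    θ ![moserVector A B θ, v] + B v = wedge B θ / wedge A θ * A v := by
  rw [twoForm_expand, covector_expand B v, covector_expand A v]
  simp only [moserVector, PiLp.add_apply, PiLp.smul_apply, smul_eq_mul, stdVec_apply,
    Fin.reduceEq, if_true, if_false, mul_one, mul_zero, add_zero, zero_add]
  field_simp
  unfold wedge
  ring

theorem moserVector_smul_self (A : R3 →L[ℝ] ℝ) (θ : R3 [⋀^Fin 2]→L[ℝ] ℝ) (c : ℝ) :
    moserVector A (c • A) θ = 0 := by
  have h (i j) : A (stdVec i) * (c * A (stdVec j)) - A (stdVec j) * (c * A (stdVec i)) = 0 := by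
    ring
  simp only [moserVector, smul_apply, smul_eq_mul, h, zero_smul, add_zero, smul_zero]

theorem eq_zero_of_contract_eq {A : R3 →L[ℝ] ℝ} {θ : R3 [⋀^Fin 2]→L[ℝ] ℝ} (h : wedge A θ ≠ 0)
    {z : R3} (hz : A z = 0) {μ : ℝ} (hμ : ∀ v, θ ![z, v] = μ * A v) : z = 0 := by
  refine eq_zero_of_vol_eq_zero fun w n => (mul_eq_zero.1 ?_).resolve_left h
  rw [wedge_mul_vol, hz, twoForm_swap θ n z, hμ, hμ]
  ring

theorem moserVector_equivariant {A B A' B' : R3 →L[ℝ] ℝ} {θ θ' : R3 [⋀^Fin 2]→L[ℝ] ℝ}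
    {U : R3 →L[ℝ] R3} (hU : Function.Surjective U) (h : wedge A θ ≠ 0) (h' : wedge A' θ' ≠ 0)
    (hA : A'.comp U = -A) (hB : B'.comp U = -B) (hθ : θ'.compContinuousLinearMap U = -θ) :
    moserVector A' B' θ' = U (moserVector A B θ) := by
  have hA (v) : A' (U v) = -A v := congr($hA v)
  have hB (v) : B' (U v) = -B v := congr($hB v)
  have hθ (v w) : θ' ![U v, U w] = -θ ![v, w] := by
    simpa only [ContinuousAlternatingMap.compContinuousLinearMap_apply, comp_vec_two,
      ContinuousAlternatingMap.neg_apply] using congr($hθ ![v, w])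
  refine sub_eq_zero.1 <| eq_zero_of_contract_eq h'
    (μ := wedge B' θ' / wedge A' θ' - wedge B θ / wedge A θ) ?_ fun y => ?_
  · rw [map_sub, apply_moserVector, hA, apply_moserVector, neg_zero, sub_zero]
  · obtain ⟨v, rfl⟩ := hU y
    have h1 := contract_moserVector B' h' (U v)
    have h2 := contract_moserVector B h v
    have h3 := hθ (moserVector A B θ) v
    rw [← toBilin_apply, map_sub, LinearMap.sub_apply, toBilin_apply, toBilin_apply]
    rw [hA, hB] at *
    linear_combination h1 + h2 - h3

end MoserVector

section MoserField

/-- The linear path of 1-forms from `α` to `β`. -/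
def pathForm (α β : R3 → R3 →L[ℝ] ℝ) (q : ℝ × R3) : R3 →L[ℝ] ℝ :=
  α q.2 + q.1 • (β q.2 - α q.2)

/-- The exterior derivatives of the linear path of 1-forms from `α` to `β`. -/
def pathDForm (α β : R3 → R3 →L[ℝ] ℝ) (q : ℝ × R3) : R3 [⋀^Fin 2]→L[ℝ] ℝ :=
  dForm α q.2 + q.1 • (dForm β q.2 - dForm α q.2)

/-- The time-dependent vector field whose flow carries `ker α` to `ker β`. -/
def moserField (α β : R3 → R3 →L[ℝ] ℝ) (q : ℝ × R3) : R3 :=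
  moserVector (pathForm α β q) (β q.2 - α q.2) (pathDForm α β q)

/-- The pairs `(t, x)` with `x ∈ O` at which the form `α + t (β - α)` is a contact form. -/
def moserDomain (α β : R3 → R3 →L[ℝ] ℝ) (O : Set R3) : Set (ℝ × R3) :=
  {q | q.2 ∈ O ∧ wedge (pathForm α β q) (pathDForm α β q) ≠ 0}

variable {α β : R3 → R3 →L[ℝ] ℝ} {O : Set R3}

theorem contDiffOn_pathForm (hα : ContDiffOn ℝ ∞ α O) (hβ : ContDiffOn ℝ ∞ β O) :
    ContDiffOn ℝ ∞ (pathForm α β) (univ ×ˢ O) := by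
  have hα' := hα.comp contDiffOn_snd fun q (hq : q ∈ univ (α := ℝ) ×ˢ O) => hq.2
  have hβ' := hβ.comp contDiffOn_snd fun q (hq : q ∈ univ (α := ℝ) ×ˢ O) => hq.2
  exact hα'.add (contDiffOn_fst.smul (hβ'.sub hα'))

theorem contDiffOn_pathDForm (hO : IsOpen O) (hα : ContDiffOn ℝ ∞ α O)
    (hβ : ContDiffOn ℝ ∞ β O) : ContDiffOn ℝ ∞ (pathDForm α β) (univ ×ˢ O) := by
  have hα' := (contDiffOn_dForm hO hα).comp contDiffOn_snd
    fun q (hq : q ∈ univ (α := ℝ) ×ˢ O) => hq.2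
  have hβ' := (contDiffOn_dForm hO hβ).comp contDiffOn_snd
    fun q (hq : q ∈ univ (α := ℝ) ×ˢ O) => hq.2
  exact hα'.add (contDiffOn_fst.smul (hβ'.sub hα'))

theorem isOpen_moserDomain (hO : IsOpen O) (hα : ContDiffOn ℝ ∞ α O) (hβ : ContDiffOn ℝ ∞ β O) :
    IsOpen (moserDomain α β O) := by
  have h := contDiffOn_wedge (contDiffOn_pathForm hα hβ) (contDiffOn_pathDForm hO hα hβ)
  have hdomain : moserDomain α β O = univ ×ˢ O ∩
      (fun q => wedge (pathForm α β q) (pathDForm α β q)) ⁻¹' {0}ᶜ := by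
    ext q
    simp [moserDomain]
  exact hdomain ▸ h.continuousOn.isOpen_inter_preimage (isOpen_univ.prod hO)
    isOpen_compl_singleton

theorem contDiffOn_moserField (hO : IsOpen O) (hα : ContDiffOn ℝ ∞ α O)
    (hβ : ContDiffOn ℝ ∞ β O) : ContDiffOn ℝ ∞ (moserField α β) (moserDomain α β O) := by
  have hsub : moserDomain α β O ⊆ univ ×ˢ O := fun q hq => ⟨trivial, hq.1⟩
  have hA := (contDiffOn_pathForm hα hβ).mono hsub
  have hB := (hβ.sub hα).comp contDiffOn_snd fun q (hq : q ∈ moserDomain α β O) => hq.1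
  have hA' (v) : ContDiffOn ℝ ∞ (fun q => pathForm α β q v) (moserDomain α β O) :=
    hA.clm_apply contDiffOn_const
  have hB' (v) : ContDiffOn ℝ ∞ (fun q : ℝ × R3 => (β q.2 - α q.2) v) (moserDomain α β O) :=
    hB.clm_apply contDiffOn_const
  have hminor (v w z : R3) := (((hA' v).mul (hB' w)).sub ((hA' w).mul (hB' v))).smul
    (contDiffOn_const (c := z))
  exact ((contDiffOn_wedge hA ((contDiffOn_pathDForm hO hα hβ).mono hsub)).inv
    fun q hq => hq.2).smul (((hminor _ _ _).add (hminor _ _ _)).add (hminor _ _ _))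

theorem convex_combination_pos {a b t : ℝ} (ha : 0 < a) (hb : 0 < b) (ht : t ∈ I) :
    0 < (1 - t) * a + t * b :=
  convex_Ioi (0 : ℝ) ha hb (sub_nonneg.2 ht.2) ht.1 (sub_add_cancel 1 t)

theorem mem_moserDomain {p : R3} (hp : p ∈ O) (hα : 0 < contactVolume α p)
    (hβ : 0 < contactVolume β p) {c : ℝ} (hc : 0 < c) (h : β p = c • α p) {t : ℝ} (ht : t ∈ I) :
    (t, p) ∈ moserDomain α β O := by
  have hβ' : 0 < wedge (α p) (dForm β p) := by
    have : contactVolume β p = c * wedge (α p) (dForm β p) := by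
      rw [contactVolume_eq_wedge, h]
      simp only [wedge, smul_apply, smul_eq_mul]
      ring
    exact (pos_iff_pos_of_mul_pos (this ▸ hβ)).1 hc
  have hfactor : wedge (pathForm α β (t, p)) (pathDForm α β (t, p)) =
      ((1 - t) * 1 + t * c) * ((1 - t) * contactVolume α p + t * wedge (α p) (dForm β p)) := by
    simp only [contactVolume_eq_wedge, wedge, pathForm, pathDForm, h, add_apply, sub_apply,
      smul_apply, smul_eq_mul, ContinuousAlternatingMap.add_apply,
      ContinuousAlternatingMap.sub_apply, ContinuousAlternatingMap.smul_apply]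
    ring
  exact ⟨hp, hfactor ▸ (mul_pos (convex_combination_pos one_pos hc ht)
    (convex_combination_pos hα hβ' ht)).ne'⟩

theorem moserField_eq_zero {p : R3} {c : ℝ} (hc : 0 < c) (h : β p = c • α p) {t : ℝ}
    (ht : t ∈ I) : moserField α β (t, p) = 0 := by
  have h1 : β p - α p = ((c - 1) / ((1 - t) * 1 + t * c)) • pathForm α β (t, p) := by
    ext v
    simp only [pathForm, h, add_apply, sub_apply, smul_apply, smul_eq_mul]
    rw [div_mul_eq_mul_div, eq_div_iff (convex_combination_pos one_pos hc ht).ne']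
    ring
  rw [moserField, h1, moserVector_smul_self]

theorem hasDerivWithinAt_pathForm_apply (hO : IsOpen O) (hα : ContDiffOn ℝ ∞ α O)
    (hβ : ContDiffOn ℝ ∞ β O) {γ η : ℝ → R3} {t : ℝ} {s : Set ℝ}
    (hq : (t, γ t) ∈ moserDomain α β O) (hγ : HasDerivWithinAt γ (moserField α β (t, γ t)) s t)
    (hη : HasDerivWithinAt η (fderiv ℝ (moserField α β) (t, γ t) (0, η t)) s t) :
    HasDerivWithinAt (fun t => pathForm α β (t, γ t) (η t))
      (wedge (β (γ t) - α (γ t)) (pathDForm α β (t, γ t)) /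
        wedge (pathForm α β (t, γ t)) (pathDForm α β (t, γ t)) * pathForm α β (t, γ t) (η t))
      s t := by
  set Y := moserField α β
  have hdα : HasFDerivAt α (fderiv ℝ α (γ t)) (γ t) :=
    ((hα.contDiffAt (hO.mem_nhds hq.1)).differentiableAt (by simp)).hasFDerivAt
  have hdβ : HasFDerivAt β (fderiv ℝ β (γ t)) (γ t) :=
    ((hβ.contDiffAt (hO.mem_nhds hq.1)).differentiableAt (by simp)).hasFDerivAt
  have hdY : HasFDerivAt Y (fderiv ℝ Y (t, γ t)) (t, γ t) :=
    (((contDiffOn_moserField hO hα hβ).contDiffAt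
      ((isOpen_moserDomain hO hα hβ).mem_nhds hq)).differentiableAt (by simp)).hasFDerivAt
  have hdγ := ((hdα.comp_hasDerivWithinAt t hγ).add ((hasDerivWithinAt_id t s).smul
    ((hdβ.comp_hasDerivWithinAt t hγ).sub (hdα.comp_hasDerivWithinAt t hγ)))).clm_apply hη
  -- Differentiate the identity `α_t(Y_t) = 0` in the direction of `η`.
  have hYt : HasFDerivAt (fun x => Y (t, x))
      ((fderiv ℝ Y (t, γ t)).comp (ContinuousLinearMap.inr ℝ ℝ R3)) (γ t) :=
    hdY.comp (γ t) (hasFDerivAt_prodMk_right t (γ t))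
  have hαt : HasFDerivAt (fun x => pathForm α β (t, x))
      (fderiv ℝ α (γ t) + t • (fderiv ℝ β (γ t) - fderiv ℝ α (γ t))) (γ t) :=
    hdα.add ((hdβ.sub hdα).const_smul t)
  have hαY : (fun x => pathForm α β (t, x) (Y (t, x))) = fun _ => 0 :=
    funext fun x => apply_moserVector _ _ _
  have hαYη := congr($((hαt.clm_apply hYt).unique (hαY ▸ hasFDerivAt_const (0 : ℝ) (γ t))) (η t))
  have hcontract := contract_moserVector (β (γ t) - α (γ t)) hq.2 (η t)
  change pathDForm α β (t, γ t) ![Y (t, γ t), η t] + _ = _ at hcontract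
  simp only [pathDForm, ContinuousAlternatingMap.add_apply, ContinuousAlternatingMap.smul_apply,
    ContinuousAlternatingMap.sub_apply, dForm_apply hdα.differentiableAt,
    dForm_apply hdβ.differentiableAt] at hcontract
  refine hdγ.congr_deriv ?_
  rw [pathDForm, ← hcontract]
  simp [pathForm] at hαYη ⊢
  linear_combination hαYη

theorem apply_eq_zero_of_linearized (hO : IsOpen O) (hα : ContDiffOn ℝ ∞ α O)
    (hβ : ContDiffOn ℝ ∞ β O) {γ η : ℝ → R3} (hdom : ∀ t ∈ I, (t, γ t) ∈ moserDomain α β O)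
    (hγ : IsIntegralCurveOn γ (fun t y => moserField α β (t, y)) I)
    (hη : IsIntegralCurveOn η (fun t w => fderiv ℝ (moserField α β) (t, γ t) (0, w)) I)
    (h₀ : α (γ 0) (η 0) = 0) : β (γ 1) (η 1) = 0 := by
  let a : ℝ → ℝ := fun t => wedge (β (γ t) - α (γ t)) (pathDForm α β (t, γ t)) /
    wedge (pathForm α β (t, γ t)) (pathDForm α β (t, γ t))
  have hcurve : ContinuousOn (fun t => (t, γ t)) I := continuousOn_id.prodMk hγ.continuousOn
  have hmaps : MapsTo (fun t => (t, γ t)) I (univ ×ˢ O) := fun t ht => ⟨trivial, (hdom t ht).1⟩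
  have hA := contDiffOn_pathForm hα hβ
  have hθ := contDiffOn_pathDForm hO hα hβ
  have hB : ContDiffOn ℝ ∞ (fun q : ℝ × R3 => β q.2 - α q.2) (univ ×ˢ O) :=
    (hβ.sub hα).comp contDiffOn_snd fun q hq => hq.2
  have ha : ContinuousOn a I :=
    ((contDiffOn_wedge hB hθ).continuousOn.comp hcurve hmaps).div
      ((contDiffOn_wedge hA hθ).continuousOn.comp hcurve hmaps) fun t ht => (hdom t ht).2
  have h := eq_zero_of_isIntegralCurveOn_linear (A := fun t => a t • ContinuousLinearMap.id ℝ ℝ)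
    (w := fun t => pathForm α β (t, γ t) (η t)) (ha.smul continuousOn_const)
    (fun t ht => hasDerivWithinAt_pathForm_apply hO hα hβ (hdom t ht) (hγ t ht) (hη t ht))
    (left_mem_Icc.2 zero_le_one) (by simpa [pathForm] using h₀) 1 (right_mem_Icc.2 zero_le_one)
  simpa [pathForm] using h

end MoserField

section MoserFlow

variable {u : R3 → R3} {α β : R3 → R3 →L[ℝ] ℝ} {O K : Set R3}

theorem pathForm_comp_fderiv (hα : IsInvariantContactForm u O α)
    (hβ : IsInvariantContactForm u O β) (t : ℝ) {x : R3} (hx : x ∈ O) :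
    (pathForm α β (t, u x)).comp (fderiv ℝ u x) = -pathForm α β (t, x) := by
  simp only [pathForm, ContinuousLinearMap.add_comp, ContinuousLinearMap.smul_comp,
    ContinuousLinearMap.sub_comp, hα.comp_fderiv hx, hβ.comp_fderiv hx]
  module

theorem pathDForm_comp_fderiv (hu : ContDiff ℝ ∞ u) (hα : IsInvariantContactForm u O α)
    (hβ : IsInvariantContactForm u O β) (t : ℝ) {x : R3} (hx : x ∈ O) :
    (pathDForm α β (t, u x)).compContinuousLinearMap (fderiv ℝ u x) = -pathDForm α β (t, x) := by
  ext v
  have h₀ := congr($(hα.dForm_comp_fderiv hu hx) v)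
  have h₁ := congr($(hβ.dForm_comp_fderiv hu hx) v)
  simp only [pathDForm, ContinuousAlternatingMap.compContinuousLinearMap_apply,
    ContinuousAlternatingMap.add_apply, ContinuousAlternatingMap.smul_apply,
    ContinuousAlternatingMap.sub_apply, ContinuousAlternatingMap.neg_apply, smul_eq_mul]
    at h₀ h₁ ⊢
  rw [h₀, h₁]
  ring

theorem apply_mem_moserDomain (hu : ContDiff ℝ ∞ u) (hα : IsInvariantContactForm u O α)
    (hβ : IsInvariantContactForm u O β) {t : ℝ} {x : R3} (h : (t, x) ∈ moserDomain α β O) :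
    (t, u x) ∈ moserDomain α β O := by
  refine ⟨hα.mapsTo h.1, fun h0 => h.2 ?_⟩
  rw [← wedge_neg_neg, ← pathForm_comp_fderiv hα hβ t h.1, ← pathDForm_comp_fderiv hu hα hβ t h.1,
    wedge_comp, h0, zero_mul]

theorem moserField_equivariant (hu : ContDiff ℝ ∞ u) (hui : Function.Involutive u)
    (hα : IsInvariantContactForm u O α) (hβ : IsInvariantContactForm u O β) {t : ℝ} {x : R3}
    (h : (t, x) ∈ moserDomain α β O) :
    moserField α β (t, u x) = fderiv ℝ u x (moserField α β (t, x)) := by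
  have hsurj : Function.Surjective (fderiv ℝ u x) := fun y => ⟨fderiv ℝ u (u x) y, by
    simpa only [hui x] using
      fderiv_apply_fderiv_of_involutive (hu.differentiable (by simp)) hui (u x) y⟩
  refine moserVector_equivariant hsurj h.2 (apply_mem_moserDomain hu hα hβ h).2
    (pathForm_comp_fderiv hα hβ t h.1) ?_ (pathDForm_comp_fderiv hu hα hβ t h.1)
  rw [ContinuousLinearMap.sub_comp, hα.comp_fderiv h.1, hβ.comp_fderiv h.1, neg_sub_neg, neg_sub]

/-- `Γ` is the flow of a globally defined vector field `Y` that agrees with the Moser vector field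
on the open set `R`. -/
structure IsMoserFlow (α β : R3 → R3 →L[ℝ] ℝ) (O : Set R3) (Y : ℝ × R3 → R3) (Γ : R3 → C(I, R3))
    (R : Set (ℝ × R3)) : Prop extends IsFlow Y Γ where
  contDiff_field : ContDiff ℝ ∞ Y
  exists_lipschitz : ∃ L, LipschitzWith L Y
  isOpen : IsOpen R
  subset_moserDomain : R ⊆ moserDomain α β O
  eqOn : EqOn Y (moserField α β) R

theorem exists_isMoserFlow (hO : IsOpen O) (hα : ContDiffOn ℝ ∞ α O) (hβ : ContDiffOn ℝ ∞ β O)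
    (hK : IsCompact K) (hdom : ∀ t ∈ I, ∀ p ∈ K, (t, p) ∈ moserDomain α β O) :
    ∃ Y Γ R, IsMoserFlow α β O Y Γ R ∧ ∀ t ∈ I, ∀ p ∈ K, (t, p) ∈ R := by
  obtain ⟨Y, R, hY, hYc, hR, hKR, hRD, hYR⟩ := exists_contDiff_hasCompactSupport_eqOn
    (isCompact_Icc.prod hK) (isOpen_moserDomain hO hα hβ) (fun q hq => hdom q.1 hq.1 q.2 hq.2)
    (contDiffOn_moserField hO hα hβ)
  obtain ⟨L, hL⟩ := hY.lipschitzWith_of_hasCompactSupport hYc (by simp)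
  obtain ⟨B, hB⟩ := hYc.exists_bound_of_continuous hY.continuous
  obtain ⟨Γ, hΓ⟩ := exists_isFlow hY hL (L := B.toNNReal)
    fun q => (hB q).trans (Real.le_coe_toNNReal B)
  exact ⟨Y, Γ, R, ⟨hΓ, hY, ⟨L, hL⟩, hR, hRD, hYR⟩, fun t ht p hp => hKR ⟨ht, hp⟩⟩

namespace IsMoserFlow

variable {Y : ℝ × R3 → R3} {Γ : R3 → C(I, R3)} {R : Set (ℝ × R3)}

theorem apply_eq_zero (hΓ : IsMoserFlow α β O Y Γ R) (hO : IsOpen O) (hα : ContDiffOn ℝ ∞ α O)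
    (hβ : ContDiffOn ℝ ∞ β O) {x : R3} (hx : ∀ t : I, (t.1, Γ x t) ∈ R) {v : R3}
    (hv : α x v = 0) : β (Γ x 1) (fderiv ℝ Γ x v 1) = 0 := by
  have hR (t) (ht : t ∈ I) : (t, pathExtend (Γ x) t) ∈ R := by
    simpa only [pathExtend, IccExtend_of_mem _ _ ht] using hx ⟨t, ht⟩
  have h := apply_eq_zero_of_linearized hO hα hβ
    (γ := pathExtend (Γ x)) (η := pathExtend (fderiv ℝ Γ x v))
    (fun t ht => hΓ.subset_moserDomain (hR t ht))
    (fun t ht => (hΓ.isIntegralCurveOn x t ht).congr_deriv (hΓ.eqOn (hR t ht)))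
    (fun t ht => (hΓ.isIntegralCurveOn_fderiv hΓ.contDiff_field x v t ht).congr_deriv
      congr($((hΓ.eqOn.eventuallyEq_of_mem (hΓ.isOpen.mem_nhds (hR t ht))).fderiv_eq) _))
  have hval (γ : C(I, R3)) : pathExtend γ 0 = γ 0 ∧ pathExtend γ 1 = γ 1 :=
    ⟨IccExtend_left _ _, IccExtend_right _ _⟩
  rw [(hval _).1, (hval _).1, (hval _).2, (hval _).2, hΓ.apply_zero,
    hΓ.fderiv_apply_zero hΓ.contDiff_field] at h
  exact h hv

theorem apply_comp_involution (hΓ : IsMoserFlow α β O Y Γ R) (hu : ContDiff ℝ ∞ u)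
    (hui : Function.Involutive u) (hα : IsInvariantContactForm u O α)
    (hβ : IsInvariantContactForm u O β) {x : R3}
    (hx : ∀ t : I, (t.1, Γ x t) ∈ R ∧ (t.1, u (Γ x t)) ∈ R) (t : I) :
    Γ (u x) t = u (Γ x t) := by
  obtain ⟨L, hL⟩ := hΓ.exists_lipschitz
  refine hΓ.apply_comp hL hu (fun s => ?_) t
  rw [hΓ.eqOn (hx s).1, hΓ.eqOn (hx s).2,
    moserField_equivariant hu hui hα hβ (hΓ.subset_moserDomain (hx s).1)]

end IsMoserFlow

/-- `χ` is the endpoint of an isotopy fixing `K` pointwise: on the neighborhood `N` of `K` it takes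
values in `O`, commutes with `u`, and carries `ker α` into `ker β`. -/
structure IsContactIsotopyEnd (u : R3 → R3) (α β : R3 → R3 →L[ℝ] ℝ) (O K N : Set R3)
    (χ : R3 → R3) : Prop where
  isOpen : IsOpen N
  subset : K ⊆ N
  contDiff : ContDiff ℝ ∞ χ
  mapsTo : MapsTo χ N O
  eqOn_id : EqOn χ id K
  injective_fderiv : ∀ x, Function.Injective (fderiv ℝ χ x)
  equivariant : ∀ x ∈ N, χ (u x) = u (χ x)
  apply_eq_zero : ∀ x ∈ N, ∀ v, α x v = 0 → β (χ x) (fderiv ℝ χ x v) = 0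

theorem exists_isContactIsotopyEnd (hu : ContDiff ℝ ∞ u) (hui : Function.Involutive u)
    (hα : IsInvariantContactForm u O α) (hβ : IsInvariantContactForm u O β) (hK : IsCompact K)
    (hKO : K ⊆ O) (huK : MapsTo u K K) (hαβ : ∀ p ∈ K, ∃ c : ℝ, 0 < c ∧ β p = c • α p) :
    ∃ N χ, IsContactIsotopyEnd u α β O K N χ := by
  choose! c hc hαβ using hαβ
  obtain ⟨Y, Γ, R, hΓ, hKR⟩ := exists_isMoserFlow hα.isOpen hα.smooth hβ.smooth hK
    fun t ht p hp => mem_moserDomain (hKO hp) (hα.positive p (hKO hp)) (hβ.positive p (hKO hp))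
      (hc p hp) (hαβ p hp) ht
  let R' : Set (ℝ × R3) := R ∩ Prod.map id u ⁻¹' R
  have hR' : IsOpen R' := hΓ.isOpen.inter
    (hΓ.isOpen.preimage (continuous_id.prodMap hu.continuous))
  have hcomp {x} (hx : ∀ t : I, pathGraph (Γ x) t ∈ R') := hΓ.apply_comp_involution hu hui hα hβ hx
  have hconst (p) (hp : p ∈ K) : Γ p = ContinuousMap.const I p := by
    obtain ⟨L, hL⟩ := hΓ.exists_lipschitz
    exact hΓ.apply_eq_const hL fun t ht =>
      (hΓ.eqOn (hKR t ht p hp)).trans (moserField_eq_zero (hc p hp) (hαβ p hp) ht)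
  have hχ (x) : HasFDerivAt (fun x => Γ x 1)
      ((ContinuousMap.evalCLM ℝ (1 : I)).comp (fderiv ℝ Γ x)) x :=
    (ContinuousMap.evalCLM (M := R3) ℝ (1 : I)).hasFDerivAt.comp x
      (hΓ.contDiff.differentiable (by simp) x).hasFDerivAt
  refine ⟨{x | ∀ t : I, pathGraph (Γ x) t ∈ R'}, fun x => Γ x 1, ?_, ?_, ?_, ?_, ?_, ?_, ?_, ?_⟩
  · have h := (ContinuousMap.isOpen_setOfPred_mapsTo isCompact_univ hR').preimage
      ((contDiff_pathGraph (E := R3)).continuous.comp hΓ.contDiff.continuous)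
    simpa [MapsTo, preimage] using h
  · intro p hp t
    simpa [hconst p hp] using ⟨hKR t t.2 p hp, hKR t t.2 (u p) (huK hp)⟩
  · exact (ContinuousMap.evalCLM ℝ (1 : I)).contDiff.comp hΓ.contDiff
  · exact fun x hx => (hΓ.subset_moserDomain (hx 1).1).1
  · exact fun p hp => congr($(hconst p hp) 1)
  · exact fun x => (hχ x).fderiv ▸ hΓ.fderiv_apply_injective hΓ.contDiff_field x 1
  · exact fun x hx => hcomp hx 1
  · exact fun x hx v hv => (hχ x).fderiv ▸
      hΓ.apply_eq_zero hα.isOpen hα.smooth hβ.smooth (fun t => (hx t).1) hv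

end MoserFlow

section TangentPlane

variable {F : Type*} [NormedAddCommGroup F] [NormedSpace ℝ F] {S : Set R3} {p : R3}

theorem eqOn_tangentPlane {f : R3 → F} {f' f'' : R3 →L[ℝ] F}
    (h' : HasFDerivWithinAt f f' S p) (h'' : HasFDerivWithinAt f f'' S p) :
    EqOn f' f'' (tangentPlane S p) :=
  LinearMap.eqOn_span' (f := (f' : R3 →ₗ[ℝ] F)) (g := (f'' : R3 →ₗ[ℝ] F)) (h'.unique_on h'')

theorem mapsTo_tangentPlane {f : R3 → R3} {f' : R3 →L[ℝ] R3} {S' : Set R3}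
    (h : HasFDerivWithinAt f f' S p) (hm : MapsTo f S S') :
    MapsTo f' (tangentPlane S p) (tangentPlane S' (f p)) := by
  have hle : tangentPlane S p ≤ (tangentPlane S' (f p)).comap (f' : R3 →ₗ[ℝ] R3) :=
    Submodule.span_le.2 fun y hy =>
      Submodule.subset_span (tangentConeAt_mono hm.image_subset (h.mapsTo_tangent_cone hy))
  exact fun v hv => hle hv

theorem eqOn_tangentPlane_fderiv {f g : R3 → F} (hf : DifferentiableAt ℝ f p)
    (hg : DifferentiableAt ℝ g p) (hp : p ∈ S) (h : ∀ᶠ x in 𝓝 p, x ∈ S → f x = g x) :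
    EqOn (fderiv ℝ f p) (fderiv ℝ g p) (tangentPlane S p) :=
  eqOn_tangentPlane (f := f) hf.hasFDerivAt.hasFDerivWithinAt <|
    hg.hasFDerivAt.hasFDerivWithinAt.congr_of_eventuallyEq (eventually_nhdsWithin_iff.2 h)
      (h.self_of_nhds hp)

theorem fderiv_eq_zero_of_mem_tangentPlane {f : R3 → F} (hf : DifferentiableAt ℝ f p) (hp : p ∈ S)
    (h : ∀ᶠ x in 𝓝 p, x ∈ S → f x = 0) {v : R3} (hv : v ∈ tangentPlane S p) :
    fderiv ℝ f p v = 0 := by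
  have := eqOn_tangentPlane_fderiv hf (differentiableAt_const (0 : F)) hp h hv
  simpa using this

theorem stdVec_mem_tangentConeAt_halfPlane (y : R3) {i : Fin 3} (hi : i ≠ 2) :
    stdVec i ∈ tangentConeAt ℝ {z : R3 | z 2 = y 2 ∧ y 1 ≤ z 1} y := by
  have hseg : segment ℝ y (y + stdVec i) ⊆ {z : R3 | z 2 = y 2 ∧ y 1 ≤ z 1} := by
    rw [segment_eq_image']
    rintro _ ⟨θ, hθ, rfl⟩
    have : 0 ≤ θ * stdVec i 1 := mul_nonneg hθ.1 (by rw [stdVec_apply]; split_ifs <;> simp)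
    simpa [stdVec_apply i 2, hi.symm] using this
  simpa using mem_tangentConeAt_of_segment_subset hseg

theorem mem_tangentPlane_iff_of_chart {e : OpenPartialHomeomorph R3 R3} (hp : p ∈ S)
    (hpe : p ∈ e.source) (he : DifferentiableAt ℝ e p) (he' : DifferentiableAt ℝ e.symm (e p))
    (hS : (∀ x ∈ e.source, x ∈ S ↔ e x 2 = 0) ∨
      (∀ x ∈ e.source, x ∈ S ↔ e x 2 = 0 ∧ 0 ≤ e x 1)) {v : R3} :
    v ∈ tangentPlane S p ↔ fderiv ℝ (fun x => e x 2) p v = 0 := by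
  let π : R3 →L[ℝ] ℝ := EuclideanSpace.proj (2 : Fin 3)
  have hs : HasFDerivAt (fun x => e x 2) (π.comp (fderiv ℝ e p)) p :=
    π.hasFDerivAt.comp p he.hasFDerivAt
  have hzero (x) (hx : x ∈ e.source) (hxS : x ∈ S) : e x 2 = 0 :=
    hS.elim (fun h => (h x hx).1 hxS) fun h => ((h x hx).1 hxS).1
  refine ⟨fderiv_eq_zero_of_mem_tangentPlane hs.differentiableAt hp
    (mem_of_superset (e.open_source.mem_nhds hpe) hzero), fun hv => ?_⟩
  let H : Set R3 := {z | z 2 = e p 2 ∧ e p 1 ≤ z 1}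
  have hm : MapsTo e.symm (H ∩ e.target) S := by
    rintro y ⟨⟨hy, hy'⟩, hyt⟩
    rw [hzero p hpe hp] at hy
    rcases hS with h | h <;> rw [h _ (e.map_target hyt), e.right_inv hyt]
    · exact hy
    · exact ⟨hy, ((h p hpe).1 hp).2.trans hy'⟩
  have hmem (i : Fin 3) (hi : i ≠ 2) : fderiv ℝ e.symm (e p) (stdVec i) ∈ tangentPlane S p := by
    have hcone : stdVec i ∈ tangentPlane (H ∩ e.target) (e p) := Submodule.subset_span <| by
      rw [tangentConeAt_inter_nhds (e.open_target.mem_nhds (e.map_source hpe))]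
      exact stdVec_mem_tangentConeAt_halfPlane (e p) hi
    simpa only [e.left_inv hpe, SetLike.mem_coe] using
      mapsTo_tangentPlane he'.hasFDerivAt.hasFDerivWithinAt hm hcone
  have hv2 : fderiv ℝ e p v 2 = 0 := by rw [hs.fderiv] at hv; exact hv
  rw [← show fderiv ℝ e.symm (e p) (fderiv ℝ e p v) = v from
    congr($(fderiv_symm_comp hpe he he') v), eq_sum_stdVec (fderiv ℝ e p v), hv2, zero_smul,
    add_zero, map_add, map_smul, map_smul]
  exact add_mem (Submodule.smul_mem _ _ (hmem 0 (by decide)))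
    (Submodule.smul_mem _ _ (hmem 1 (by decide)))

theorem IsCompactSurface.exists_local_definingFunction (hS : IsCompactSurface S) (hp : p ∈ S) :
    ∃ (V : Set R3) (s : R3 → ℝ), IsOpen V ∧ p ∈ V ∧ ContDiffOn ℝ ∞ s V ∧
      (∀ x ∈ V, x ∈ S → s x = 0) ∧ fderiv ℝ s p ≠ 0 ∧
      ∀ v, v ∈ tangentPlane S p ↔ fderiv ℝ s p v = 0 := by
  obtain ⟨e, hpe, he, he', hSe⟩ := hS.chart p hp
  let π : R3 →L[ℝ] ℝ := EuclideanSpace.proj (2 : Fin 3)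
  have hpt := e.map_source hpe
  have hed : DifferentiableAt ℝ e p :=
    (he.contDiffAt (e.open_source.mem_nhds hpe)).differentiableAt (by simp)
  have hed' : DifferentiableAt ℝ e.symm (e p) :=
    (he'.contDiffAt (e.open_target.mem_nhds hpt)).differentiableAt (by simp)
  refine ⟨e.source, fun x => e x 2, e.open_source, hpe, π.contDiff.comp_contDiffOn he,
    fun x hx hxS => hSe.elim (fun h => (h x hx).1 hxS) fun h => ((h x hx).1 hxS).1, fun h0 => ?_,
    fun v => mem_tangentPlane_iff_of_chart hp hpe hed hed' hSe⟩
  have hs : fderiv ℝ (fun x => e x 2) p = π.comp (fderiv ℝ e p) :=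
    (π.hasFDerivAt.comp p hed.hasFDerivAt).fderiv
  have hinv := congr($(comp_fderiv_symm hpt (by rwa [e.left_inv hpe]) hed') (stdVec 2))
  rw [e.left_inv hpe] at hinv
  have hone : (1 : ℝ) = π.comp (fderiv ℝ e p) (fderiv ℝ e.symm (e p) (stdVec 2)) := by
    simpa [π, stdVec_apply] using congr($hinv 2).symm
  rw [← hs, h0] at hone
  exact one_ne_zero hone

end TangentPlane

theorem SmoothOnSet.exists_contDiff {F : Type*} [NormedAddCommGroup F] [NormedSpace ℝ F]
    {f : R3 → F} {S : Set R3} (hS : IsClosed S) (hf : SmoothOnSet f S) :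
    ∃ g : R3 → F, ContDiff ℝ ∞ g ∧ EqOn g f S := by
  obtain ⟨g, hg⟩ := exists_contMDiffMap_forall_mem_convex_of_local (n := (⊤ : ℕ∞)) (M := R3)
    (F := F) 𝓘(ℝ, R3) (t := fun x => {y | x ∈ S → y = f x})
    (fun x y hy z hz a b _ _ hab hx => by rw [hy hx, hz hx, Convex.combo_self hab])
    (fun x => by
      by_cases hx : x ∈ S
      · obtain ⟨V, g, hV, hxV, hg, hfg⟩ := hf x hx
        exact ⟨V, hV.mem_nhds hxV, g, contMDiffOn_iff_contDiffOn.2 hg,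
          fun y hy hyS => (hfg ⟨hyS, hy⟩).symm⟩
      · exact ⟨Sᶜ, hS.isOpen_compl.mem_nhds hx, 0,
          contMDiffOn_iff_contDiffOn.2 contDiffOn_const, fun y hy hyS => absurd hyS hy⟩)
  exact ⟨g, contMDiff_iff_contDiff.1 g.contMDiff, fun x hx => hg x hx⟩

section DefiningFunction

theorem wedge_add_left (A B : R3 →L[ℝ] ℝ) (θ : R3 [⋀^Fin 2]→L[ℝ] ℝ) :
    wedge (A + B) θ = wedge A θ + wedge B θ := by
  simp only [wedge, add_apply]; ring

theorem wedge_smul_left (c : ℝ) (A : R3 →L[ℝ] ℝ) (θ : R3 [⋀^Fin 2]→L[ℝ] ℝ) :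
    wedge (c • A) θ = c * wedge A θ := by
  simp only [wedge, smul_apply, smul_eq_mul]; ring

theorem wedge_zero_left (θ : R3 [⋀^Fin 2]→L[ℝ] ℝ) : wedge 0 θ = 0 := by
  simp [wedge]

theorem ne_zero_of_wedge_ne_zero {A : R3 →L[ℝ] ℝ} {θ : R3 [⋀^Fin 2]→L[ℝ] ℝ}
    (h : wedge A θ ≠ 0) : A ≠ 0 := by
  rintro rfl
  exact h (wedge_zero_left θ)

theorem wedge_ne_zero {A : R3 →L[ℝ] ℝ} {θ : R3 [⋀^Fin 2]→L[ℝ] ℝ} (hA : A ≠ 0) {v w : R3}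
    (hv : A v = 0) (hw : A w = 0) (hθ : θ ![v, w] ≠ 0) : wedge A θ ≠ 0 := by
  refine fun h => hA (ContinuousLinearMap.ext fun n => (mul_eq_zero.1 ?_).resolve_right hθ)
  have := wedge_mul_vol A θ v w n
  rw [h, hv, hw] at this
  linarith

theorem apply_eq_zero_iff_of_imp {A B : R3 →L[ℝ] ℝ} (h : ∀ v, A v = 0 → B v = 0) (hB : B ≠ 0)
    (v : R3) : B v = 0 ↔ A v = 0 := by
  refine ⟨fun hv => by_contra fun hA => hB (ContinuousLinearMap.ext fun w => ?_), h v⟩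
  have := h (w - (A w / A v) • v) (by simp [hA])
  simpa [hv] using this

/-- `Ω` restricts to an area form on the surface `S`. -/
structure IsAreaForm (S : Set R3) (Ω : R3 → R3 [⋀^Fin 2]→L[ℝ] ℝ) : Prop where
  smooth : SmoothOnSet Ω S
  nonvanishing : ∀ p ∈ S, ∃ v ∈ tangentPlane S p, ∃ w ∈ tangentPlane S p, Ω p ![v, w] ≠ 0

/-- `s` is a smooth function that vanishes on `S`, is regular along `S`, and coorients `S` in the
way prescribed by the area form `Ω`. -/
structure IsDefiningFunction (S : Set R3) (Ω : R3 → R3 [⋀^Fin 2]→L[ℝ] ℝ) (s : R3 → ℝ) : Prop where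
  contDiff : ContDiff ℝ ∞ s
  eq_zero : ∀ p ∈ S, s p = 0
  wedge_pos : ∀ p ∈ S, 0 < wedge (fderiv ℝ s p) (Ω p)
  mem_tangentPlane_iff : ∀ p ∈ S, ∀ v, v ∈ tangentPlane S p ↔ fderiv ℝ s p v = 0

variable {S : Set R3} {Ω : R3 → R3 [⋀^Fin 2]→L[ℝ] ℝ}

theorem exists_local_definingFunction_wedge_pos (hS : IsCompactSurface S) (hΩ : Continuous Ω)
    {p : R3} (hp : p ∈ S)
    (hne : ∃ v ∈ tangentPlane S p, ∃ w ∈ tangentPlane S p, Ω p ![v, w] ≠ 0) :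
    ∃ (V : Set R3) (s : R3 → ℝ), IsOpen V ∧ p ∈ V ∧ ContDiffOn ℝ ∞ s V ∧
      (∀ x ∈ V, x ∈ S → s x = 0) ∧ ∀ x ∈ V, 0 < wedge (fderiv ℝ s x) (Ω x) := by
  obtain ⟨V, s, hV, hpV, hs, hs0, hds, hT⟩ := hS.exists_local_definingFunction hp
  obtain ⟨v, hv, w, hw, hvw⟩ := hne
  set c := wedge (fderiv ℝ s p) (Ω p)
  have hc : c ≠ 0 := wedge_ne_zero hds ((hT v).1 hv) ((hT w).1 hw) hvw
  have hcs : ContDiffOn ℝ ∞ (c • s) V := hs.const_smul c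
  have hcont : ContinuousOn (fun x => wedge (fderiv ℝ (c • s) x) (Ω x)) V :=
    continuousOn_wedge (hcs.continuousOn_fderiv_of_isOpen hV (by simp)) hΩ.continuousOn
  have hpos : 0 < wedge (fderiv ℝ (c • s) p) (Ω p) := by
    rw [fderiv_const_smul ((hs.contDiffAt (hV.mem_nhds hpV)).differentiableAt (by simp)),
      wedge_smul_left]
    exact mul_self_pos.2 hc
  exact ⟨_, c • s, hcont.isOpen_inter_preimage hV isOpen_Ioi, ⟨hpV, hpos⟩,
    hcs.mono inter_subset_left, fun x hx hxS => by simp [hs0 x hx.1 hxS], fun x hx => hx.2⟩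

theorem exists_contDiff_wedge_nonneg (hS : IsCompactSurface S) (hΩ : Continuous Ω)
    {p : R3} (hp : p ∈ S)
    (hne : ∃ v ∈ tangentPlane S p, ∃ w ∈ tangentPlane S p, Ω p ![v, w] ≠ 0) :
    ∃ s : R3 → ℝ, ContDiff ℝ ∞ s ∧ (∀ x ∈ S, s x = 0) ∧
      (∀ x ∈ S, 0 ≤ wedge (fderiv ℝ s x) (Ω x)) ∧
      ∀ᶠ x in 𝓝 p, x ∈ S → 0 < wedge (fderiv ℝ s x) (Ω x) := by
  obtain ⟨V, s, hV, hpV, hs, hs0, hsw⟩ := exists_local_definingFunction_wedge_pos hS hΩ hp hne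
  obtain ⟨χ, hχV, -, hχ, hχI, hχp⟩ := exists_contDiff_tsupport_subset (n := ⊤) (hV.mem_nhds hpV)
  have hzero (x) (hx : x ∈ S) : χ x = 0 ∨ s x = 0 := by
    by_cases hxV : x ∈ V
    · exact Or.inr (hs0 x hxV hx)
    · exact Or.inl (image_eq_zero_of_notMem_tsupport fun h => hxV (hχV h))
  have hsmooth : ContDiff ℝ ∞ (χ * s) := contMDiff_iff_contDiff.1 <|
    contMDiff_of_tsupport fun x hx => contMDiffAt_iff_contDiffAt.2 <|
      hχ.contDiffAt.mul (hs.contDiffAt (hV.mem_nhds (hχV (tsupport_mul_subset_left hx))))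
  have hwedge (x) (hx : x ∈ S) (hxV : x ∈ V) :
      wedge (fderiv ℝ (χ * s) x) (Ω x) = χ x * wedge (fderiv ℝ s x) (Ω x) := by
    rw [fderiv_mul (hχ.differentiable (by simp) x)
      ((hs.contDiffAt (hV.mem_nhds hxV)).differentiableAt (by simp)), hs0 x hxV hx, zero_smul,
      add_zero, wedge_smul_left]
  refine ⟨χ * s, hsmooth, fun x hx => mul_eq_zero.2 (hzero x hx), fun x hx => ?_, ?_⟩
  · by_cases hxχ : x ∈ tsupport χ
    · rw [hwedge x hx (hχV hxχ)]
      exact mul_nonneg (hχI (mem_range_self x)).1 (hsw x (hχV hxχ)).le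
    · rw [fderiv_of_notMem_tsupport ℝ (f := χ * s) fun h => hxχ (tsupport_mul_subset_left h),
        wedge_zero_left]
  · filter_upwards [hV.mem_nhds hpV, hχ.continuous.continuousAt.eventually
      (lt_mem_nhds (show 0 < χ p from hχp ▸ one_pos))] with x hxV hχx hxS
    rw [hwedge x hxS hxV]
    exact mul_pos hχx (hsw x hxV)

theorem exists_contDiff_wedge_pos (hS : IsCompactSurface S) (hΩ : Continuous Ω)
    (hne : ∀ p ∈ S, ∃ v ∈ tangentPlane S p, ∃ w ∈ tangentPlane S p, Ω p ![v, w] ≠ 0) :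
    ∃ s : R3 → ℝ, ContDiff ℝ ∞ s ∧ (∀ x ∈ S, s x = 0) ∧
      ∀ x ∈ S, 0 < wedge (fderiv ℝ s x) (Ω x) := by
  suffices ∃ s : R3 → ℝ, ContDiff ℝ ∞ s ∧ (∀ x ∈ S, s x = 0) ∧
      (∀ x ∈ S, 0 ≤ wedge (fderiv ℝ s x) (Ω x)) ∧ ∀ x ∈ S, x ∈ S → 0 < wedge (fderiv ℝ s x) (Ω x) by
    obtain ⟨s, hs, hs0, -, hpos⟩ := this
    exact ⟨s, hs, hs0, fun x hx => hpos x hx hx⟩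
  refine hS.compact.induction_on (p := fun A => ∃ s : R3 → ℝ, ContDiff ℝ ∞ s ∧
    (∀ x ∈ S, s x = 0) ∧ (∀ x ∈ S, 0 ≤ wedge (fderiv ℝ s x) (Ω x)) ∧
    ∀ x ∈ A, x ∈ S → 0 < wedge (fderiv ℝ s x) (Ω x)) ?_ ?_ ?_ ?_
  · exact ⟨0, contDiff_const, fun _ _ => rfl, fun x _ => by simp [wedge_zero_left], by simp⟩
  · rintro A B hAB ⟨s, hs, hs0, hnonneg, hpos⟩
    exact ⟨s, hs, hs0, hnonneg, fun x hx => hpos x (hAB hx)⟩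
  · rintro A B ⟨s, hs, hs0, hnonneg, hpos⟩ ⟨s', hs', hs0', hnonneg', hpos'⟩
    have hadd (x) : wedge (fderiv ℝ (s + s') x) (Ω x) =
        wedge (fderiv ℝ s x) (Ω x) + wedge (fderiv ℝ s' x) (Ω x) := by
      rw [fderiv_add (hs.differentiable (by simp) x) (hs'.differentiable (by simp) x),
        wedge_add_left]
    refine ⟨s + s', hs.add hs', fun x hx => by simp [hs0 x hx, hs0' x hx],
      fun x hx => hadd x ▸ add_nonneg (hnonneg x hx) (hnonneg' x hx), fun x hx hxS => hadd x ▸ ?_⟩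
    exact hx.elim (fun hx => add_pos_of_pos_of_nonneg (hpos x hx hxS) (hnonneg' x hxS))
      fun hx => add_pos_of_nonneg_of_pos (hnonneg x hxS) (hpos' x hx hxS)
  · intro p hp
    obtain ⟨s, hs, hs0, hnonneg, hpos⟩ := exists_contDiff_wedge_nonneg hS hΩ hp (hne p hp)
    exact ⟨_, mem_nhdsWithin_of_mem_nhds hpos, s, hs, hs0, hnonneg, fun x hx => hx⟩

theorem exists_isDefiningFunction (hS : IsCompactSurface S) (hΩ : Continuous Ω)
    (hne : ∀ p ∈ S, ∃ v ∈ tangentPlane S p, ∃ w ∈ tangentPlane S p, Ω p ![v, w] ≠ 0) :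
    ∃ s, IsDefiningFunction S Ω s := by
  obtain ⟨s, hs, hs0, hpos⟩ := exists_contDiff_wedge_pos hS hΩ hne
  refine ⟨s, hs, hs0, hpos, fun p hp v => ?_⟩
  obtain ⟨-, s', -, -, -, -, -, hT⟩ := hS.exists_local_definingFunction hp
  rw [hT]
  refine (apply_eq_zero_iff_of_imp (fun w hw => ?_) (ne_zero_of_wedge_ne_zero (hpos p hp).ne')
    v).symm
  exact fderiv_eq_zero_of_mem_tangentPlane (hs.differentiable (by simp) p) hp
    (Eventually.of_forall hs0) ((hT w).2 hw)

namespace IsDefiningFunction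

variable {s : R3 → ℝ}

theorem fderiv_ne_zero (hs : IsDefiningFunction S Ω s) {p : R3} (hp : p ∈ S) : fderiv ℝ s p ≠ 0 :=
  ne_zero_of_wedge_ne_zero (hs.wedge_pos p hp).ne'

theorem dForm_eq_zero (hs : IsDefiningFunction S Ω s) {γ : R3 → R3 →L[ℝ] ℝ} {p : R3}
    (hγ : DifferentiableAt ℝ γ p) (hp : p ∈ S) (h : ∀ q ∈ S, ∀ v ∈ tangentPlane S q, γ q v = 0)
    {v w : R3} (hv : v ∈ tangentPlane S p) (hw : w ∈ tangentPlane S p) :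
    dForm γ p ![v, w] = 0 := by
  obtain ⟨n, hn⟩ := DFunLike.ne_iff.1 (hs.fderiv_ne_zero hp)
  have hds : HasFDerivAt (fderiv ℝ s) (fderiv ℝ (fderiv ℝ s) p) p :=
    ((hs.contDiff.fderiv_right (m := ∞) (by simp)).differentiable (by simp) p).hasFDerivAt
  have hsymm : fderiv ℝ (fderiv ℝ s) p v w = fderiv ℝ (fderiv ℝ s) p w v :=
    hs.contDiff.contDiffAt.isSymmSndFDerivAt
      (by simp only [minSmoothness_of_isRCLikeNormedField]; exact WithTop.coe_le_coe.2 le_top) v w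
  -- Along `S` the covectors `γ` and `ds` are proportional.
  have hprop (q) (hq : q ∈ S) : fderiv ℝ s q n • γ q - γ q n • fderiv ℝ s q = 0 := by
    ext y
    have := h q hq (fderiv ℝ s q n • y - fderiv ℝ s q y • n)
      ((hs.mem_tangentPlane_iff q hq _).2 (by simp; ring))
    simp only [map_sub, map_smul, smul_eq_mul] at this
    simp only [sub_apply, smul_apply, smul_eq_mul, zero_apply]
    linarith
  have hprop' := ((hds.clm_apply (hasFDerivAt_const n p)).smul hγ.hasFDerivAt).sub
    ((hγ.hasFDerivAt.clm_apply (hasFDerivAt_const n p)).smul hds)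
  have hfderiv {y z} (hy : y ∈ tangentPlane S p) (hz : z ∈ tangentPlane S p) :
      fderiv ℝ s p n * fderiv ℝ γ p y z = γ p n * fderiv ℝ (fderiv ℝ s) p y z := by
    have := congr($(fderiv_eq_zero_of_mem_tangentPlane hprop'.differentiableAt hp
      (Eventually.of_forall hprop) hy) z)
    rw [hprop'.fderiv] at this
    simp [h p hp z hz, (hs.mem_tangentPlane_iff p hp z).1 hz] at this
    linarith
  have hvw := hfderiv hv hw
  have hwv := hfderiv hw hv
  rw [hsymm, ← hwv] at hvw
  rw [dForm_apply hγ, mul_left_cancel₀ hn hvw, sub_self]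

end IsDefiningFunction

end DefiningFunction

section TransverseExtension

variable {ℓ A : R3 →L[ℝ] ℝ} {D L : R3 →L[ℝ] R3}

theorem exists_vol_ne_zero_of_ne_zero (hℓ : ℓ ≠ 0) :
    ∃ v w n, ℓ v = 0 ∧ ℓ w = 0 ∧ ℓ n = 1 ∧ vol v w n ≠ 0 := by
  obtain ⟨i, hi⟩ : ∃ i, ℓ (stdVec i) ≠ 0 := by
    by_contra! h
    exact hℓ (ContinuousLinearMap.ext fun v => by rw [covector_expand]; simp [h])
  set n := (ℓ (stdVec i))⁻¹ • stdVec i with hn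
  have hℓn : ℓ n = 1 := by simp [hn, hi]
  refine ⟨stdVec (i + 1) - ℓ (stdVec (i + 1)) • n, stdVec (i + 2) - ℓ (stdVec (i + 2)) • n, n,
    by simp [hℓn], by simp [hℓn], hℓn, ?_⟩
  rw [hn]
  fin_cases i <;> simpa [vol_apply, stdVec_apply] using hi

theorem det_combo_of_eqOn_ker {L' : R3 →L[ℝ] R3} (hℓ : ℓ ≠ 0)
    (h : ∀ v, ℓ v = 0 → L v = L' v) {a b : ℝ} (hab : a + b = 1) :
    (a • L + b • L').det = a * L.det + b * L'.det := by
  obtain ⟨v, w, n, hv, hw, -, hvol⟩ := exists_vol_ne_zero_of_ne_zero hℓ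
  refine mul_right_cancel₀ hvol ?_
  have hLv : (a • L + b • L') v = L v := by simp [← h v hv, Convex.combo_self hab]
  have hLw : (a • L + b • L') w = L w := by simp [← h w hw, Convex.combo_self hab]
  have hL' := vol_map L' v w n
  rw [← h v hv, ← h w hw] at hL'
  rw [← vol_map, hLv, hLw, add_mul, mul_assoc, mul_assoc, ← vol_map, ← hL']
  simp only [vol_apply, add_apply, smul_apply, PiLp.add_apply, PiLp.smul_apply, smul_eq_mul]
  ring

theorem exists_vol_ne_zero_of_linearIndependent {v w : R3} (h : LinearIndependent ℝ ![v, w]) :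
    ∃ n, vol v w n ≠ 0 := by
  obtain ⟨n, hn⟩ := exists_linearIndependent_snoc_of_lt_finrank h (by simp)
  have heq : ![v, w, n] = Fin.snoc (α := fun _ => R3) ![v, w] n := by
    funext i
    fin_cases i <;> rfl
  refine ⟨n, (vol_ne_zero_iff_linearIndependent v w n).2 ?_⟩
  rw [heq]
  exact hn

theorem exists_apply_eq_and_pos {E : Type*} [AddCommGroup E] [Module ℝ E] {f g : E →ₗ[ℝ] ℝ}
    {y m : E} (hfy : f y ≠ 0) (hgy : g y = 0) (hgm : g m ≠ 0) (b : ℝ) :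
    ∃ z, f z = b ∧ 0 < g z := by
  refine ⟨g m • m + ((b - f (g m • m)) / f y) • y, ?_, ?_⟩
  · rw [map_add, map_smul f _ y, smul_eq_mul, div_mul_cancel₀ _ hfy, add_sub_cancel]
  · simpa [hgy] using mul_self_pos.2 hgm

theorem exists_apply_eq_and_vol_pos {v w : R3} {c : ℝ} (hvw : LinearIndependent ℝ ![v, w])
    (hc : c ≠ 0) (hA : A v ≠ 0 ∨ A w ≠ 0) (b : ℝ) : ∃ z, A z = b ∧ 0 < vol v w z * c := by
  obtain ⟨m, hm⟩ := exists_vol_ne_zero_of_linearIndependent hvw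
  let g : R3 →ₗ[ℝ] ℝ := IsLinearMap.mk' (fun z => vol v w z * c)
    ⟨fun x y => by simp [vol_apply]; ring, fun a x => by simp [vol_apply]; ring⟩
  have hgv : g v = 0 := mul_eq_zero_of_left (by rw [vol_apply]; ring) c
  have hgw : g w = 0 := mul_eq_zero_of_left (by rw [vol_apply]; ring) c
  exact hA.elim (fun hv => exists_apply_eq_and_pos (f := (A : R3 →ₗ[ℝ] ℝ)) hv hgv
    (mul_ne_zero hm hc) b) fun hw => exists_apply_eq_and_pos (f := (A : R3 →ₗ[ℝ] ℝ)) hw hgw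
    (mul_ne_zero hm hc) b

theorem linearIndependent_pair_map {v w n : R3} (hvol : vol v w n ≠ 0) (hv : ℓ v = 0)
    (hw : ℓ w = 0) (hD : ∀ v, ℓ v = 0 → D v = 0 → v = 0) :
    LinearIndependent ℝ ![D v, D w] := by
  have hvw : LinearIndependent ℝ ![v, w] := by
    convert ((vol_ne_zero_iff_linearIndependent v w n).1 hvol).comp Fin.castSucc
      (Fin.castSucc_injective 2) using 1
    ext i
    fin_cases i <;> rfl
  rw [LinearIndependent.pair_iff] at hvw ⊢
  exact fun s t h => hvw s t (hD _ (by simp [hv, hw]) (by simpa using h))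

theorem exists_comp_eq_and_det_pos {B : R3 →L[ℝ] ℝ} {θ θ' : R3 [⋀^Fin 2]→L[ℝ] ℝ} (hℓ : ℓ ≠ 0)
    (hA : 0 < wedge A θ) (hB : 0 < wedge B θ') (hD : ∀ v, ℓ v = 0 → D v = 0 → v = 0)
    (hAB : ∀ v, ℓ v = 0 → A (D v) = B v)
    (hθ : ∀ v w, ℓ v = 0 → ℓ w = 0 → θ ![D v, D w] = θ' ![v, w]) :
    ∃ W : R3, A.comp (D + ℓ.smulRight W) = B ∧ 0 < (D + ℓ.smulRight W).det := by
  obtain ⟨v, w, n, hv, hw, hn, hvol⟩ := exists_vol_ne_zero_of_ne_zero hℓ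
  obtain ⟨Z, hAZ, hZ⟩ : ∃ Z, A Z = B n ∧ 0 < vol (D v) (D w) Z * vol v w n := by
    by_cases hB0 : B v = 0 ∧ B w = 0
    · obtain ⟨m, hm⟩ := DFunLike.ne_iff.1 (ne_zero_of_wedge_ne_zero hA.ne')
      have hAZ : A ((B n / A m) • m) = B n := by simp [div_mul_cancel₀ _ hm]
      refine ⟨(B n / A m) • m, hAZ, ?_⟩
      have hAvol := wedge_mul_vol A θ (D v) (D w) ((B n / A m) • m)
      have hBvol := wedge_mul_vol B θ' v w n
      rw [hAB v hv, hAB w hw, hB0.1, hB0.2, hAZ, hθ v w hv hw] at hAvol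
      rw [hB0.1, hB0.2] at hBvol
      refine (mul_pos_iff_of_pos_left hA).1 ?_
      calc 0 < wedge B θ' * vol v w n ^ 2 := mul_pos hB (sq_pos_of_ne_zero hvol)
        _ = _ := by linear_combination vol v w n * (hBvol - hAvol)
    · refine exists_apply_eq_and_vol_pos (linearIndependent_pair_map hvol hv hw hD) hvol ?_ (B n)
      rwa [hAB v hv, hAB w hw, ← not_and_or]
  set L := D + ℓ.smulRight (Z - D n)
  have hLv : ∀ {v}, ℓ v = 0 → L v = D v := fun hv => by simp [L, hv]
  have hLn : L n = Z := by simp [L, hn]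
  refine ⟨Z - D n, ContinuousLinearMap.ext fun x => ?_, ?_⟩
  · have hx : ℓ (x - ℓ x • n) = 0 := by simp [hn]
    have := hAB _ hx
    rw [← hLv hx, map_sub, map_sub, map_sub, map_smul, map_smul, map_smul, hLn, hAZ] at this
    exact sub_left_injective this
  · have := vol_map L v w n
    rw [hLv hv, hLv hw, hLn] at this
    rw [this, mul_assoc] at hZ
    exact pos_of_mul_pos_left hZ (mul_self_nonneg _)

end TransverseExtension

theorem contactVolume_smul {α : R3 → R3 →L[ℝ] ℝ} {h : R3 → ℝ} {p : R3}
    (hh : DifferentiableAt ℝ h p) (hα : DifferentiableAt ℝ α p) :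
    contactVolume (fun q => h q • α q) p = h p ^ 2 * contactVolume α p := by
  have hdForm (v w : R3) : dForm (fun q => h q • α q) p ![v, w] =
      h p * dForm α p ![v, w] + (fderiv ℝ h p v * α p w - fderiv ℝ h p w * α p v) := by
    rw [dForm_apply (hh.fun_smul hα), dForm_apply hα, fderiv_fun_smul hh hα]
    simp only [add_apply, smul_apply, ContinuousLinearMap.smulRight_apply, smul_eq_mul]
    ring
  simp only [contactVolume, hdForm, smul_apply, smul_eq_mul]
  ring

section Extension

/-- `L` agrees with `D` on the plane `ker ℓ`, pulls the covector `A` back to `B`, and preserves the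
orientation. For `ℓ = ds`, `D = df`, `A = α ∘ f` and `B = β` these are the derivatives along the
surface `s = 0` of the extensions of `f` that pull `α` back to `β` there. -/
structure IsContactExtension (ℓ : R3 →L[ℝ] ℝ) (D : R3 →L[ℝ] R3) (A B : R3 →L[ℝ] ℝ)
    (L : R3 →L[ℝ] R3) : Prop where
  eqOn : ∀ v, ℓ v = 0 → L v = D v
  comp_eq : A.comp L = B
  det_pos : 0 < L.det

theorem convex_setOf_isContactExtension {ℓ A B : R3 →L[ℝ] ℝ} {D : R3 →L[ℝ] R3} (hℓ : ℓ ≠ 0) :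
    Convex ℝ {L | IsContactExtension ℓ D A B L} := by
  intro L hL L' hL' a b ha hb hab
  have hLL' (v) (hv : ℓ v = 0) : L v = L' v := (hL.eqOn v hv).trans (hL'.eqOn v hv).symm
  refine ⟨fun v hv => ?_, ?_, ?_⟩
  · simp [← hLL' v hv, hL.eqOn v hv, Convex.combo_self hab]
  · rw [ContinuousLinearMap.comp_add, ContinuousLinearMap.comp_smul, ContinuousLinearMap.comp_smul,
      hL.comp_eq, hL'.comp_eq, Convex.combo_self hab]
  · rw [det_combo_of_eqOn_ker hℓ hLL' hab]
    exact convex_Ioi (0 : ℝ) hL.det_pos hL'.det_pos ha hb hab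

/-- `f` restricts to an immersion of `S` that pulls `α` back to `β` on the tangent planes of `S`. -/
structure IsMatchingImmersion (S : Set R3) (α β : R3 → R3 →L[ℝ] ℝ) (f : R3 → R3) : Prop where
  contDiff : ContDiff ℝ ∞ f
  injective : ∀ p ∈ S, ∀ v ∈ tangentPlane S p, fderiv ℝ f p v = 0 → v = 0
  apply_eq : ∀ p ∈ S, ∀ v ∈ tangentPlane S p, α (f p) (fderiv ℝ f p v) = β p v

variable {u f : R3 → R3} {S U U' : Set R3} {s : R3 → ℝ} {Ω : R3 → R3 [⋀^Fin 2]→L[ℝ] ℝ}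
  {α β : R3 → R3 →L[ℝ] ℝ} {p : R3}

theorem IsMatchingImmersion.dForm_apply_eq (hf : IsMatchingImmersion S α β f)
    (hs : IsDefiningFunction S Ω s) (hα : DifferentiableAt ℝ α (f p)) (hβ : DifferentiableAt ℝ β p)
    (hp : p ∈ S) {v w : R3} (hv : v ∈ tangentPlane S p) (hw : w ∈ tangentPlane S p) :
    dForm α (f p) ![fderiv ℝ f p v, fderiv ℝ f p w] = dForm β p ![v, w] := by
  have hpull : DifferentiableAt ℝ (pullbackForm f α) p :=
    (hα.comp p (hf.contDiff.differentiable (by simp) p)).clm_comp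
      ((hf.contDiff.fderiv_right (m := ∞) (by simp)).differentiable (by simp) p)
  have hzero := hs.dForm_eq_zero (hpull.sub hβ) hp
    (fun q hq v hv => sub_eq_zero.2 (hf.apply_eq q hq v hv)) hv hw
  have hdpull := congr($(dForm_pullbackForm hf.contDiff.contDiffAt hα) ![v, w])
  rw [ContinuousAlternatingMap.compContinuousLinearMap_apply, comp_vec_two,
    dForm_apply hpull] at hdpull
  rw [dForm_apply (hpull.sub hβ), fderiv_sub hpull hβ] at hzero
  rw [← hdpull, dForm_apply hβ]
  simp only [sub_apply] at hzero
  linarith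

theorem IsMatchingImmersion.exists_isContactExtension (hf : IsMatchingImmersion S α β f)
    (hs : IsDefiningFunction S Ω s) (hα : IsInvariantContactForm u U' α)
    (hβ : IsInvariantContactForm u U β) (hp : p ∈ S) (hpU : p ∈ U) (hpU' : f p ∈ U') :
    ∃ W, IsContactExtension (fderiv ℝ s p) (fderiv ℝ f p) (α (f p)) (β p)
      (fderiv ℝ f p + (fderiv ℝ s p).smulRight W) := by
  have hT := hs.mem_tangentPlane_iff p hp
  obtain ⟨W, hW, hdet⟩ := exists_comp_eq_and_det_pos (hs.fderiv_ne_zero hp)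
    (hα.positive _ hpU') (hβ.positive p hpU) (fun v hv => hf.injective p hp v ((hT v).2 hv))
    (fun v hv => hf.apply_eq p hp v ((hT v).2 hv)) fun v w hv hw =>
      hf.dForm_apply_eq hs (hα.differentiableAt hpU') (hβ.differentiableAt hpU) hp
        ((hT v).2 hv) ((hT w).2 hw)
  exact ⟨W, fun v hv => by simp [hv], hW, hdet⟩

theorem comp_add_smulRight_eq {ℓ A B : R3 →L[ℝ] ℝ} {D : R3 →L[ℝ] R3} {W n : R3}
    (hAB : ∀ v, ℓ v = 0 → A (D v) = B v) (hn : ℓ n ≠ 0) (hW : A W = (B n - A (D n)) / ℓ n) :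
    A.comp (D + ℓ.smulRight W) = B := by
  ext x
  have := hAB (x - (ℓ x / ℓ n) • n) (by simp [hn])
  simp only [map_sub, map_smul, smul_eq_mul] at this
  simp only [ContinuousLinearMap.comp_apply, add_apply, ContinuousLinearMap.smulRight_apply,
    map_add, map_smul, smul_eq_mul, hW]
  linear_combination this

theorem exists_eventually_contDiffAt_apply_eq {E F : Type*} [NormedAddCommGroup E]
    [NormedSpace ℝ E] [NormedAddCommGroup F] [NormedSpace ℝ F] {γ : E → F →L[ℝ] ℝ} {c : E → ℝ}
    {p : E} {W₀ : F} (hγ : ∀ᶠ x in 𝓝 p, ContDiffAt ℝ ∞ γ x) (hc : ∀ᶠ x in 𝓝 p, ContDiffAt ℝ ∞ c x)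
    (hγp : γ p ≠ 0) (hW₀ : γ p W₀ = c p) :
    ∃ W : E → F, W p = W₀ ∧ ∀ᶠ x in 𝓝 p, ContDiffAt ℝ ∞ W x ∧ γ x (W x) = c x := by
  obtain ⟨m, hm⟩ := DFunLike.ne_iff.1 hγp
  have hm' : ∀ᶠ x in 𝓝 p, γ x m ≠ 0 :=
    (hγ.self_of_nhds.continuousAt.clm_apply continuousAt_const).eventually_ne hm
  refine ⟨fun x => W₀ + ((c x - γ x W₀) / γ x m) • m, by simp [hW₀], ?_⟩
  filter_upwards [hγ, hc, hm'] with x hγx hcx hmx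
  exact ⟨by fun_prop (disch := assumption), by simp [hmx]⟩

theorem IsMatchingImmersion.exists_local_extension (hf : IsMatchingImmersion S α β f)
    (hs : IsDefiningFunction S Ω s) (hα : IsInvariantContactForm u U' α)
    (hβ : IsInvariantContactForm u U β) (hp : p ∈ S) (hpU : p ∈ U) (hpU' : f p ∈ U') :
    ∃ W : R3 → R3, ∀ᶠ x in 𝓝 p, ContDiffAt ℝ ∞ W x ∧ (x ∈ S →
      IsContactExtension (fderiv ℝ s x) (fderiv ℝ f x) (α (f x)) (β x)
        (fderiv ℝ f x + (fderiv ℝ s x).smulRight (W x))) := by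
  obtain ⟨W₀, hW₀⟩ := hf.exists_isContactExtension hs hα hβ hp hpU hpU'
  obtain ⟨n, hn⟩ := DFunLike.ne_iff.1 (hs.fderiv_ne_zero hp)
  rw [zero_apply] at hn
  have hα' : ∀ᶠ x in 𝓝 p, ContDiffAt ℝ ∞ (fun x => α (f x)) x := by
    filter_upwards [hf.contDiff.continuous.continuousAt (hα.isOpen.mem_nhds hpU')] with x hx
    exact (hα.smooth.contDiffAt (hα.isOpen.mem_nhds hx)).comp x hf.contDiff.contDiffAt
  have hds : ContDiff ℝ ∞ (fderiv ℝ s) := hs.contDiff.fderiv_right (by simp)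
  have hdf : ContDiff ℝ ∞ (fderiv ℝ f) := hf.contDiff.fderiv_right (by simp)
  have hn' : ∀ᶠ x in 𝓝 p, fderiv ℝ s x n ≠ 0 :=
    (hds.continuous.clm_apply continuous_const).continuousAt.eventually_ne hn
  have hc : ∀ᶠ x in 𝓝 p,
      ContDiffAt ℝ ∞ (fun x => (β x n - α (f x) (fderiv ℝ f x n)) / fderiv ℝ s x n) x := by
    filter_upwards [hα', hβ.isOpen.mem_nhds hpU, hn'] with x hαx hx hnx
    have hβx := hβ.smooth.contDiffAt (hβ.isOpen.mem_nhds hx)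
    exact ((hβx.clm_apply contDiffAt_const).sub (hαx.clm_apply
      (hdf.contDiffAt.clm_apply contDiffAt_const))).div
      (hds.contDiffAt.clm_apply contDiffAt_const) hnx
  have hW₀n : α (f p) W₀ = (β p n - α (f p) (fderiv ℝ f p n)) / fderiv ℝ s p n := by
    simp [← hW₀.comp_eq, hn]
  obtain ⟨W, hWp, hW⟩ := exists_eventually_contDiffAt_apply_eq hα' hc (hα.ne_zero hpU') hW₀n
  have hdet : ∀ᶠ x in 𝓝 p, 0 < (fderiv ℝ f x + (fderiv ℝ s x).smulRight (W x)).det := by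
    refine (continuousAt_const (y := (0 : ℝ))).eventually_lt ?_ (by rw [hWp]; exact hW₀.det_pos)
    exact ContinuousLinearMap.continuous_det.continuousAt.comp (hdf.continuous.continuousAt.add
      ((hds.contDiffAt (x := p)).smulRight hW.self_of_nhds.1).continuousAt)
  refine ⟨W, ?_⟩
  filter_upwards [hW, hn', hdet] with x hWx hnx hdetx
  exact ⟨hWx.1, fun hx => ⟨fun v hv => by simp [hv], comp_add_smulRight_eq (fun v hv =>
    hf.apply_eq x hx v ((hs.mem_tangentPlane_iff x hx v).2 hv)) hnx hWx.2, hdetx⟩⟩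

theorem IsMatchingImmersion.exists_extension (hf : IsMatchingImmersion S α β f)
    (hS : IsClosed S) (hs : IsDefiningFunction S Ω s) (hα : IsInvariantContactForm u U' α)
    (hβ : IsInvariantContactForm u U β) (hSU : S ⊆ U) (hfU' : MapsTo f S U') :
    ∃ F : R3 → R3, ContDiff ℝ ∞ F ∧ EqOn F f S ∧ ∀ p ∈ S,
      IsContactExtension (fderiv ℝ s p) (fderiv ℝ f p) (α (f p)) (β p) (fderiv ℝ F p) := by
  obtain ⟨W, hW⟩ := exists_contMDiffMap_forall_mem_convex_of_local (n := (⊤ : ℕ∞)) (M := R3)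
    (F := R3) 𝓘(ℝ, R3) (t := fun x => {W | x ∈ S → IsContactExtension (fderiv ℝ s x)
      (fderiv ℝ f x) (α (f x)) (β x) (fderiv ℝ f x + (fderiv ℝ s x).smulRight W)})
    (fun x W hW W' hW' a b ha hb hab hx => by
      have := convex_setOf_isContactExtension (hs.fderiv_ne_zero hx) (hW hx) (hW' hx) ha hb hab
      rw [smul_add, smul_add, add_add_add_comm, Convex.combo_self hab] at this
      convert this.out using 2
      ext v : 1
      simp only [ContinuousLinearMap.smulRight_apply, add_apply, smul_apply, smul_add,
        smul_comm a, smul_comm b])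
    (fun x => by
      by_cases hx : x ∈ S
      · obtain ⟨W, hW⟩ := hf.exists_local_extension hs hα hβ hx (hSU hx) (hfU' hx)
        exact ⟨_, hW, W, contMDiffOn_iff_contDiffOn.2 fun y hy => hy.1.contDiffWithinAt,
          fun y hy => hy.2⟩
      · exact ⟨Sᶜ, hS.isOpen_compl.mem_nhds hx, 0,
          contMDiffOn_iff_contDiffOn.2 contDiffOn_const, fun y hy hyS => absurd hyS hy⟩)
  have hWsmooth : ContDiff ℝ ∞ W := contMDiff_iff_contDiff.1 W.contMDiff
  refine ⟨fun x => f x + s x • W x, hf.contDiff.add (hs.contDiff.smul hWsmooth),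
    fun x hx => by simp [hs.eq_zero x hx], fun x hx => ?_⟩
  have hderiv := (hf.contDiff.differentiable (by simp) x).hasFDerivAt.add
    ((hs.contDiff.differentiable (by simp) x).hasFDerivAt.smul
      (hWsmooth.differentiable (by simp) x).hasFDerivAt)
  rw [hs.eq_zero x hx, zero_smul, zero_add] at hderiv
  exact (HasFDerivAt.fderiv hderiv).symm ▸ hW x hx

end Extension

section Averaging

variable {E : Type*} [NormedAddCommGroup E] [NormedSpace ℝ E] {u : E → E}

/-- Coordinates on `E × E` near the graph of the involution `u`, which is the image of `q.2 = 0`. -/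
def graphCoords (u : E → E) (q : E × E) : E × E := (q.1 - q.2, u q.1 + fderiv ℝ u q.1 q.2)

/-- The involution of `E × E` that becomes the exchange of the two factors in `graphCoords`. -/
def graphReflection (u : E → E) (q : E × E) : E × E := (u q.1, -fderiv ℝ u q.1 q.2)

theorem graphCoords_graphReflection (hu : Differentiable ℝ u) (hui : Function.Involutive u)
    (q : E × E) : graphCoords u (graphReflection u q) = (graphCoords u q).swap := by
  simp [graphCoords, graphReflection, fderiv_apply_fderiv_of_involutive hu hui, hui q.1,
    ← sub_eq_add_neg]

theorem graphReflection_graphReflection (hu : Differentiable ℝ u) (hui : Function.Involutive u)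
    (q : E × E) : graphReflection u (graphReflection u q) = q := by
  simp [graphReflection, fderiv_apply_fderiv_of_involutive hu hui, hui q.1]

theorem contDiff_graphReflection (hu : ContDiff ℝ ∞ u) : ContDiff ℝ ∞ (graphReflection u) :=
  (hu.comp contDiff_fst).prodMk
    (((hu.fderiv_right (m := ∞) (by simp)).comp contDiff_fst).clm_apply contDiff_snd).neg

theorem contDiff_graphCoords (hu : ContDiff ℝ ∞ u) : ContDiff ℝ ∞ (graphCoords u) :=
  (contDiff_fst.sub contDiff_snd).prodMk ((hu.comp contDiff_fst).add
    (((hu.fderiv_right (m := ∞) (by simp)).comp contDiff_fst).clm_apply contDiff_snd))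

theorem hasFDerivAt_graphCoords (hu : ContDiff ℝ ∞ u) (z : E) :
    HasFDerivAt (graphCoords u)
      ((ContinuousLinearMap.fst ℝ E E - ContinuousLinearMap.snd ℝ E E).prod
        ((fderiv ℝ u z).comp (ContinuousLinearMap.fst ℝ E E + ContinuousLinearMap.snd ℝ E E)))
      (z, 0) := by
  have hu' : HasFDerivAt (fun q : E × E => u q.1) _ (z, 0) :=
    (hu.differentiable (by simp) z).hasFDerivAt.comp (z, (0 : E)) hasFDerivAt_fst
  have hdu : HasFDerivAt (fun q : E × E => fderiv ℝ u q.1) _ (z, 0) :=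
    ((hu.fderiv_right (m := ∞) (by simp)).differentiable (by simp) z).hasFDerivAt.comp
      (z, (0 : E)) hasFDerivAt_fst
  refine ((hasFDerivAt_fst.sub hasFDerivAt_snd).prodMk
    (hu'.add (hdu.clm_apply hasFDerivAt_snd))).congr_fderiv ?_
  ext <;> simp

theorem isInvertible_fderiv_graphCoords (hu : ContDiff ℝ ∞ u) (hui : Function.Involutive u)
    (z : E) : (fderiv ℝ (graphCoords u) (z, 0)).IsInvertible := by
  have hinv := fderiv_apply_fderiv_of_involutive (hu.differentiable (by simp)) hui
  have hinv' (v) : fderiv ℝ u z (fderiv ℝ u (u z) v) = v := by simpa [hui z] using hinv (u z) v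
  rw [(hasFDerivAt_graphCoords hu z).fderiv]
  let D' := (fderiv ℝ u (u z)).comp (ContinuousLinearMap.snd ℝ E E)
  refine ContinuousLinearMap.IsInvertible.of_inverse
    (g := (1 / 2 : ℝ) • (ContinuousLinearMap.fst ℝ E E + D').prod
      (D' - ContinuousLinearMap.fst ℝ E E)) ?_ ?_ <;> ext v <;>
    simp [D', hinv, hinv', ← add_smul, sub_eq_add_neg] <;> module

/-- `r` is a smooth retraction of `T` onto the graph of the involution `u` near the points over `K`,
the graph being identified with `E` by the first projection. It intertwines the exchange of the two
factors with `u`. -/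
structure IsGraphRetraction (u : E → E) (K : Set E) (T : Set (E × E)) (r : E × E → E) : Prop where
  isOpen : IsOpen T
  contDiffOn : ContDiffOn ℝ ∞ r T
  swap_mem : ∀ y ∈ T, y.swap ∈ T
  apply_swap : ∀ y ∈ T, r y.swap = u (r y)
  graph_mem : ∀ z ∈ K, (z, u z) ∈ T
  apply_graph : ∀ z ∈ K, ∀ᶠ w in 𝓝 z, r (w, u w) = w

theorem exists_isGraphRetraction [CompleteSpace E] (hu : ContDiff ℝ ∞ u)
    (hui : Function.Involutive u) {K : Set E} (hK : IsCompact K) (huK : MapsTo u K K) :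
    ∃ T r, IsGraphRetraction u K T r := by
  have hud := hu.differentiable (by simp)
  have hG0 (z) : graphCoords u (z, 0) = (z, u z) := by simp [graphCoords]
  obtain ⟨W, hW, hKW, -, hinj, hinv⟩ := exists_isOpen_injOn_of_isInvertible_fderiv
    (f := graphCoords u) (K := (fun z => (z, (0 : E))) '' K) (hK.image (by fun_prop)) isOpen_univ
    (subset_univ _) (contDiff_graphCoords hu).contDiffOn
    (by rintro _ ⟨z, -, rfl⟩ _ ⟨z', -, rfl⟩ h; simpa [hG0] using congr($(h).1))
    (by rintro _ ⟨z, -, rfl⟩; exact isInvertible_fderiv_graphCoords hu hui z)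
  set V := W ∩ graphReflection u ⁻¹' W
  have hV : IsOpen V := hW.inter (hW.preimage (contDiff_graphReflection hu).continuous)
  have hτV (q) (hq : q ∈ V) : graphReflection u q ∈ V :=
    ⟨hq.2, by rw [mem_preimage, graphReflection_graphReflection hud hui]; exact hq.1⟩
  have hKV (z) (hz : z ∈ K) : (z, 0) ∈ V :=
    ⟨hKW ⟨z, hz, rfl⟩, by simpa [graphReflection] using hKW ⟨u z, huK hz, rfl⟩⟩
  obtain ⟨e, heV, he, hesymm⟩ := exists_openPartialHomeomorph_of_isInvertible_fderiv hV
    (contDiff_graphCoords hu).contDiffOn (hinj.mono inter_subset_left) fun q hq => hinv q hq.1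
  have htarget (q) (hq : q ∈ V) : graphCoords u q ∈ e.target :=
    he q ▸ e.map_source (heV.symm ▸ hq)
  have hsymm (q) (hq : q ∈ V) : e.symm (graphCoords u q) = q := by
    rw [← he, e.left_inv (heV.symm ▸ hq)]
  have hswap (y) (hy : y ∈ e.target) :
      e.symm y ∈ V ∧ y.swap = graphCoords u (graphReflection u (e.symm y)) :=
    ⟨heV ▸ e.map_target hy,
      by rw [graphCoords_graphReflection hud hui, ← he, e.right_inv hy]⟩
  refine ⟨e.target, fun y => (e.symm y).1, e.open_target, contDiff_fst.comp_contDiffOn hesymm,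
    fun y hy => ?_, fun y hy => ?_, fun z hz => ?_, fun z hz => ?_⟩
  · exact (hswap y hy).2 ▸ htarget _ (hτV _ (hswap y hy).1)
  · rw [(hswap y hy).2, hsymm _ (hτV _ (hswap y hy).1), graphReflection]
  · exact hG0 z ▸ htarget _ (hKV z hz)
  · filter_upwards [(Continuous.prodMk_left (0 : E)).continuousAt (hV.mem_nhds (hKV z hz))]
      with w hw
    rw [← hG0, hsymm _ hw]

theorem IsGraphRetraction.hasFDerivAt_comp {K : Set E} {T : Set (E × E)} {r : E × E → E}
    (hr : IsGraphRetraction u K T r) (hu : Differentiable ℝ u) {A : E → E × E} {L : E →L[ℝ] E}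
    {p z : E} (hz : z ∈ K) (hAp : A p = (z, u z))
    (hA : HasFDerivAt A (L.prod ((fderiv ℝ u z).comp L)) p) :
    HasFDerivAt (fun x => r (A x)) L p := by
  have hr' : HasFDerivAt r (fderiv ℝ r (z, u z)) (z, u z) :=
    ((hr.contDiffOn.contDiffAt (hr.isOpen.mem_nhds (hr.graph_mem z hz))).differentiableAt
      (by simp)).hasFDerivAt
  have hgraph : (fderiv ℝ r (z, u z)).comp ((ContinuousLinearMap.id ℝ E).prod (fderiv ℝ u z)) =
      ContinuousLinearMap.id ℝ E :=
    (hr'.comp z ((hasFDerivAt_id z).prodMk (hu z).hasFDerivAt)).unique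
      ((hasFDerivAt_id z).congr_of_eventuallyEq (hr.apply_graph z hz))
  refine ((hAp ▸ hr').comp p hA).congr_fderiv ?_
  ext v
  simpa [hAp] using congr($hgraph (L v))

theorem exists_equivariant_average [CompleteSpace E] (hu : ContDiff ℝ ∞ u)
    (hui : Function.Involutive u) {K : Set E} {F : E → E} (hK : IsCompact K) (huK : MapsTo u K K)
    (hF : ContDiff ℝ ∞ F) (hFu : ∀ p ∈ K, F (u p) = u (F p)) :
    ∃ (N : Set E) (F' : E → E), IsOpen N ∧ K ⊆ N ∧ MapsTo u N N ∧ ContDiffOn ℝ ∞ F' N ∧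
      EqOn F' F K ∧ (∀ x ∈ N, F' (u x) = u (F' x)) ∧ ∀ p ∈ K,
        fderiv ℝ F' p = (1 / 2 : ℝ) • (fderiv ℝ F p + fderiv ℝ (fun x => u (F (u x))) p) := by
  have hFK : MapsTo u (F '' K) (F '' K) := by
    rintro _ ⟨p, hp, rfl⟩
    exact ⟨u p, huK hp, hFu p hp⟩
  obtain ⟨T, r, hr⟩ := exists_isGraphRetraction hu hui (hK.image hF.continuous) hFK
  set F₁ : E → E := fun x => u (F (u x)) with hF₁
  have hF₁s : ContDiff ℝ ∞ F₁ := hu.comp (hF.comp hu)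
  set A : E → E × E := fun x => ((1 / 2 : ℝ) • (F x + F₁ x), (1 / 2 : ℝ) • (u (F x) + u (F₁ x)))
  have hA : ContDiff ℝ ∞ A := ((hF.add hF₁s).const_smul (1 / 2 : ℝ)).prodMk
    (((hu.comp hF).add (hu.comp hF₁s)).const_smul (1 / 2 : ℝ))
  have hF₁K (p) (hp : p ∈ K) : F₁ p = F p := by rw [hF₁]; simp only [hFu p hp, hui (F p)]
  have hAK (p) (hp : p ∈ K) : A p = (F p, u (F p)) := by
    simp only [A, hF₁K p hp]
    refine Prod.ext ?_ ?_ <;> simp only <;> module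
  have hAu (x) : A (u x) = (A x).swap := by
    simp only [A, F₁, hui _, Prod.swap_prod_mk, add_comm (F (u x)), add_comm (u (F (u x)))]
  have hAT (p) (hp : p ∈ K) : A p ∈ T := hAK p hp ▸ hr.graph_mem _ ⟨p, hp, rfl⟩
  refine ⟨A ⁻¹' T, fun x => r (A x), hr.isOpen.preimage hA.continuous, hAT,
    fun x hx => ?_, hr.contDiffOn.comp hA.contDiffOn fun x hx => hx, fun p hp => ?_,
    fun x hx => ?_, fun p hp => ?_⟩
  · rw [mem_preimage, hAu]
    exact hr.swap_mem _ hx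
  · simp only [hAK p hp]
    exact (hr.apply_graph _ ⟨p, hp, rfl⟩).self_of_nhds
  · simp only [hAu, hr.apply_swap _ hx]
  · have hud := hu.differentiable (by simp)
    have hdF := (hF.differentiable (by simp) p).hasFDerivAt
    have hdF₁ := (hF₁s.differentiable (by simp) p).hasFDerivAt
    have hduF₁ := (hud (F₁ p)).hasFDerivAt.comp p hdF₁
    rw [hF₁K p hp] at hduF₁
    refine (hr.hasFDerivAt_comp hud ⟨p, hp, rfl⟩ (hAK p hp) ?_).fderiv
    refine (((hdF.add hdF₁).const_smul (1 / 2 : ℝ)).prodMk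
      ((((hud (F p)).hasFDerivAt.comp p hdF).add hduF₁).const_smul (1 / 2 : ℝ))).congr_fderiv ?_
    rw [ContinuousLinearMap.comp_smul, ContinuousLinearMap.comp_add]

end Averaging

section EquivariantExtension

variable {u f F : R3 → R3} {S U U' : Set R3} {s : R3 → ℝ} {Ω : R3 → R3 [⋀^Fin 2]→L[ℝ] ℝ}
  {α β : R3 → R3 →L[ℝ] ℝ} {p : R3}

theorem IsInvariantContactForm.det_fderiv_pos (hα : IsInvariantContactForm u U α)
    (hu : ContDiff ℝ ∞ u) (hp : p ∈ U) : 0 < (fderiv ℝ u p).det := by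
  have h := wedge_comp (α (u p)) (dForm α (u p)) (fderiv ℝ u p)
  rw [hα.comp_fderiv hp, hα.dForm_comp_fderiv hu hp, wedge_neg_neg, ← contactVolume_eq_wedge,
    ← contactVolume_eq_wedge] at h
  exact (mul_pos_iff_of_pos_left (hα.positive _ (hα.mapsTo hp))).1 (h ▸ hα.positive p hp)

theorem IsContactExtension.conjugate (hu : ContDiff ℝ ∞ u) (hui : Function.Involutive u)
    (huS : MapsTo u S S) (hs : IsDefiningFunction S Ω s) (hα : IsInvariantContactForm u U' α)
    (hβ : IsInvariantContactForm u U β) (hSU : S ⊆ U) (hfU' : MapsTo f S U')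
    (hf : ContDiff ℝ ∞ f) (hF : ContDiff ℝ ∞ F) (hfu : ∀ p ∈ S, f (u p) = u (f p))
    (hFf : EqOn F f S) (hp : p ∈ S)
    (h : IsContactExtension (fderiv ℝ s (u p)) (fderiv ℝ f (u p)) (α (f (u p))) (β (u p))
      (fderiv ℝ F (u p))) :
    IsContactExtension (fderiv ℝ s p) (fderiv ℝ f p) (α (f p)) (β p)
      (fderiv ℝ (fun x => u (F (u x))) p) := by
  have hud := hu.differentiable (by simp)
  have hFd := hF.differentiable (by simp)
  have huFu (x) (hx : x ∈ S) : u (F (u x)) = f x := by rw [hFf (huS hx), hfu x hx, hui]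
  have hderiv : fderiv ℝ (fun x => u (F (u x))) p =
      (fderiv ℝ u (f (u p))).comp ((fderiv ℝ F (u p)).comp (fderiv ℝ u p)) := by
    rw [← hFf (huS hp)]
    exact ((hud _).hasFDerivAt.comp p ((hFd (u p)).hasFDerivAt.comp p (hud p).hasFDerivAt)).fderiv
  refine ⟨fun v hv => ?_, ?_, ?_⟩
  · exact eqOn_tangentPlane_fderiv (hud.comp (hFd.comp hud) p) (hf.differentiable (by simp) p) hp
      (Eventually.of_forall huFu) ((hs.mem_tangentPlane_iff p hp v).2 hv)
  · have hcomp := hα.comp_fderiv (hfU' (huS hp))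
    rw [hfu p hp, hui, ← hfu p hp] at hcomp
    rw [hderiv, ← ContinuousLinearMap.comp_assoc, hcomp, ← ContinuousLinearMap.comp_assoc,
      ContinuousLinearMap.neg_comp, h.comp_eq, ContinuousLinearMap.neg_comp,
      hβ.comp_fderiv (hSU hp), neg_neg]
  · rw [hderiv, det_comp, det_comp]
    exact mul_pos (hα.det_fderiv_pos hu (hfU' (huS hp)))
      (mul_pos h.det_pos (hβ.det_fderiv_pos hu (hSU hp)))

/-- `F` is an equivariant map on the neighborhood `N` of `S` that pulls `α` back to `β` along `S`
and preserves the orientation along `S`. -/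
structure IsEquivariantContactGerm (u : R3 → R3) (S : Set R3) (α β : R3 → R3 →L[ℝ] ℝ)
    (N : Set R3) (F : R3 → R3) : Prop where
  isOpen : IsOpen N
  subset : S ⊆ N
  mapsTo_involution : MapsTo u N N
  contDiffOn : ContDiffOn ℝ ∞ F N
  equivariant : ∀ x ∈ N, F (u x) = u (F x)
  comp_eq : ∀ p ∈ S, (α (F p)).comp (fderiv ℝ F p) = β p
  det_pos : ∀ p ∈ S, 0 < (fderiv ℝ F p).det

theorem IsMatchingImmersion.exists_isEquivariantContactGerm (hf : IsMatchingImmersion S α β f)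
    (hu : ContDiff ℝ ∞ u) (hui : Function.Involutive u) (hS : IsCompact S) (huS : MapsTo u S S)
    (hs : IsDefiningFunction S Ω s) (hα : IsInvariantContactForm u U' α)
    (hβ : IsInvariantContactForm u U β) (hSU : S ⊆ U) (hfU' : MapsTo f S U')
    (hfu : ∀ p ∈ S, f (u p) = u (f p)) :
    ∃ N F, IsEquivariantContactGerm u S α β N F ∧ EqOn F f S := by
  obtain ⟨F, hF, hFf, hFext⟩ := hf.exists_extension hS.isClosed hs hα hβ hSU hfU'
  obtain ⟨N, F', hN, hSN, huN, hF', hF'F, hF'u, hdF'⟩ := exists_equivariant_average hu hui hS huS hF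
    fun p hp => by rw [hFf (huS hp), hFf hp, hfu p hp]
  have hF'f : EqOn F' f S := hF'F.trans hFf
  have hext (p) (hp : p ∈ S) : IsContactExtension (fderiv ℝ s p) (fderiv ℝ f p) (α (F' p)) (β p)
      (fderiv ℝ F' p) := by
    rw [hdF' p hp, smul_add, hF'f hp]
    exact convex_setOf_isContactExtension (hs.fderiv_ne_zero hp) (hFext p hp)
      ((hFext (u p) (huS hp)).conjugate hu hui huS hs hα hβ hSU hfU' hf.contDiff hF hfu hFf hp)
      (by norm_num) (by norm_num) (by norm_num)
  exact ⟨N, F', ⟨hN, hSN, huN, hF', hF'u, fun p hp => (hext p hp).comp_eq,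
    fun p hp => (hext p hp).det_pos⟩, hF'f⟩

end EquivariantExtension

section Contactomorphism

variable {u F : R3 → R3} {S U U' N O : Set R3} {α β : R3 → R3 →L[ℝ] ℝ}

theorem IsInvariantContactForm.mono (hα : IsInvariantContactForm u U α) (hO : IsOpen O)
    (huO : MapsTo u O O) (hOU : O ⊆ U) : IsInvariantContactForm u O α :=
  ⟨hO, huO, hα.smooth.mono hOU, fun p hp => hα.positive p (hOU hp),
    fun p hp => hα.antiInvariant p (hOU hp)⟩

theorem fderiv_comp_fderiv_of_equivariant (hu : Differentiable ℝ u) (hN : IsOpen N)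
    (huN : MapsTo u N N) (hF : DifferentiableOn ℝ F N) (hFu : ∀ x ∈ N, F (u x) = u (F x)) {x : R3}
    (hx : x ∈ N) : (fderiv ℝ F (u x)).comp (fderiv ℝ u x) =
      (fderiv ℝ u (F x)).comp (fderiv ℝ F x) := by
  have hFd (y) (hy : y ∈ N) := (hF.differentiableAt (hN.mem_nhds hy)).hasFDerivAt
  exact ((hFd (u x) (huN hx)).comp x (hu x).hasFDerivAt).unique
    (((hu (F x)).hasFDerivAt.comp x (hFd x hx)).congr_of_eventuallyEq
      (mem_of_superset (hN.mem_nhds hx) hFu))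

theorem IsInvariantContactForm.pullbackForm (hα : IsInvariantContactForm u U' α)
    (hu : Differentiable ℝ u) (hO : IsOpen O) (huO : MapsTo u O O) (hF : ContDiffOn ℝ ∞ F O)
    (hFU' : MapsTo F O U') (hFu : ∀ x ∈ O, F (u x) = u (F x))
    (hdet : ∀ x ∈ O, 0 < (fderiv ℝ F x).det) :
    IsInvariantContactForm u O (pullbackForm F α) where
  isOpen := hO
  mapsTo := huO
  smooth := contDiffOn_pullbackForm hO hF hα.smooth hFU'
  positive p hp := by
    rw [contactVolume_pullbackForm (hF.contDiffAt (hO.mem_nhds hp))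
      (hα.differentiableAt (hFU' hp))]
    exact mul_pos (hα.positive _ (hFU' hp)) (hdet p hp)
  antiInvariant p hp v := by
    have := congr($(fderiv_comp_fderiv_of_equivariant hu hO huO (hF.differentiableOn (by simp)) hFu
      hp) v)
    simp only [ContinuousLinearMap.comp_apply] at this
    simp only [EquivContact.pullbackForm, ContinuousLinearMap.comp_apply, this, hFu p hp,
      hα.antiInvariant _ (hFU' hp)]

theorem map_contactPlane_eq {L : R3 →L[ℝ] R3} {p q : R3} (hL : L.IsInvertible) (hα : α q ≠ 0)
    (h : ∀ v, β p v = 0 → α q (L v) = 0) :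
    (contactPlane β p).map (L : R3 →ₗ[ℝ] R3) = contactPlane α q := by
  obtain ⟨L, rfl⟩ := hL
  have hne : (α q).comp (L : R3 →L[ℝ] R3) ≠ 0 := fun h0 => hα <| by
    ext v
    simpa using congr($h0 (L.symm v))
  have hker := apply_eq_zero_iff_of_imp (B := (α q).comp (L : R3 →L[ℝ] R3)) h hne
  ext w
  refine ⟨fun ⟨v, hv, hvw⟩ => hvw ▸ (hker v).2 hv, fun hw => ⟨L.symm w, (hker _).1 ?_, ?_⟩⟩
  · have hw : α q w = 0 := hw
    simpa using hw
  · simp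

theorem exists_isEquivariantContacto_of_injOn {g : R3 → R3} {V : Set R3} (hu : Continuous u)
    (hui : Function.Involutive u) (hS : IsCompact S) (huS : MapsTo u S S) (hV : IsOpen V)
    (hSV : S ⊆ V) (hg : ContDiffOn ℝ ∞ g V) (hgu : ∀ x ∈ V, g (u x) = u (g x)) (hinj : InjOn g S)
    (hg' : ∀ p ∈ S, (fderiv ℝ g p).IsInvertible) (hα : ∀ x ∈ V, α (g x) ≠ 0)
    (hker : ∀ x ∈ V, ∀ v, β x v = 0 → α (g x) (fderiv ℝ g x v) = 0) :
    ∃ ψ : OpenPartialHomeomorph R3 R3, S ⊆ ψ.source ∧ ψ.source ⊆ V ∧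
      IsEquivariantContacto u β α ψ ∧ ∀ x, ψ x = g x := by
  obtain ⟨W, hW, hSW, hWV, hWinj, hW'⟩ :=
    exists_isOpen_injOn_of_isInvertible_fderiv hS hV hSV hg hinj hg'
  have hsub : W ∩ u ⁻¹' W ⊆ V := inter_subset_left.trans hWV
  obtain ⟨ψ, hψ, hψg, hψsymm⟩ := exists_openPartialHomeomorph_of_isInvertible_fderiv
    (hW.inter (hW.preimage hu)) (hg.mono hsub) (hWinj.mono inter_subset_left)
    fun x hx => hW' x hx.1
  have hψu : MapsTo u ψ.source ψ.source := by
    rw [hψ]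
    exact fun x hx => ⟨hx.2, by rw [mem_preimage, hui x]; exact hx.1⟩
  have hequiv (x) (hx : x ∈ ψ.source) : ψ (u x) = u (ψ x) := by
    rw [hψg, hψg, hgu x (hsub (hψ ▸ hx))]
  refine ⟨ψ, hψ ▸ fun p hp => ⟨hSW hp, hSW (huS hp)⟩, hψ ▸ hsub,
    ⟨hψu, fun y hy => ?_, ?_, hψsymm, hequiv, fun x hx => ?_⟩, hψg⟩
  · rw [← ψ.right_inv hy, ← hequiv _ (ψ.map_target hy)]
    exact ψ.map_source (hψu (ψ.map_target hy))
  · rw [hψ]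
    exact (hg.mono hsub).congr fun x _ => hψg x
  · rw [hψ] at hx
    rw [funext hψg]
    exact map_contactPlane_eq (hW' x hx.1) (hα x (hsub hx)) (hker x (hsub hx))

namespace IsEquivariantContactGerm

theorem exists_isInvariantContactForm (hF : IsEquivariantContactGerm u S α β N F)
    (hu : ContDiff ℝ ∞ u) (hα : IsInvariantContactForm u U' α)
    (hβ : IsInvariantContactForm u U β) (hSU : S ⊆ U) (hFU' : MapsTo F S U') :
    ∃ O, S ⊆ O ∧ O ⊆ N ∩ U ∧ MapsTo F O U' ∧ IsInvariantContactForm u O β ∧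
      IsInvariantContactForm u O (pullbackForm F α) ∧ ∀ x ∈ O, 0 < (fderiv ℝ F x).det := by
  have hud := hu.differentiable (by simp)
  set O := ((N ∩ (fun x => (fderiv ℝ F x).det) ⁻¹' Ioi 0) ∩ (N ∩ F ⁻¹' U')) ∩ U
  have hO : IsOpen O :=
    (((ContinuousLinearMap.continuous_det.comp_continuousOn
      (hF.contDiffOn.continuousOn_fderiv_of_isOpen hF.isOpen (by simp))).isOpen_inter_preimage
      hF.isOpen isOpen_Ioi).inter
      (hF.contDiffOn.continuousOn.isOpen_inter_preimage hF.isOpen hα.isOpen)).inter hβ.isOpen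
  have hON : O ⊆ N := fun x hx => hx.1.1.1
  have huO : MapsTo u O O := by
    rintro x ⟨⟨⟨hxN, hdet⟩, -, hxU'⟩, hxU⟩
    have hFx : F (u x) ∈ U' := hF.equivariant x hxN ▸ hα.mapsTo hxU'
    refine ⟨⟨⟨hF.mapsTo_involution hxN, ?_⟩, hF.mapsTo_involution hxN, hFx⟩, hβ.mapsTo hxU⟩
    have := congrArg ContinuousLinearMap.det (fderiv_comp_fderiv_of_equivariant hud hF.isOpen
      hF.mapsTo_involution (hF.contDiffOn.differentiableOn (by simp)) hF.equivariant hxN)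
    rw [det_comp, det_comp] at this
    exact pos_of_mul_pos_left (this ▸ mul_pos (hα.det_fderiv_pos hu hxU') hdet)
      (hβ.det_fderiv_pos hu hxU).le
  exact ⟨O, fun p hp => ⟨⟨⟨hF.subset hp, hF.det_pos p hp⟩, hF.subset hp, hFU' hp⟩, hSU hp⟩,
    fun x hx => ⟨hON hx, hx.2⟩, fun x hx => hx.1.2.2, hβ.mono hO huO fun x hx => hx.2,
    hα.pullbackForm hud hO huO (hF.contDiffOn.mono hON) (fun x hx => hx.1.2.2)
      (fun x hx => hF.equivariant x (hON hx)) fun x hx => hx.1.1.2, fun x hx => hx.1.1.2⟩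

theorem exists_isEquivariantContacto (hF : IsEquivariantContactGerm u S α β N F)
    (hu : ContDiff ℝ ∞ u) (hui : Function.Involutive u) (hS : IsCompact S) (huS : MapsTo u S S)
    (hα : IsInvariantContactForm u U' α) (hβ : IsInvariantContactForm u U β) (hSU : S ⊆ U)
    (hFU' : MapsTo F S U') (hinj : InjOn F S) :
    ∃ ψ : OpenPartialHomeomorph R3 R3, S ⊆ ψ.source ∧ ψ.source ⊆ U ∧ ψ.target ⊆ U' ∧
      IsEquivariantContacto u β α ψ ∧ EqOn ψ F S := by
  obtain ⟨O, hSO, hO, hOU', hβO, hFα, hdet⟩ := hF.exists_isInvariantContactForm hu hα hβ hSU hFU'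
  obtain ⟨M, χ, hχ⟩ := exists_isContactIsotopyEnd hu hui hβO hFα hS hSO huS
    fun p hp => ⟨1, one_pos, by rw [one_smul]; exact hF.comp_eq p hp⟩
  have hχM : MapsTo χ (M ∩ U) O := fun x hx => hχ.mapsTo hx.1
  have hderiv (x) (hx : x ∈ M) : fderiv ℝ (fun x => F (χ x)) x =
      (fderiv ℝ F (χ x)).comp (fderiv ℝ χ x) :=
    fderiv_comp x ((hF.contDiffOn.contDiffAt (hF.isOpen.mem_nhds (hO (hχ.mapsTo hx)).1)
      ).differentiableAt (by simp)) (hχ.contDiff.differentiable (by simp) x)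
  obtain ⟨ψ, hSψ, hψM, hψ, hψF⟩ := exists_isEquivariantContacto_of_injOn (α := α) (β := β)
    (g := fun x => F (χ x)) hu.continuous hui hS huS (hχ.isOpen.inter hβ.isOpen)
    (fun p hp => ⟨hχ.subset hp, hSU hp⟩)
    (hF.contDiffOn.comp hχ.contDiff.contDiffOn fun x hx => (hO (hχM hx)).1)
    (fun x hx => by
      simp only [hχ.equivariant x hx.1, hF.equivariant _ (hO (hχM hx)).1])
    (hinj.congr fun p hp => by simp only [hχ.eqOn_id hp, id])
    (fun p hp => by
      rw [hderiv p (hχ.subset hp)]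
      exact (isInvertible_of_det_ne_zero
        (hdet _ (hχ.mapsTo (hχ.subset hp))).ne').comp
        ⟨(LinearEquiv.ofInjectiveEndo _ (hχ.injective_fderiv p)).toContinuousLinearEquiv, rfl⟩)
    (fun x hx => hα.ne_zero (hOU' (hχM hx)))
    (fun x hx v hv => by
      rw [hderiv x hx.1]
      exact hχ.apply_eq_zero x hx.1 v hv)
  refine ⟨ψ, hSψ, fun x hx => (hψM hx).2, fun y hy => ?_, hψ, fun p hp => ?_⟩
  · rw [← ψ.right_inv hy, hψF]
    exact hOU' (hχM (hψM (ψ.map_target hy)))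
  · rw [hψF, hχ.eqOn_id hp, id]

end IsEquivariantContactGerm

end Contactomorphism

section AreaRatio

variable {f k : R3 → R3} {S S' : Set R3} {s : R3 → ℝ} {Ω Ω' : R3 → R3 [⋀^Fin 2]→L[ℝ] ℝ} {p : R3}

theorem IsAreaForm.exists_isDefiningFunction (hΩ : IsAreaForm S Ω) (hS : IsCompactSurface S) :
    ∃ s, IsDefiningFunction S Ω s := by
  obtain ⟨θ, hθ, hθΩ⟩ := hΩ.smooth.exists_contDiff hS.compact.isClosed
  obtain ⟨s, hs⟩ := EquivContact.exists_isDefiningFunction hS hθ.continuous fun p hp => by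
    rw [hθΩ hp]
    exact hΩ.nonvanishing p hp
  exact ⟨s, hs.contDiff, hs.eq_zero, fun p hp => hθΩ hp ▸ hs.wedge_pos p hp,
    hs.mem_tangentPlane_iff⟩

/-- The factor by which the restriction of `f` to the surface `{s = 0}` changes area, measured with
`Ω` in the source and with `Ω'` in the target. -/
def areaRatio (s : R3 → ℝ) (Ω Ω' : R3 → R3 [⋀^Fin 2]→L[ℝ] ℝ) (f : R3 → R3) (p : R3) : ℝ :=
  wedge (fderiv ℝ s p) ((Ω' (f p)).compContinuousLinearMap (fderiv ℝ f p)) /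
    wedge (fderiv ℝ s p) (Ω p)

theorem areaRatio_mul_apply (hs : IsDefiningFunction S Ω s) (hp : p ∈ S) {v w : R3}
    (hv : v ∈ tangentPlane S p) (hw : w ∈ tangentPlane S p) :
    areaRatio s Ω Ω' f p * Ω p ![v, w] = Ω' (f p) ![fderiv ℝ f p v, fderiv ℝ f p w] := by
  obtain ⟨n, hn⟩ := DFunLike.ne_iff.1 (hs.fderiv_ne_zero hp)
  have hvol (θ : R3 [⋀^Fin 2]→L[ℝ] ℝ) :
      wedge (fderiv ℝ s p) θ * vol v w n = fderiv ℝ s p n * θ ![v, w] := by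
    rw [wedge_mul_vol, (hs.mem_tangentPlane_iff p hp v).1 hv,
      (hs.mem_tangentPlane_iff p hp w).1 hw, zero_mul, zero_mul, zero_add, zero_add]
  have hpull := hvol ((Ω' (f p)).compContinuousLinearMap (fderiv ℝ f p))
  rw [ContinuousAlternatingMap.compContinuousLinearMap_apply, comp_vec_two] at hpull
  rw [areaRatio, div_mul_eq_mul_div, div_eq_iff (hs.wedge_pos p hp).ne']
  refine mul_left_cancel₀ hn ?_
  linear_combination wedge (fderiv ℝ s p) (Ω p) * hpull -
    wedge (fderiv ℝ s p) ((Ω' (f p)).compContinuousLinearMap (fderiv ℝ f p)) * hvol (Ω p)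

theorem contDiff_twoForm_apply {X : Type*} [NormedAddCommGroup X] [NormedSpace ℝ X]
    {θ : X → R3 [⋀^Fin 2]→L[ℝ] ℝ} {v w : X → R3} (hθ : ContDiff ℝ ∞ θ) (hv : ContDiff ℝ ∞ v)
    (hw : ContDiff ℝ ∞ w) : ContDiff ℝ ∞ fun x => θ x ![v x, w x] := by
  have hθ' (y) : ContDiff ℝ ∞ fun x => θ x y :=
    (ContinuousAlternatingMap.apply ℝ R3 ℝ y).contDiff.comp hθ
  simp only [twoForm_expand (θ _) (v _)]
  fun_prop

theorem contDiff_wedge_pullback {A : R3 → R3 →L[ℝ] ℝ} {θ : R3 → R3 [⋀^Fin 2]→L[ℝ] ℝ}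
    (hA : ContDiff ℝ ∞ A) (hθ : ContDiff ℝ ∞ θ) (hf : ContDiff ℝ ∞ f) :
    ContDiff ℝ ∞ fun x => wedge (A x) ((θ (f x)).compContinuousLinearMap (fderiv ℝ f x)) := by
  have hdf (v) : ContDiff ℝ ∞ fun x => fderiv ℝ f x v :=
    (hf.fderiv_right (by simp)).clm_apply contDiff_const
  have hA' (v) : ContDiff ℝ ∞ fun x => A x v := hA.clm_apply contDiff_const
  have hθ' (v w) := contDiff_twoForm_apply (hθ.comp hf) (hdf v) (hdf w)
  simp only [wedge, ContinuousAlternatingMap.compContinuousLinearMap_apply, comp_vec_two]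
  exact (((hA' _).mul (hθ' _ _)).add ((hA' _).mul (hθ' _ _))).add ((hA' _).mul (hθ' _ _))

theorem smoothOnSet_areaRatio (hS : IsClosed S) (hS' : IsClosed S') (hs : IsDefiningFunction S Ω s)
    (hΩ : SmoothOnSet Ω S) (hΩ' : SmoothOnSet Ω' S') (hf : ContDiff ℝ ∞ f) (hfS : MapsTo f S S') :
    SmoothOnSet (areaRatio s Ω Ω' f) S := by
  obtain ⟨θ, hθ, hθΩ⟩ := hΩ.exists_contDiff hS
  obtain ⟨θ', hθ', hθΩ'⟩ := hΩ'.exists_contDiff hS'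
  have hds : ContDiff ℝ ∞ (fderiv ℝ s) := hs.contDiff.fderiv_right (by simp)
  have hwedge : ContDiff ℝ ∞ fun x => wedge (fderiv ℝ s x) (θ x) :=
    contDiffOn_univ.1 (contDiffOn_wedge hds.contDiffOn hθ.contDiffOn)
  refine fun p hp => ⟨{x | wedge (fderiv ℝ s x) (θ x) ≠ 0}, areaRatio s θ θ' f,
    isOpen_ne_fun hwedge.continuous continuous_const, ?_,
    (contDiff_wedge_pullback hds hθ' hf).contDiffOn.div hwedge.contDiffOn fun x hx => hx,
    fun x hx => ?_⟩
  · rw [mem_ofPred_eq, hθΩ hp]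
    exact (hs.wedge_pos p hp).ne'
  · rw [areaRatio, areaRatio, hθΩ hx.1, hθΩ' (hfS hx.1)]

theorem fderiv_apply_fderiv_of_leftInvOn (hf : DifferentiableAt ℝ f p)
    (hk : DifferentiableAt ℝ k (f p)) (hkf : LeftInvOn k f S) (hp : p ∈ S) {v : R3}
    (hv : v ∈ tangentPlane S p) : fderiv ℝ k (f p) (fderiv ℝ f p v) = v := by
  have := eqOn_tangentPlane_fderiv (f := fun x => k (f x)) (hk.comp p hf) differentiableAt_id hp
    (Eventually.of_forall hkf) hv
  rwa [fderiv_fun_comp p hk hf, fderiv_id] at this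

theorem areaRatio_ne_zero (hs : IsDefiningFunction S Ω s)
    (hΩ' : ∃ v ∈ tangentPlane S' (f p), ∃ w ∈ tangentPlane S' (f p), Ω' (f p) ![v, w] ≠ 0)
    (hf : DifferentiableAt ℝ f p) (hk : DifferentiableAt ℝ k (f p)) (hfS : MapsTo f S S')
    (hkS : MapsTo k S' S) (hinv : InvOn k f S S') (hp : p ∈ S) : areaRatio s Ω Ω' f p ≠ 0 := by
  obtain ⟨v, hv, w, hw, hvw⟩ := hΩ'
  have hkfp := hinv.1 hp
  have hmem {y} (hy : y ∈ tangentPlane S' (f p)) : fderiv ℝ k (f p) y ∈ tangentPlane S p := by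
    simpa only [hkfp, SetLike.mem_coe] using
      mapsTo_tangentPlane hk.hasFDerivAt.hasFDerivWithinAt hkS hy
  have hright {y} (hy : y ∈ tangentPlane S' (f p)) : fderiv ℝ f p (fderiv ℝ k (f p) y) = y := by
    simpa only [hkfp] using
      fderiv_apply_fderiv_of_leftInvOn hk (hkfp.symm ▸ hf) hinv.2 (hfS hp) hy
  refine left_ne_zero_of_mul (b := Ω p ![fderiv ℝ k (f p) v, fderiv ℝ k (f p) w]) ?_
  rwa [areaRatio_mul_apply hs hp (hmem hv) (hmem hw), hright hv, hright hw]

theorem exists_isMatchingImmersion_smul {α α' : R3 → R3 →L[ℝ] ℝ} {X X' : R3 → R3} {l : R3 → ℝ}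
    (hS : IsCompactSurface S) (hΩ : IsAreaForm S Ω) (hΩ' : IsAreaForm S' Ω')
    (hX : IsCharacteristicField S Ω α X)
    (hX' : IsCharacteristicField S' Ω' α' X') (hf : ContDiff ℝ ∞ f) (hk : ContDiff ℝ ∞ k)
    (hfS : MapsTo f S S') (hkS : MapsTo k S' S) (hinv : InvOn k f S S') (hl : SmoothOnSet l S')
    (hl0 : ∀ q ∈ S', l q ≠ 0) (hlX : ∀ p ∈ S, X' (f p) = l (f p) • fderiv ℝ f p (X p)) :
    ∃ h : R3 → ℝ, ContDiff ℝ ∞ h ∧ (∀ p ∈ S, h p ≠ 0) ∧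
      IsMatchingImmersion S α' (fun p => h p • α p) f := by
  have hfd := hf.differentiable (by simp)
  have hkd := hk.differentiable (by simp)
  have hS' : IsClosed S' :=
    (hinv.bijOn hfS hkS).image_eq ▸ (hS.compact.image hf.continuous).isClosed
  obtain ⟨s, hs⟩ := hΩ.exists_isDefiningFunction hS
  obtain ⟨r, hr, hrs⟩ := (smoothOnSet_areaRatio hS.compact.isClosed hS' hs hΩ.smooth hΩ'.smooth hf
    hfS).exists_contDiff hS.compact.isClosed
  obtain ⟨m, hm, hml⟩ := hl.exists_contDiff hS'
  refine ⟨fun p => m (f p) * r p, (hm.comp hf).mul hr, fun p hp => mul_ne_zero ?_ ?_, hf,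
    fun p hp v hv hv0 => ?_, fun p hp v hv => ?_⟩
  · rw [hml (hfS hp)]
    exact hl0 _ (hfS hp)
  · rw [hrs hp]
    exact areaRatio_ne_zero hs (hΩ'.nonvanishing _ (hfS hp)) (hfd p) (hkd _) hfS hkS hinv hp
  · rw [← fderiv_apply_fderiv_of_leftInvOn (hfd p) (hkd _) hinv.1 hp hv, hv0, map_zero]
  · have hdfv := mapsTo_tangentPlane (hfd p).hasFDerivAt.hasFDerivWithinAt hfS hv
    have hX'v := (hX' _ (hfS hp)).2 _ hdfv
    have hsmul : Ω' (f p) ![l (f p) • fderiv ℝ f p (X p), fderiv ℝ f p v] =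
        l (f p) * Ω' (f p) ![fderiv ℝ f p (X p), fderiv ℝ f p v] := by
      rw [← toBilin_apply, map_smul, LinearMap.smul_apply, toBilin_apply, smul_eq_mul]
    rw [← hX'v, hlX p hp, hsmul, ← areaRatio_mul_apply hs hp (hX p hp).1 hv, (hX p hp).2 v hv]
    simp only [smul_apply, smul_eq_mul, hml (hfS hp), hrs hp, mul_assoc]

theorem pushforward_apply_eq {φ : PartialEquiv R3 R3} {X : R3 → R3}
    (hf : DifferentiableAt ℝ f p) (hfφ : EqOn f φ φ.source) (hp : p ∈ φ.source)
    (hX : X p ∈ tangentPlane φ.source p) :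
    pushforward φ X (f p) = fderiv ℝ f p (X p) := by
  have hd : HasFDerivWithinAt φ (fderiv ℝ f p) φ.source p :=
    hf.hasFDerivAt.hasFDerivWithinAt.congr (fun x hx => (hfφ hx).symm) (hfφ hp).symm
  rw [pushforward, hfφ hp, φ.left_inv hp]
  exact eqOn_tangentPlane hd.differentiableWithinAt.hasFDerivWithinAt hd hX

end AreaRatio

section ConformalFactor

variable {u f : R3 → R3} {S U U' : Set R3} {h : R3 → ℝ} {Ω : R3 → R3 [⋀^Fin 2]→L[ℝ] ℝ}
  {α α' : R3 → R3 →L[ℝ] ℝ}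

theorem IsInvariantContactForm.smul (hα : IsInvariantContactForm u U α) (hh : ContDiffOn ℝ ∞ h U)
    (hh0 : ∀ p ∈ U, h p ≠ 0) (hhu : ∀ p ∈ U, h (u p) = h p) :
    IsInvariantContactForm u U fun p => h p • α p where
  isOpen := hα.isOpen
  mapsTo := hα.mapsTo
  smooth := hh.smul hα.smooth
  positive p hp := by
    rw [contactVolume_smul ((hh.contDiffAt (hα.isOpen.mem_nhds hp)).differentiableAt (by simp))
      (hα.differentiableAt hp)]
    exact mul_pos (sq_pos_of_ne_zero (hh0 p hp)) (hα.positive p hp)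
  antiInvariant p hp v := by
    simp only [smul_apply, smul_eq_mul, hα.antiInvariant p hp, hhu p hp, mul_neg]

theorem contactPlane_smul {p : R3} (hp : h p ≠ 0) :
    contactPlane (fun q => h q • α q) p = contactPlane α p := by
  ext v
  simp [contactPlane, hp]

theorem IsEquivariantContacto.congr {β β' : R3 → R3 →L[ℝ] ℝ} {ψ : OpenPartialHomeomorph R3 R3}
    (hψ : IsEquivariantContacto u α α' ψ)
    (hβ : ∀ p ∈ ψ.source, contactPlane β p = contactPlane α p)
    (hβ' : ∀ q ∈ ψ.target, contactPlane β' q = contactPlane α' q) :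
    IsEquivariantContacto u β β' ψ :=
  ⟨hψ.source_invariant, hψ.target_invariant, hψ.smooth, hψ.smooth_symm, hψ.equivariant,
    fun p hp => by rw [hβ p hp, hβ' _ (ψ.map_source hp), hψ.map_contactPlane p hp]⟩

theorem IsMatchingImmersion.comp_involution
    (hf : IsMatchingImmersion S α' (fun p => h p • α p) f) (hu : ContDiff ℝ ∞ u)
    (huS : MapsTo u S S) (hα : IsInvariantContactForm u U α)
    (hα' : IsInvariantContactForm u U' α') (hSU : S ⊆ U) (hfU' : MapsTo f S U')
    (hfu : ∀ p ∈ S, f (u p) = u (f p)) :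
    IsMatchingImmersion S α' (fun p => h (u p) • α p) f where
  contDiff := hf.contDiff
  injective := hf.injective
  apply_eq p hp v hv := by
    have hud := hu.differentiable (by simp)
    have hfd := hf.contDiff.differentiable (by simp)
    have huv : fderiv ℝ u p v ∈ tangentPlane S (u p) :=
      mapsTo_tangentPlane (hud p).hasFDerivAt.hasFDerivWithinAt huS hv
    have hdfu : fderiv ℝ f (u p) (fderiv ℝ u p v) = fderiv ℝ u (f p) (fderiv ℝ f p v) := by
      have := eqOn_tangentPlane_fderiv (f := fun x => f (u x)) (g := fun x => u (f x))
        (hfd.comp hud p) (hud.comp hfd p) hp (Eventually.of_forall hfu) hv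
      rwa [fderiv_fun_comp p (hfd _) (hud p), fderiv_fun_comp p (hud _) (hfd p)] at this
    have := hf.apply_eq (u p) (huS hp) _ huv
    rw [hdfu, hfu p hp, hα'.antiInvariant _ (hfU' hp), smul_apply,
      hα.antiInvariant p (hSU hp), smul_neg, neg_inj] at this
    exact this

theorem IsMatchingImmersion.exists_invariant_factor
    (hf : IsMatchingImmersion S α' (fun p => h p • α p) f) (hu : ContDiff ℝ ∞ u)
    (hui : Function.Involutive u) (huS : MapsTo u S S) (hα : IsInvariantContactForm u U α)
    (hα' : IsInvariantContactForm u U' α') (hSU : S ⊆ U) (hfU' : MapsTo f S U')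
    (hfu : ∀ p ∈ S, f (u p) = u (f p)) (hh : ContDiff ℝ ∞ h) (hpos : ∀ p ∈ S, 0 < h p) :
    ∃ k : R3 → ℝ, ContDiff ℝ ∞ k ∧ (∀ p ∈ S, 0 < k p) ∧ (∀ p, k (u p) = k p) ∧
      IsMatchingImmersion S α' (fun p => k p • α p) f := by
  refine ⟨fun p => (1 / 2) * (h p + h (u p)), contDiff_const.mul (hh.add (hh.comp hu)),
    fun p hp => ?_, fun p => ?_, hf.contDiff, hf.injective, fun p hp v hv => ?_⟩
  · have := hpos p hp
    have := hpos _ (huS hp)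
    positivity
  · simp only [hui p, add_comm]
  · have hp₁ := hf.apply_eq p hp v hv
    have hp₂ := (hf.comp_involution hu huS hα hα' hSU hfU' hfu).apply_eq p hp v hv
    simp only [smul_apply, smul_eq_mul] at hp₁ hp₂ ⊢
    linear_combination (1 / 2 : ℝ) * hp₁ + (1 / 2 : ℝ) * hp₂

theorem IsMatchingImmersion.exists_isEquivariantContacto_of_pos
    (hf : IsMatchingImmersion S α' (fun p => h p • α p) f) (hu : ContDiff ℝ ∞ u)
    (hui : Function.Involutive u) (hS : IsCompactSurface S) (hΩ : IsAreaForm S Ω)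
    (huS : MapsTo u S S) (hα : IsInvariantContactForm u U α)
    (hα' : IsInvariantContactForm u U' α') (hSU : S ⊆ U) (hfU' : MapsTo f S U')
    (hfu : ∀ p ∈ S, f (u p) = u (f p)) (hinj : InjOn f S) (hh : ContDiff ℝ ∞ h)
    (hpos : ∀ p ∈ S, 0 < h p) :
    ∃ ψ : OpenPartialHomeomorph R3 R3, S ⊆ ψ.source ∧ ψ.source ⊆ U ∧ ψ.target ⊆ U' ∧
      IsEquivariantContacto u α α' ψ ∧ EqOn ψ f S := by
  obtain ⟨k, hk, hkpos, hku, hfk⟩ :=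
    hf.exists_invariant_factor hu hui huS hα hα' hSU hfU' hfu hh hpos
  obtain ⟨s, hs⟩ := hΩ.exists_isDefiningFunction hS
  have hkα : IsInvariantContactForm u (U ∩ {p | 0 < k p}) fun p => k p • α p :=
    (hα.mono (hα.isOpen.inter (isOpen_lt continuous_const hk.continuous))
      (fun p hp => ⟨hα.mapsTo hp.1, lt_of_lt_of_eq hp.2 (hku p).symm⟩) inter_subset_left).smul
      hk.contDiffOn (fun p hp => hp.2.ne') fun p _ => hku p
  have hSk : S ⊆ U ∩ {p | 0 < k p} := fun p hp => ⟨hSU hp, hkpos p hp⟩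
  obtain ⟨N, F, hF, hFf⟩ := hfk.exists_isEquivariantContactGerm hu hui hS.compact huS hs hα' hkα
    hSk hfU' hfu
  obtain ⟨ψ, hSψ, hψ, hψ', hψα, hψF⟩ := hF.exists_isEquivariantContacto hu hui hS.compact huS hα'
    hkα hSk (hfU'.congr hFf.symm) (hinj.congr hFf.symm)
  exact ⟨ψ, hSψ, hψ.trans inter_subset_left, hψ',
    hψα.congr (fun p hp => (contactPlane_smul (hψ hp).2.ne').symm) fun _ _ => rfl,
    hψF.trans hFf⟩

theorem forall_pos_or_forall_neg {X : Type*} [TopologicalSpace X] {A : Set X} {g : X → ℝ}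
    (hA : IsPreconnected A) (hg : ContinuousOn g A) (hg0 : ∀ x ∈ A, g x ≠ 0) :
    (∀ x ∈ A, 0 < g x) ∨ ∀ x ∈ A, g x < 0 := by
  by_contra! ⟨⟨x, hx, hgx⟩, y, hy, hgy⟩
  obtain ⟨z, hz, hgz⟩ := hA.intermediate_value hx hy hg ⟨hgx, hgy⟩
  exact hg0 z hz hgz

theorem IsMatchingImmersion.exists_isEquivariantContacto
    (hf : IsMatchingImmersion S α' (fun p => h p • α p) f) (hu : ContDiff ℝ ∞ u)
    (hui : Function.Involutive u) (hS : IsCompactSurface S) (hΩ : IsAreaForm S Ω)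
    (huS : MapsTo u S S) (hα : IsInvariantContactForm u U α)
    (hα' : IsInvariantContactForm u U' α') (hSU : S ⊆ U) (hfU' : MapsTo f S U')
    (hfu : ∀ p ∈ S, f (u p) = u (f p)) (hinj : InjOn f S) (hh : ContDiff ℝ ∞ h)
    (hh0 : ∀ p ∈ S, h p ≠ 0) :
    ∃ ψ : OpenPartialHomeomorph R3 R3, S ⊆ ψ.source ∧ ψ.source ⊆ U ∧ ψ.target ⊆ U' ∧
      IsEquivariantContacto u α α' ψ ∧ EqOn ψ f S := by
  rcases forall_pos_or_forall_neg hS.connected.isPreconnected hh.continuous.continuousOn hh0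
    with hpos | hneg
  · exact hf.exists_isEquivariantContacto_of_pos hu hui hS hΩ huS hα hα' hSU hfU' hfu hinj hh hpos
  · have hf' : IsMatchingImmersion S (fun x => -α' x) (fun p => -h p • α p) f :=
      ⟨hf.contDiff, hf.injective, fun p hp v hv => by
        rw [neg_apply, hf.apply_eq p hp v hv]
        exact congr($(neg_smul (h p) (α p)) v).symm⟩
    obtain ⟨ψ, hSψ, hψU, hψU', hψ, hψf⟩ := hf'.exists_isEquivariantContacto_of_pos hu hui hS hΩ huS
      hα hα'.neg hSU hfU' hfu hinj hh.neg fun p hp => neg_pos.2 (hneg p hp)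
    refine ⟨ψ, hSψ, hψU, hψU', hψ.congr (fun _ _ => rfl) fun q _ => ?_, hψf⟩
    ext v
    simp [contactPlane]

end ConformalFactor

end EquivContact

open EquivContact in
theorem proposition2p4_general {u : R3 → R3} (hu : ContDiff ℝ ∞ u) (hui : Function.Involutive u)
    {S₀ S₁ : Set R3} (hS₀ : IsCompactSurface S₀) (huS₀ : MapsTo u S₀ S₀)
    {Ω₀ Ω₁ : R3 → R3 [⋀^Fin 2]→L[ℝ] ℝ} (hΩ₀ : IsAreaForm S₀ Ω₀) (hΩ₁ : IsAreaForm S₁ Ω₁)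
    {U₀ U₁ : Set R3} (hSU₀ : S₀ ⊆ U₀) (hSU₁ : S₁ ⊆ U₁) {α₀ α₁ : R3 → R3 →L[ℝ] ℝ}
    (hα₀ : IsInvariantContactForm u U₀ α₀) (hα₁ : IsInvariantContactForm u U₁ α₁)
    {X₀ X₁ : R3 → R3} (hX₀ : IsCharacteristicField S₀ Ω₀ α₀ X₀)
    (hX₁ : IsCharacteristicField S₁ Ω₁ α₁ X₁) {φ : PartialEquiv R3 R3}
    (hφ : IsEquivariantDiffeo u S₀ S₁ φ) {l : R3 → ℝ} (hl : SmoothOnSet l S₁)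
    (hl0 : ∀ q ∈ S₁, l q ≠ 0) (hlX : ∀ q ∈ S₁, X₁ q = l q • pushforward φ X₀ q) :
    ∃ ψ : OpenPartialHomeomorph R3 R3, S₀ ⊆ ψ.source ∧ ψ.source ⊆ U₀ ∧ S₁ ⊆ ψ.target ∧
      ψ.target ⊆ U₁ ∧ IsEquivariantContacto u α₀ α₁ ψ ∧ EqOn ψ φ S₀ := by
  obtain ⟨rfl, rfl, hφs, hφs', hφu⟩ := hφ
  obtain ⟨f, hf, hfφ⟩ := hφs.exists_contDiff hS₀.compact.isClosed
  have hfS : MapsTo f φ.source φ.target := φ.mapsTo.congr hfφ.symm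
  have himage : f '' φ.source = φ.target := hfφ.image_eq.trans φ.image_source_eq_target
  obtain ⟨k, hk, hkφ⟩ := hφs'.exists_contDiff
    (himage ▸ (hS₀.compact.image hf.continuous).isClosed)
  have hinv : InvOn k f φ.source φ.target := by
    refine ⟨fun p hp => ?_, fun q hq => ?_⟩
    · rw [hkφ (hfS hp), hfφ hp, φ.left_inv hp]
    · rw [hkφ hq, hfφ (φ.map_target hq), φ.right_inv hq]
  obtain ⟨h, hh, hh0, hfα⟩ := exists_isMatchingImmersion_smul hS₀ hΩ₀ hΩ₁ hX₀ hX₁ hf hk hfS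
    (φ.mapsTo_symm.congr hkφ.symm) hinv hl hl0 fun p hp => by
      rw [hlX _ (hfS hp), pushforward_apply_eq (hf.differentiable (by simp) p) hfφ hp (hX₀ p hp).1]
  obtain ⟨ψ, hSψ, hψU₀, hψU₁, hψ, hψf⟩ := hfα.exists_isEquivariantContacto hu hui hS₀ hΩ₀ huS₀ hα₀
    hα₁ hSU₀ (hfS.mono_right hSU₁) (fun p hp => by rw [hfφ (huS₀ hp), hfφ hp, hφu p hp])
    hinv.1.injOn hh hh0
  refine ⟨ψ, hSψ, hψU₀, ?_, hψU₁, hψ, hψf.trans hfφ⟩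
  rw [← himage, ← hψf.image_eq]
  exact image_subset_iff.2 fun p hp => ψ.map_source (hSψ hp)

theorem proposition2p4
    (u : EquivContact.R3 → EquivContact.R3) (hu : EquivContact.IsAxialInvolution u)
    (S₀ S₁ : Set EquivContact.R3)
    (Ω₀ Ω₁ : EquivContact.R3 → EquivContact.R3 [⋀^Fin 2]→L[ℝ] ℝ)
    (hS₀ : EquivContact.IsUOrientedCompactSurface u S₀ Ω₀)
    (hS₁ : EquivContact.IsUOrientedCompactSurface u S₁ Ω₁)
    (U₀ U₁ : Set EquivContact.R3) (hSU₀ : S₀ ⊆ U₀) (hSU₁ : S₁ ⊆ U₁)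
    (α₀ α₁ : EquivContact.R3 → EquivContact.R3 →L[ℝ] ℝ)
    (hα₀ : EquivContact.IsInvariantContactForm u U₀ α₀)
    (hα₁ : EquivContact.IsInvariantContactForm u U₁ α₁)
    (X₀ X₁ : EquivContact.R3 → EquivContact.R3)
    (hX₀ : EquivContact.IsCharacteristicField S₀ Ω₀ α₀ X₀)
    (hX₁ : EquivContact.IsCharacteristicField S₁ Ω₁ α₁ X₁)
    (φ : PartialEquiv EquivContact.R3 EquivContact.R3)
    (hφ : EquivContact.IsEquivariantDiffeo u S₀ S₁ φ)
    (hfol : EquivContact.SameFoliation u S₁ (EquivContact.pushforward φ X₀) X₁) :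
    ∃ ψ : OpenPartialHomeomorph EquivContact.R3 EquivContact.R3,
      S₀ ⊆ ψ.source ∧ ψ.source ⊆ U₀ ∧ S₁ ⊆ ψ.target ∧ ψ.target ⊆ U₁ ∧
      EquivContact.IsEquivariantContacto u α₀ α₁ ψ ∧
      Set.EqOn ψ φ S₀ := by
  obtain ⟨l, hl, hl0, -, hlX⟩ := hfol
  exact proposition2p4_general hu.smooth hu.involutive hS₀.surface hS₀.area.mapsTo
    ⟨hS₀.area.smooth, hS₀.area.nonvanishing⟩ ⟨hS₁.area.smooth, hS₁.area.nonvanishing⟩ hSU₀ hSU₁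
    hα₀ hα₁ hX₀ hX₁ hφ hl (fun q hq => (hl0 q hq).ne') hlX

end
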